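/- **Definitions.** A *sampling problem* is a family $S=(\mathcal{D}_x)_{x\in\{0,1\}^*}$ where, for some fixed polynomial $p$, $\mathcal{D}_x$ is a probability distribution over $\{0,1\}^{p(|x|)}$. A *search problem* is a family $R=(A_x)_{x\in\{0,1\}^*}$ of nonempty sets where, for some fixed polynomial $p$, $A_x\subseteq\{0,1\}^{p(|x|)}$. An algorithm receives an input $\langle x,0^{1/\varepsilon}\rangle$, with $1/\varepsilon$ a positive integer, and is *polynomial-time* if it always halts in time polynomial in $|x|$ and $1/\varepsilon$. A *classical* algorithm is probabilistic (it may toss fair coins). A *quantum* algorithm is a classical one that moreover controls qubits, initially in the state $|0\rangle$: it may reset them to $|0\cdots 0\rangle$, apply the Hadamard, $\pi/8$ and controlled-NOT gates, and measure single qubits in the computational basis. Relative to an oracle $\mathcal{O}\subseteq\{0,1\}^*$, both kinds of algorithm may ask whether $w\in\mathcal{O}$, and a quantum algorithm may also apply the gate $|w\rangle|c\rangle\mapsto|w\rangle|c\oplus\mathcal{O}(w)\rangle$. $\mathsf{SampP}$ (respectively $\mathsf{SampBQP}$) is the class of sampling problems $(\mathcal{D}_x)_x$ for which there is a classical (respectively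 quantum) polynomial-time algorithm that, given $\langle x,0^{1/\varepsilon}\rangle$, samples from a distribution $\mathcal{C}$ with $\|\mathcal{C}-\mathcal{D}_x\|\le\varepsilon$, where $\|\mathcal{C}-\mathcal{D}\|=\frac12\sum_y|\mathcal{C}(y)-\mathcal{D}(y)|$. $\mathsf{FBPP}$ (respectively $\mathsf{FBQP}$) is the class of search problems $(A_x)_x$ for which there is a classical (respectively quantum) polynomial-time algorithm that, given $\langle x,0^{1/\varepsilon}\rangle$, outputs a $y$ with $\Pr[y\in A_x]\ge 1-\varepsilon$. For an oracle $\mathcal{O}$, the classes $\mathsf{SampP}^{\mathcal{O}}$, $\mathsf{SampBQP}^{\mathcal{O}}$, $\mathsf{FBPP}^{\mathcal{O}}$, $\mathsf{FBQP}^{\mathcal{O}}$ are defined in the same way with algorithms relative to $\mathcal{O}$. **Theorem.** $\mathsf{FBPP}=\mathsf{FBQP}$ if and only if $\mathsf{SampP}=\mathsf{SampBQP}$. Moreover, the equivalence relativizes: for every oracle $\mathcal{O}\subseteq\{0,1\}^*$, $\mathsf{FBPP}^{\mathcal{O}}=\mathsf{FBQP}^{\mathcal{O}}$ if and only if $\mathsf{SampP}^{\mathcal{O}}=\mathsf{SampBQP}^{\mathcal{O}}$.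 -/

import Mathlib

open scoped ENNReal NNReal

noncomputable section

namespace SampSearch

/-! ### Quantum memory

Qubits are numbered by `ℕ`. A computational basis state in which only finitely many qubits are `|1⟩`
is given by the finite set of those qubits; a state of the memory is a finite linear combination of
basis states. States are kept up to a nonzero scalar, so that projecting need not be followed by
rescaling; outcome probabilities are relative squared norms. -/

/-- Computational basis states: the finite set of qubits that are `|1⟩`. -/
abbrev Basis : Type := Finset ℕ

/-- (Unnormalised) state vectors of the quantum memory. -/
abbrev QState : Type := Basis →₀ ℂ

/-- The basis vector `|b⟩`. -/
def ket (b : Basis) : QState := Finsupp.single b 1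

/-- Flip qubit `t` of a basis state. -/
def flipBit (t : ℕ) (b : Basis) : Basis := symmDiff b {t}

/-- The linear extension of a map that is given on basis states. -/
def extend (U : Basis → QState) (ψ : QState) : QState := Finsupp.linearCombination ℂ U ψ

/-- The Hadamard gate on qubit `i`: `|0⟩ ↦ (|0⟩ + |1⟩)/√2`, `|1⟩ ↦ (|0⟩ - |1⟩)/√2`. -/
def hadGate (i : ℕ) : QState → QState :=
  extend fun b => ((Real.sqrt 2 : ℝ) : ℂ)⁻¹ •
    (ket (b.erase i) + (if i ∈ b then (-1 : ℂ) else 1) • ket (insert i b))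

/-- The `π/8` gate on qubit `i`: `|0⟩ ↦ |0⟩`, `|1⟩ ↦ e^{iπ/4} |1⟩`. -/
def tGate (i : ℕ) : QState → QState :=
  extend fun b => (if i ∈ b then Complex.exp (Complex.I * (Real.pi / 4)) else 1) • ket b

/-- The controlled-NOT gate with control `i` and target `j`; it does nothing if `i = j`. -/
def cnotGate (i j : ℕ) : QState → QState :=
  extend fun b => ket (if i ∈ b ∧ i ≠ j then flipBit j b else b)

/-- The string stored by a basis state in the qubits `a, a + 1, …, a + l - 1`. -/
def readBits (a l : ℕ) (b : Basis) : List Bool := (List.range l).map fun i => decide (a + i ∈ b)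

open scoped Classical in
/-- The oracle gate `|w⟩|c⟩ ↦ |w⟩|c ⊕ A(w)⟩`, where `w` is stored in the qubits `a, …, a + l - 1`
and `c` in qubit `t`; it does nothing if `t` is one of the qubits of `w`. -/
def oracleGate (A : Set (List Bool)) (a l t : ℕ) : QState → QState :=
  extend fun b => ket (if readBits a l b ∈ A ∧ ¬(a ≤ t ∧ t < a + l) then flipBit t b else b)

/-- The squared norm of a state vector. -/
def normSq (ψ : QState) : ℝ≥0 := ψ.sum fun _ c => ‖c‖₊ ^ 2

/-- The projection of `ψ` to the basis states in which qubit `i` has the value `v`. -/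
def proj (i : ℕ) (v : Bool) (ψ : QState) : QState := ψ.filter fun b => decide (i ∈ b) = v

theorem normSq_eq_zero {ψ : QState} (h : normSq ψ = 0) : ψ = 0 := by
  ext b
  by_contra hb
  have h1 : ‖ψ b‖₊ ^ 2 ≤ normSq ψ :=
    Finset.single_le_sum (f := fun b => ‖ψ b‖₊ ^ 2) (fun _ _ => zero_le)
      (Finsupp.mem_support_iff.mpr hb)
  rw [h] at h1
  exact hb (by simpa using h1)

theorem proj_add (i : ℕ) (ψ : QState) : proj i true ψ + proj i false ψ = ψ := by
  ext b
  by_cases i ∈ b <;> simp [proj, *]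

theorem born_ne_zero (i : ℕ) {ψ : QState} (h : ψ ≠ 0) :
    (∑' v : Bool, (normSq (proj i v ψ) : ℝ≥0∞)) ≠ 0 := by
  intro h0
  rw [ENNReal.tsum_eq_zero] at h0
  apply h
  have ht : proj i true ψ = 0 := normSq_eq_zero (by exact_mod_cast h0 true)
  have hf : proj i false ψ = 0 := normSq_eq_zero (by exact_mod_cast h0 false)
  rw [← proj_add i ψ, ht, hf, add_zero]

theorem born_ne_top (i : ℕ) (ψ : QState) :
    (∑' v : Bool, (normSq (proj i v ψ) : ℝ≥0∞)) ≠ ∞ := by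
  rw [tsum_fintype]
  exact ENNReal.sum_ne_top.mpr fun _ _ => ENNReal.coe_ne_top

open scoped Classical in
/-- Born's rule: the outcome `v` of measuring qubit `i` has probability proportional to the squared
norm of the projection. (The zero vector, which is not a state and is never reached, gets a default
value.) -/
def measureDist (i : ℕ) (ψ : QState) : PMF Bool :=
  if h : ψ = 0 then PMF.pure false
  else PMF.normalize (fun v => (normSq (proj i v ψ) : ℝ≥0∞)) (born_ne_zero i h) (born_ne_top i ψ)

/-! ### Machines

A machine has finitely many stacks of bits (two stacks form a Turing tape), a source of fair coins,
access to an oracle `A ⊆ {0,1}*`, and a quantum memory which it controls classically. It is given by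
a structured program. Every elementary instruction and every test takes one step. A qubit is
addressed in unary: instructions act on the qubit whose number is the height of a given stack. -/

/-- Programs. -/
inductive Prog : Type
  /-- Do nothing. -/
  | skip
  /-- Push the bit `b` onto stack `r`. -/
  | push (r : ℕ) (b : Bool)
  /-- Remove the top of stack `r`, if there is one. -/
  | pop (r : ℕ)
  /-- First `p`, then `q`. -/
  | seq (p q : Prog)
  /-- Execute `pe`, `p0` or `p1` if stack `r` is empty, has top `0`, or has top `1`. -/
  | branch (r : ℕ) (pe p0 p1 : Prog)
  /-- While stack `r` is not empty, execute `p`. -/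
  | loop (r : ℕ) (p : Prog)
  /-- Push a fair coin toss onto stack `r`. -/
  | toss (r : ℕ)
  /-- Push the oracle's answer to the query string on stack `r` onto stack `t`. -/
  | query (r t : ℕ)
  /-- Discard the quantum memory and prepare a new one, with all qubits in the state `|0⟩`. -/
  | reset
  /-- Apply the Hadamard gate. -/
  | had (r : ℕ)
  /-- Apply the `π/8` gate. -/
  | tee (r : ℕ)
  /-- Apply the controlled-NOT gate. -/
  | cnot (r s : ℕ)
  /-- Apply the oracle gate: query block at the address `r`, of length `l`, and target `t`. -/
  | qquery (r l t : ℕ)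
  /-- Measure a qubit in the computational basis and push the outcome onto stack `t`. -/
  | measure (r t : ℕ)

/-- Classical (probabilistic) programs: those that never touch the quantum memory. -/
def Prog.Classical : Prog → Prop
  | .skip | .push _ _ | .pop _ | .toss _ | .query _ _ => True
  | .seq p q => p.Classical ∧ q.Classical
  | .branch _ pe p0 p1 => pe.Classical ∧ p0.Classical ∧ p1.Classical
  | .loop _ p => p.Classical
  | .reset | .had _ | .tee _ | .cnot _ _ | .qquery _ _ _ | .measure _ _ => False

/-- Memory contents; the head of a list is the top of the stack. -/
structure Mem where
  /-- The stacks. -/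
  reg : ℕ → List Bool
  /-- The quantum memory. -/
  qst : QState

/-- Replace the contents of stack `r`. -/
def Mem.set (m : Mem) (r : ℕ) (w : List Bool) : Mem := { m with reg := Function.update m.reg r w }

/-- Push a bit onto stack `r`. -/
def Mem.push (m : Mem) (r : ℕ) (b : Bool) : Mem := m.set r (b :: m.reg r)

/-- The height of stack `r`, used as the number of a qubit. -/
def Mem.addr (m : Mem) (r : ℕ) : ℕ := (m.reg r).length

/-- Apply a transformation to the quantum memory. -/
def Mem.apply (m : Mem) (U : QState → QState) : Mem := { m with qst := U m.qst }

/-- Configurations: the programs that remain to be executed, and the memory. The machine has halted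
when nothing remains to be executed. -/
abbrev Config : Type := List Prog × Mem

open scoped Classical in
/-- One step of the machine with oracle `A`. -/
def step (A : Set (List Bool)) : Config → PMF Config
  | ([], m) => PMF.pure ([], m)
  | (.skip :: k, m) => PMF.pure (k, m)
  | (.push r b :: k, m) => PMF.pure (k, m.push r b)
  | (.pop r :: k, m) => PMF.pure (k, m.set r (m.reg r).tail)
  | (.seq p q :: k, m) => PMF.pure (p :: q :: k, m)
  | (.branch r pe p0 p1 :: k, m) =>
      match m.reg r with
      | [] => PMF.pure (pe :: k, m)
      | false :: _ => PMF.pure (p0 :: k, m)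
      | true :: _ => PMF.pure (p1 :: k, m)
  | (.loop r p :: k, m) =>
      match m.reg r with
      | [] => PMF.pure (k, m)
      | _ :: _ => PMF.pure (p :: .loop r p :: k, m)
  | (.toss r :: k, m) => (PMF.uniformOfFintype Bool).bind fun b => PMF.pure (k, m.push r b)
  | (.query r t :: k, m) => PMF.pure (k, m.push t (decide (m.reg r ∈ A)))
  | (.reset :: k, m) => PMF.pure (k, m.apply fun _ => ket ∅)
  | (.had r :: k, m) => PMF.pure (k, m.apply (hadGate (m.addr r)))
  | (.tee r :: k, m) => PMF.pure (k, m.apply (tGate (m.addr r)))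
  | (.cnot r s :: k, m) => PMF.pure (k, m.apply (cnotGate (m.addr r) (m.addr s)))
  | (.qquery r l t :: k, m) =>
      PMF.pure (k, m.apply (oracleGate A (m.addr r) (m.addr l) (m.addr t)))
  | (.measure r t :: k, m) =>
      (measureDist (m.addr r) m.qst).bind fun v =>
        PMF.pure (k, (m.apply (proj (m.addr r) v)).push t v)

/-- The distribution of the configuration after `t` steps. -/
def run (A : Set (List Bool)) : ℕ → Config → PMF Config
  | 0, c => PMF.pure c
  | t + 1, c => (step A c).bind (run A t)

/-- The initial configuration of `B` on the input `⟨x, 0^k⟩`: stack `0` holds `x`, stack `1` holds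
`0^k`, all other stacks are empty and all qubits are `|0⟩`. -/
def initial (B : Prog) (x : List Bool) (k : ℕ) : Config :=
  ([B], { reg := fun r => if r = 0 then x else if r = 1 then List.replicate k false else []
          qst := ket ∅ })

/-- On the input `⟨x, 0^k⟩`, `B` with oracle `A` always halts within `t` steps. -/
def HaltsWithin (A : Set (List Bool)) (B : Prog) (x : List Bool) (k t : ℕ) : Prop :=
  ∀ c ∈ (run A t (initial B x k)).support, c.1 = []

/-- The distribution of the contents of the output stack `2` after `t` steps. -/
def output (A : Set (List Bool)) (B : Prog) (x : List Bool) (k t : ℕ) : PMF (List Bool) :=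
  (run A t (initial B x k)).map fun c => c.2.reg 2

/-! ### Sampling and search problems -/

/-- The variation distance of two distributions over strings. -/
def tvDist (P Q : PMF (List Bool)) : ℝ := 1 / 2 * ∑' y, |(P y).toReal - (Q y).toReal|

/-- A sampling problem: a distribution over `{0,1}^{p(n)}` for every input of length `n`, where `p`
is some fixed polynomial. -/
structure SamplingProblem where
  /-- The distributions. -/
  dist : List Bool → PMF (List Bool)
  exists_length : ∃ p : Polynomial ℕ, ∀ x, ∀ y ∈ (dist x).support, y.length = p.eval x.length

/-- A search problem: a nonempty subset of `{0,1}^{p(n)}` for every input of length `n`, where `p`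
is some fixed polynomial. -/
structure SearchProblem where
  /-- The solution sets. -/
  sol : List Bool → Set (List Bool)
  nonempty : ∀ x, (sol x).Nonempty
  exists_length : ∃ p : Polynomial ℕ, ∀ x, ∀ y ∈ sol x, y.length = p.eval x.length

/-- `B` solves the sampling problem `S` in time polynomial in `n` and `1/ε`, for `ε = 1/k`. -/
def SolvesSampling (A : Set (List Bool)) (B : Prog) (S : SamplingProblem) : Prop :=
  ∃ T : Polynomial ℕ, ∀ (x : List Bool) (k : ℕ), 0 < k →
    HaltsWithin A B x k (T.eval (x.length + k)) ∧
    tvDist (output A B x k (T.eval (x.length + k))) (S.dist x) ≤ 1 / (k : ℝ)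

/-- `B` solves the search problem `R` in time polynomial in `n` and `1/ε`, for `ε = 1/k`. -/
def SolvesSearch (A : Set (List Bool)) (B : Prog) (R : SearchProblem) : Prop :=
  ∃ T : Polynomial ℕ, ∀ (x : List Bool) (k : ℕ), 0 < k →
    HaltsWithin A B x k (T.eval (x.length + k)) ∧
    1 - 1 / (k : ℝ) ≤ ((output A B x k (T.eval (x.length + k))).toOuterMeasure (R.sol x)).toReal

/-- `SampP` relative to the oracle `A`. -/
def SampPRel (A : Set (List Bool)) : Set SamplingProblem :=
  {S | ∃ B : Prog, B.Classical ∧ SolvesSampling A B S}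

/-- `SampBQP` relative to the oracle `A`. -/
def SampBQPRel (A : Set (List Bool)) : Set SamplingProblem :=
  {S | ∃ B : Prog, SolvesSampling A B S}

/-- `FBPP` relative to the oracle `A`. -/
def FBPPRel (A : Set (List Bool)) : Set SearchProblem :=
  {R | ∃ B : Prog, B.Classical ∧ SolvesSearch A B R}

/-- `FBQP` relative to the oracle `A`. -/
def FBQPRel (A : Set (List Bool)) : Set SearchProblem :=
  {R | ∃ B : Prog, SolvesSearch A B R}

/-! The unrelativized classes are those for the empty oracle, which answers every query by `0` and
whose oracle gate is the identity. -/

/-- Sampling problems solvable by a probabilistic polynomial-time algorithm. -/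
def SampP : Set SamplingProblem := SampPRel ∅

/-- Sampling problems solvable by a polynomial-time quantum algorithm. -/
def SampBQP : Set SamplingProblem := SampBQPRel ∅

/-- Search problems solvable by a probabilistic polynomial-time algorithm. -/
def FBPP : Set SearchProblem := FBPPRel ∅

/-- Search problems solvable by a polynomial-time quantum algorithm. -/
def FBQP : Set SearchProblem := FBQPRel ∅

end SampSearch

end

/-!
All proofs below treat the oracle `A` as a parameter, and the classes without an oracle are those
for `A = ∅`, so that both parts of the theorem are instances of `FBPPRel_eq_iff`. Since a classical
program is a quantum program, only the inclusions of the quantum classes in the classical ones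
matter.

*From sampling to searching* (`FBPPRel_eq_of_SampPRel_eq`). Let `B` be a quantum algorithm for a
search problem. To sample the output of `B` on `⟨x, 0^(e + 1)⟩`, given a string that encodes `x` and
`0^e`, is a sampling problem in `SampBQP`. A classical algorithm for it, run with `e = 2k` and the
precision `1 / (2k)`, finds a solution of the search problem except with probability `1 / k`.

*From searching to sampling* (`SampPRel_eq_of_FBPPRel_eq`). Let `D` be a sampling problem with a
quantum algorithm. A search problem is needed in which every classical algorithm is forced to
produce samples from `D x`. The input `z` encodes `x` and random strings `r₁, …, r_N` of length `L`,
and a string `Y` that consists of `N` blocks `y₁ … y_N` is a solution (`Solution`) if one of the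
following holds.

* A universal distribution `universal`, the mixture of the outputs on `z` of all programs with
  polynomial clocks, gives `Y` at most `2^(L + 1)` times the weight that `N` independent samples
  from `D x` give it. This replaces the condition that the Kolmogorov complexity of `Y` is almost as
  large as the logarithm of the inverse of its probability, and needs no universal machine.
* Each `y_i` is approximately the quantile of `D x` at the place `val r_i / 2^L`.

The problem is in `FBQP` (`exists_searchProblem`): by Markov's inequality, independent samples
satisfy the first condition except with probability `2^(-L - 1)` (`prob_not_le_mul_le`). The
definition of `FBQP` asks for any error `1 / k` on a fixed input, hence also for errors below
`2^(-L - 1)`; this is the purpose of the second condition. If `2^L ≤ k`, then there is time to find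
the quantiles by bisection, where each comparison is decided by many samples and Chernoff's bound
applies (`prob_bisect_le`).

Now let `C` be a classical algorithm for this search problem. The classical sampling algorithm
`extractProg` chooses random strings, runs `C`, and outputs a random block. Fix an event `E`, and
consider the number of blocks in `E`. As `C` is one of the programs in the mixture, say that with
weight `2^(-ν - 1)`, its output distribution on the solutions of the first kind is at most
`2^(L + ν + 2)` times that of `N` independent samples. On the solutions of the second kind, the
blocks are quantiles at random places, and each string is such a quantile with about its probability
under `D x` (`prob_quantile_le`). In both cases the exponential moment, with a small parameter `r`,
of the deviation of the number of blocks in `E` from `N` times the probability of `E` is at most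
`exp (L + ν + 3 + 2 N r²)`; up to constants, this is the bound for independent samples times a
factor that depends on `L` and `ν` only (`ex_count_le`). When `N` is large compared to `L` and `ν`,
the frequency of `E` thus exceeds its probability by at most `1 / k` in expectation
(`prob_extract_le`). This holds for all events `E`, so that the variation distance is at most
`1 / k` (`tvDist_le_of_prob`).

Programs are analyzed by the predicate `Exec`, which states a time bound together with the exact
distribution of the final memory; an algorithm is called as a subroutine by shifting its stacks
above those of the caller (`exec_call`).
-/

noncomputable section

namespace SampSearch

/-! ### Executions of programs -/

deriving instance Countable for Prog

theorem pmf_bind_congr {α β : Type*} {p : PMF α} {f g : α → PMF β}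
    (h : ∀ a ∈ p.support, f a = g a) : p.bind f = p.bind g := by
  ext b
  simp only [PMF.bind_apply]
  refine tsum_congr fun a => ?_
  by_cases ha : p a = 0
  · simp [ha]
  · rw [h a ((PMF.mem_support_iff _ _).mpr ha)]

theorem run_nil (A : Set (List Bool)) (t : ℕ) (m : Mem) : run A t ([], m) = PMF.pure ([], m) := by
  induction t with
  | zero => rfl
  | succ t ih => simp [run, step, ih]

/-- The list `l` of programs, started in `m`, always halts within `t` steps, and the distribution of
its final memory is `μ`. -/
def ExecL (A : Set (List Bool)) (l : List Prog) (m : Mem) (t : ℕ) (μ : PMF Mem) : Prop :=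
  run A t (l, m) = μ.map (Prod.mk [])

/-- The program `p`, started in `m`, always halts within `t` steps, and the distribution of its
final memory is `μ`. -/
def Exec (A : Set (List Bool)) (p : Prog) (m : Mem) (t : ℕ) (μ : PMF Mem) : Prop :=
  ExecL A [p] m t μ

variable {A : Set (List Bool)}

theorem execL_nil (t : ℕ) (m : Mem) : ExecL A [] m t (PMF.pure m) := by
  simp [ExecL, run_nil, PMF.pure_map]

theorem execL_of_halts {l : List Prog} {m : Mem} {t : ℕ}
    (h : ∀ c ∈ (run A t (l, m)).support, c.1 = []) :
    ExecL A l m t ((run A t (l, m)).map Prod.snd) := by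
  unfold ExecL
  rw [PMF.map_comp]
  conv_lhs => rw [← PMF.map_id (run A t (l, m))]
  simp only [PMF.map]
  refine pmf_bind_congr fun c hc => ?_
  have := h c hc
  obtain ⟨c1, c2⟩ := c
  simp_all

theorem ExecL.halts {l : List Prog} {m : Mem} {t : ℕ} {μ : PMF Mem} (h : ExecL A l m t μ) :
    ∀ c ∈ (run A t (l, m)).support, c.1 = [] := by
  intro c hc
  rw [h, PMF.mem_support_map_iff] at hc
  obtain ⟨a, _, rfl⟩ := hc
  rfl

theorem ExecL.eq_snd {l : List Prog} {m : Mem} {t : ℕ} {μ : PMF Mem} (h : ExecL A l m t μ) :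
    μ = (run A t (l, m)).map Prod.snd := by
  rw [h, PMF.map_comp]
  exact (PMF.map_id μ).symm

/-- Appending programs to the list of those that remain to be executed commutes with a step. -/
theorem step_append (p : Prog) (l k : List Prog) (m : Mem) :
    step A (p :: l ++ k, m) = (step A (p :: l, m)).map fun c => (c.1 ++ k, c.2) := by
  cases p <;>
    simp only [step, List.cons_append, PMF.pure_map, PMF.map_bind]
  all_goals split <;> simp [*, PMF.pure_map]

/-- If the programs in `l` are executed before those in `k`, the times add up, and the continuation
may depend on the memory that results from `l`. -/
theorem ExecL.append {l k : List Prog} {m : Mem} {t s : ℕ} {μ : PMF Mem} {ν : Mem → PMF Mem}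
    (h : ExecL A l m t μ) (hk : ∀ m' ∈ μ.support, ExecL A k m' s (ν m')) :
    ExecL A (l ++ k) m (t + s) (μ.bind ν) := by
  induction t generalizing l m μ with
  | zero =>
    have hl : l = [] := h.halts (l, m) (by simp [run])
    subst hl
    have hμ : μ = PMF.pure m := by rw [h.eq_snd]; simp [run, PMF.pure_map]
    subst hμ
    simpa using hk m (by simp)
  | succ t ih =>
    cases l with
    | nil =>
      have hμ : μ = PMF.pure m := by rw [h.eq_snd]; simp [run_nil, PMF.pure_map]
      subst hμ
      have h1 := hk m (by simp)
      -- idle steps after halting do not change the result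
      have key : ∀ (s u : ℕ) (c : Config) (μ : PMF Mem), run A s c = μ.map (Prod.mk []) →
          run A (u + s) c = μ.map (Prod.mk []) := by
        intro s u c μ hc
        have h2 : run A (u + s) c = (run A s c).bind (run A u) := by
          clear hc
          induction s generalizing c with
          | zero => simp [run]
          | succ s ihs =>
            rw [← add_assoc]
            simp only [run, PMF.bind_bind]
            exact congrArg _ (funext ihs)
        rw [h2, hc, PMF.bind_map]
        simp only [Function.comp_def, run_nil]
        rfl
      simpa [ExecL] using key s (t + 1) (k, m) (ν m) h1
    | cons p l =>
      have hh := h.halts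
      set μ' : Config → PMF Mem := fun c => (run A t c).map Prod.snd with hμ'
      have e1 : μ = (step A (p :: l, m)).bind μ' := by
        rw [h.eq_snd]; simp only [run, PMF.map_bind, hμ']
      have hc : ∀ c ∈ (step A (p :: l, m)).support, ExecL A c.1 c.2 t (μ' c) := by
        intro c hcs
        refine execL_of_halts fun d hd => hh d ?_
        rw [run, PMF.mem_support_bind_iff]
        exact ⟨c, hcs, hd⟩
      have hc' : ∀ c ∈ (step A (p :: l, m)).support,
          ExecL A (c.1 ++ k) c.2 (t + s) ((μ' c).bind ν) := by
        intro c hcs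
        refine ih (hc c hcs) fun m' hm' => hk m' ?_
        rw [e1, PMF.mem_support_bind_iff]
        exact ⟨c, hcs, hm'⟩
      unfold ExecL
      rw [show t + 1 + s = t + s + 1 by ring, run, step_append, PMF.bind_map, e1, PMF.bind_bind,
        PMF.map_bind]
      exact pmf_bind_congr fun c hcs => hc' c hcs

theorem ExecL.mono {l : List Prog} {m : Mem} {t t' : ℕ} {μ : PMF Mem} (h : ExecL A l m t μ)
    (ht : t ≤ t') : ExecL A l m t' μ := by
  obtain ⟨s, rfl⟩ := Nat.exists_eq_add_of_le ht
  simpa using h.append (k := []) (s := s) (ν := PMF.pure) fun m' _ => execL_nil s m'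

theorem Exec.mono {p : Prog} {m : Mem} {t t' : ℕ} {μ : PMF Mem} (h : Exec A p m t μ)
    (ht : t ≤ t') : Exec A p m t' μ := ExecL.mono h ht

theorem ExecL.of_step {p : Prog} {l : List Prog} {m : Mem} {t : ℕ} {c : Config} {μ : PMF Mem}
    (hs : step A (p :: l, m) = PMF.pure c) (h : ExecL A c.1 c.2 t μ) :
    ExecL A (p :: l) m (t + 1) μ := by
  unfold ExecL at *
  rw [run, hs, PMF.pure_bind, h]

theorem Exec.seq {p q : Prog} {m : Mem} {t s : ℕ} {μ : PMF Mem} {ν : Mem → PMF Mem}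
    (h : Exec A p m t μ) (hq : ∀ m' ∈ μ.support, Exec A q m' s (ν m')) :
    Exec A (.seq p q) m (t + s + 1) (μ.bind ν) :=
  ExecL.of_step (c := ([p, q], m)) rfl (ExecL.append h hq)

theorem exec_loop_nil {r : ℕ} {p : Prog} {m : Mem} (h : m.reg r = []) :
    Exec A (.loop r p) m 1 (PMF.pure m) :=
  ExecL.of_step (c := ([], m)) (by simp [step, h]) (execL_nil 0 m)

theorem exec_loop_cons {r : ℕ} {p : Prog} {m : Mem} {t s : ℕ} {μ : PMF Mem} {ν : Mem → PMF Mem}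
    (hr : m.reg r ≠ []) (h : Exec A p m t μ)
    (hq : ∀ m' ∈ μ.support, Exec A (.loop r p) m' s (ν m')) :
    Exec A (.loop r p) m (t + s + 1) (μ.bind ν) := by
  refine ExecL.of_step (c := ([p, .loop r p], m)) ?_ (ExecL.append h hq)
  obtain ⟨b, w, hw⟩ := List.exists_cons_of_ne_nil hr
  simp [step, hw]

theorem exec_branch {r : ℕ} {pe p0 p1 : Prog} {m : Mem} {t : ℕ} {μ : PMF Mem}
    (he : m.reg r = [] → Exec A pe m t μ) (h0 : ∀ w, m.reg r = false :: w → Exec A p0 m t μ)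
    (h1 : ∀ w, m.reg r = true :: w → Exec A p1 m t μ) :
    Exec A (.branch r pe p0 p1) m (t + 1) μ := by
  rcases hw : m.reg r with _ | ⟨b | b, w⟩
  · exact ExecL.of_step (c := ([pe], m)) (by simp [step, hw]) (he hw)
  · exact ExecL.of_step (c := ([p0], m)) (by simp [step, hw]) (h0 w hw)
  · exact ExecL.of_step (c := ([p1], m)) (by simp [step, hw]) (h1 w hw)

theorem exec_toss (r : ℕ) (m : Mem) :
    Exec A (.toss r) m 1 ((PMF.uniformOfFintype Bool).map (m.push r)) := by
  simp only [Exec, ExecL, run, step, PMF.bind_bind, PMF.pure_bind, PMF.map_comp]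
  rfl

/-- The program `p` leads from `m` to `m'` in at most `t` steps, without randomness. -/
def Det (A : Set (List Bool)) (p : Prog) (m : Mem) (t : ℕ) (m' : Mem) : Prop :=
  Exec A p m t (PMF.pure m')

theorem Det.mono {p : Prog} {m m' : Mem} {t t' : ℕ} (h : Det A p m t m') (ht : t ≤ t') :
    Det A p m t' m' := Exec.mono h ht

theorem Det.seq_exec {p q : Prog} {m m' : Mem} {t s : ℕ} {ν : PMF Mem} (h : Det A p m t m')
    (hq : Exec A q m' s ν) : Exec A (.seq p q) m (t + s + 1) ν := by
  have := Exec.seq (ν := fun _ => ν) h (by simpa using hq)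
  simpa using this

theorem Det.seq {p q : Prog} {m m' m'' : Mem} {t s : ℕ} (h : Det A p m t m')
    (hq : Det A q m' s m'') : Det A (.seq p q) m (t + s + 1) m'' :=
  h.seq_exec hq

theorem det_skip (m : Mem) : Det A .skip m 1 m :=
  ExecL.of_step (c := ([], m)) rfl (execL_nil 0 m)

/-! ### Memories with named stacks -/

/-- The stacks numbered `0, 1, 2, …` are those in `vs`, followed by those in `lo`. -/
def regs : List (List Bool) → (ℕ → List Bool) → ℕ → List Bool
  | [], lo, r => lo r
  | v :: _, _, 0 => v
  | _ :: vs, lo, r + 1 => regs vs lo r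

/-- The memory with quantum state `q`, whose stacks are those in `vs`, followed by those in `lo`. -/
def St (q : QState) (vs : List (List Bool)) (lo : ℕ → List Bool) : Mem := ⟨regs vs lo, q⟩

theorem regs_lt {vs : List (List Bool)} {lo : ℕ → List Bool} {i : ℕ} (h : i < vs.length) :
    regs vs lo i = vs.getD i [] := by
  induction vs generalizing i with
  | nil => simp at h
  | cons v vs ih =>
    cases i with
    | zero => rfl
    | succ i => simpa [regs] using ih (by simpa using h)

theorem regs_add (vs : List (List Bool)) (lo : ℕ → List Bool) (r : ℕ) :
    regs vs lo (r + vs.length) = lo r := by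
  induction vs with
  | nil => rfl
  | cons v vs ih => simpa [regs, ← add_assoc] using ih

theorem regs_append (us vs : List (List Bool)) (lo : ℕ → List Bool) :
    regs (us ++ vs) lo = regs us (regs vs lo) := by
  induction us with
  | nil => rfl
  | cons u us ih => funext r; cases r <;> simp [regs, ih]

theorem regs_update_lt {vs : List (List Bool)} {lo : ℕ → List Bool} {i : ℕ} (h : i < vs.length)
    (w : List Bool) : Function.update (regs vs lo) i w = regs (vs.set i w) lo := by
  induction vs generalizing i with
  | nil => simp at h
  | cons v vs ih =>
    funext r
    cases i with
    | zero => cases r <;> simp [regs, Function.update]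
    | succ i =>
      cases r with
      | zero => simp [regs, Function.update]
      | succ r =>
        have := congrFun (ih (i := i) (by simpa using h)) r
        simpa [regs, Function.update] using this

theorem regs_update_add (vs : List (List Bool)) (lo : ℕ → List Bool) (r : ℕ) (w : List Bool) :
    Function.update (regs vs lo) (r + vs.length) w = regs vs (Function.update lo r w) := by
  induction vs with
  | nil => rfl
  | cons v vs ih =>
    funext i
    cases i with
    | zero => simp [regs, Function.update]
    | succ i =>
      have := congrFun ih i
      simpa [regs, Function.update, ← add_assoc] using this

variable {q : QState} {vs : List (List Bool)} {lo : ℕ → List Bool}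

theorem St_reg {i : ℕ} (h : i < vs.length) : (St q vs lo).reg i = vs.getD i [] := regs_lt h

theorem St_set {i : ℕ} (h : i < vs.length) (w : List Bool) :
    (St q vs lo).set i w = St q (vs.set i w) lo := by
  simp [St, Mem.set, regs_update_lt h]

theorem det_push (r : ℕ) (b : Bool) (h : r < vs.length := by simp) :
    Det A (.push r b) (St q vs lo) 1 (St q (vs.set r (b :: vs.getD r [])) lo) := by
  rw [← St_set h, ← St_reg (q := q) (lo := lo) h]
  exact ExecL.of_step (c := ([], _)) rfl (execL_nil 0 _)

theorem det_pop (r : ℕ) (h : r < vs.length := by simp) :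
    Det A (.pop r) (St q vs lo) 1 (St q (vs.set r (vs.getD r []).tail) lo) := by
  rw [← St_set h, ← St_reg (q := q) (lo := lo) h]
  exact ExecL.of_step (c := ([], _)) rfl (execL_nil 0 _)

theorem exec_toss_St (r : ℕ) (h : r < vs.length := by simp) :
    Exec A (.toss r) (St q vs lo) 1
      ((PMF.uniformOfFintype Bool).map fun b => St q (vs.set r (b :: vs.getD r [])) lo) := by
  have := exec_toss (A := A) r (St q vs lo)
  have e : (St q vs lo).push r = fun b => St q (vs.set r (b :: vs.getD r [])) lo := by
    funext b
    rw [Mem.push, St_set h, St_reg h]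
  rwa [e] at this

theorem det_reset : Det A .reset (St q vs lo) 1 (St (ket ∅) vs lo) :=
  ExecL.of_step (c := ([], St (ket ∅) vs lo)) rfl (execL_nil 0 _)

/-- The result of repeating a random transformation of the state, once for every element of `l`. -/
def kfold {β σ : Type*} (f : β → σ → PMF σ) : List β → σ → PMF σ
  | [], s => PMF.pure s
  | b :: l, s => (f b s).bind (kfold f l)

/-- A loop that consumes the stack `r` bit by bit. `S l s` is the memory in which `l` is what is
left on the stack `r`, and `I` is an invariant of the loop. -/
theorem exec_loop_list {σ : Type*} {r : ℕ} {p : Prog} {t : ℕ} (S : List Bool → σ → Mem)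
    (f : Bool → σ → PMF σ) (I : List Bool → σ → Prop) (hr : ∀ l s, (S l s).reg r = l)
    (hp : ∀ b l s, I (b :: l) s → Exec A p (S (b :: l) s) t ((f b s).map (S l)))
    (hI : ∀ b l s, I (b :: l) s → ∀ s' ∈ (f b s).support, I l s') (l : List Bool) (s : σ)
    (h : I l s) :
    Exec A (.loop r p) (S l s) ((t + 1) * l.length + 1) ((kfold f l s).map (S [])) := by
  induction l generalizing s with
  | nil => simpa [kfold, PMF.pure_map] using exec_loop_nil (hr [] s)
  | cons b l ih =>
    set ν : Mem → PMF Mem := fun m' =>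
      (run A ((t + 1) * l.length + 1) ([.loop r p], m')).map Prod.snd
    have hν : ∀ s' ∈ (f b s).support, ν (S l s') = (kfold f l s').map (S []) := fun s' hs' =>
      (ExecL.eq_snd (ih s' (hI b l s h s' hs'))).symm
    have key := exec_loop_cons (r := r) (m := S (b :: l) s) (ν := ν) (by simp [hr]) (hp b l s h)
      (s := (t + 1) * l.length + 1) (fun m' hm' => by
        rw [PMF.mem_support_map_iff] at hm'
        obtain ⟨s', hs', rfl⟩ := hm'
        rw [hν s' hs']
        exact ih s' (hI b l s h s' hs'))
    have e : ((f b s).map (S l)).bind ν = (kfold f (b :: l) s).map (S []) := by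
      rw [kfold, PMF.map_bind, PMF.bind_map]
      exact pmf_bind_congr hν
    rw [e] at key
    refine key.mono ?_
    simp only [List.length_cons]
    ring_nf
    rfl

theorem kfold_pure {β σ : Type*} (g : β → σ → σ) (l : List β) (s : σ) :
    kfold (fun b s => PMF.pure (g b s)) l s = PMF.pure (l.foldl (fun s b => g b s) s) := by
  induction l generalizing s with
  | nil => rfl
  | cons b l ih => simp [kfold, ih]

/-- The deterministic case of `exec_loop_list`. -/
theorem det_loop_list {σ : Type*} {r : ℕ} {p : Prog} {t : ℕ} (S : List Bool → σ → Mem)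
    (g : Bool → σ → σ) (I : List Bool → σ → Prop) (hr : ∀ l s, (S l s).reg r = l)
    (hp : ∀ b l s, I (b :: l) s → Det A p (S (b :: l) s) t (S l (g b s)))
    (hI : ∀ b l s, I (b :: l) s → I l (g b s)) (l : List Bool) (s : σ) (h : I l s) :
    Det A (.loop r p) (S l s) ((t + 1) * l.length + 1)
      (S [] (l.foldl (fun s b => g b s) s)) := by
  have := exec_loop_list (A := A) (p := p) (t := t) S (fun b s => PMF.pure (g b s)) I hr
    (fun b l s hs => by rw [PMF.pure_map]; exact hp b l s hs)
    (fun b l s hs s' hs' => by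
      rw [PMF.mem_support_pure_iff] at hs'
      rw [hs']; exact hI b l s hs) l s h
  rw [kfold_pure, PMF.pure_map] at this
  exact this

theorem det_branch {r : ℕ} {pe p0 p1 : Prog} {m m' : Mem} {t : ℕ}
    (he : m.reg r = [] → Det A pe m t m') (h0 : ∀ w, m.reg r = false :: w → Det A p0 m t m')
    (h1 : ∀ w, m.reg r = true :: w → Det A p1 m t m') :
    Det A (.branch r pe p0 p1) m (t + 1) m' := exec_branch he h0 h1

/-! ### Basic subprograms -/

theorem Det.of_eq {p : Prog} {m m' m'' : Mem} {t : ℕ} (h : Det A p m t m') (e : m' = m'') :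
    Det A p m t m'' := e ▸ h

theorem St_congr {us : List (List Bool)} (h : ∀ n : ℕ, us[n]? = vs[n]?) :
    St q us lo = St q vs lo := by
  rw [List.ext_getElem? h]

theorem getD_set_eq {i : ℕ} (h : i < vs.length) (w : List Bool) :
    (vs.set i w).getD i [] = w := by
  simp [h]

theorem getD_set_ne {i j : ℕ} (h : i ≠ j) (w : List Bool) :
    (vs.set i w).getD j [] = vs.getD j [] := by
  simp [h]

theorem set_getD_self (i : ℕ) : vs.set i (vs.getD i []) = vs :=
  List.ext_getElem? fun n => by grind

/-- Empty the stack `a`. -/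
def clear (a : ℕ) : Prog := .loop a (.pop a)

theorem det_clear (a : ℕ) (h : a < vs.length := by simp) :
    Det A (clear a) (St q vs lo) (2 * (vs.getD a []).length + 1) (St q (vs.set a []) lo) := by
  have := det_loop_list (A := A) (r := a) (p := .pop a) (t := 1)
    (fun l (_ : Unit) => St q (vs.set a l) lo) (fun _ s => s) (fun _ _ => True)
    (fun l s => by rw [St_reg (by simpa), getD_set_eq h])
    (fun b l s _ => (det_pop a (by simpa)).of_eq (by exact St_congr fun n => by grind))
    (fun _ _ _ _ => trivial) (vs.getD a []) () trivial
  rw [set_getD_self] at this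
  exact this

/-- Move the stack `a` onto the stack `b`, reversing its order. -/
def move (a b : ℕ) : Prog :=
  .loop a (.branch a .skip (.seq (.pop a) (.push b false)) (.seq (.pop a) (.push b true)))

theorem foldl_cons_eq (l s : List Bool) : l.foldl (fun s b => b :: s) s = l.reverse ++ s := by
  induction l generalizing s with
  | nil => rfl
  | cons b l ih => simp [ih]

theorem det_move (a b : ℕ) (hab : a ≠ b := by simp) (ha : a < vs.length := by simp)
    (hb : b < vs.length := by simp) :
    Det A (move a b) (St q vs lo) (5 * (vs.getD a []).length + 1)
      (St q ((vs.set a []).set b ((vs.getD a []).reverse ++ vs.getD b [])) lo) := by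
  have := det_loop_list (A := A) (r := a)
    (p := .branch a .skip (.seq (.pop a) (.push b false)) (.seq (.pop a) (.push b true))) (t := 4)
    (fun l s => St q ((vs.set a l).set b s) lo) (fun c s => c :: s) (fun _ _ => True)
    (fun l s => by rw [St_reg (by simpa)]; grind)
    (fun c l s _ => by
      refine det_branch ?_ ?_ ?_ <;> rw [St_reg (by simpa)] <;> intros <;>
        rename_i hw
      · grind
      all_goals
        refine ((det_pop a (by simpa)).seq (det_push b _ (by simpa))).of_eq ?_
        exact St_congr fun n => by grind)
    (fun _ _ _ _ => trivial) (vs.getD a []) (vs.getD b []) trivial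
  rw [set_getD_self, set_getD_self, foldl_cons_eq] at this
  exact this

/-- Move the stack `a` onto both of the stacks `b` and `c`, reversing its order. -/
def dup (a b c : ℕ) : Prog :=
  .loop a (.branch a .skip (.seq (.pop a) (.seq (.push b false) (.push c false)))
    (.seq (.pop a) (.seq (.push b true) (.push c true))))

theorem det_dup (a b c : ℕ) (hab : a ≠ b := by simp) (hac : a ≠ c := by simp)
    (hbc : b ≠ c := by simp) (ha : a < vs.length := by simp)
    (hb : b < vs.length := by simp) (hc : c < vs.length := by simp) :
    Det A (dup a b c) (St q vs lo) (7 * (vs.getD a []).length + 1)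
      (St q (((vs.set a []).set b ((vs.getD a []).reverse ++ vs.getD b [])).set c
        ((vs.getD a []).reverse ++ vs.getD c [])) lo) := by
  have := det_loop_list (A := A) (r := a)
    (p := .branch a .skip (.seq (.pop a) (.seq (.push b false) (.push c false)))
      (.seq (.pop a) (.seq (.push b true) (.push c true)))) (t := 6)
    (fun l (s : List Bool × List Bool) => St q (((vs.set a l).set b s.1).set c s.2) lo)
    (fun d s => (d :: s.1, d :: s.2)) (fun _ _ => True)
    (fun l s => by rw [St_reg (by simpa)]; grind)
    (fun d l s _ => by
      refine det_branch ?_ ?_ ?_ <;> rw [St_reg (by simpa)] <;> intros <;>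
        rename_i hw
      · grind
      all_goals
        refine ((det_pop a (by simpa)).seq ((det_push b _ (by simpa)).seq
          (det_push c _ (by simpa)))).of_eq ?_
        exact St_congr fun n => by grind)
    (fun _ _ _ _ => trivial) (vs.getD a []) (vs.getD b [], vs.getD c []) trivial
  have e : ∀ l s s' : List Bool, l.foldl (fun (s : List Bool × List Bool) b => (b :: s.1, b :: s.2))
      (s, s') = (l.reverse ++ s, l.reverse ++ s') := by
    intro l
    induction l with
    | nil => simp
    | cons b l ih => simp [ih]
  rw [e, set_getD_self, set_getD_self, set_getD_self] at this
  exact this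

/-- Push the reversal of the stack `a` onto the stack `b`, keeping the stack `a`; the stack `c` is
auxiliary and has to be empty. -/
def copyRev (a b c : ℕ) : Prog := .seq (dup a c b) (move c a)

theorem det_copyRev (a b c : ℕ) (hc : vs.getD c [] = [] := by rfl) (hab : a ≠ b := by simp)
    (hac : a ≠ c := by simp) (hbc : b ≠ c := by simp) (ha' : a < vs.length := by simp)
    (hb' : b < vs.length := by simp) (hc' : c < vs.length := by simp) :
    Det A (copyRev a b c) (St q vs lo) (12 * (vs.getD a []).length + 3)
      (St q (vs.set b ((vs.getD a []).reverse ++ vs.getD b [])) lo) := by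
  refine (((det_dup a c b hac hab hbc.symm ha' hc' hb').seq
    (det_move c a hac.symm (by simpa) (by simpa))).of_eq ?_).mono ?_
  · exact St_congr fun n => by grind
  · have : ∀ u v : List Bool, (((vs.set a []).set c u).set b v).getD c [] = u := by grind
    rw [this, hc]
    simp
    omega

/-- Push as many zeros as the height of the stack `a` onto the stack `b`, emptying the
stack `a`. -/
def unary (a b : ℕ) : Prog := .loop a (.seq (.pop a) (.push b false))

theorem foldl_replicate (l s : List Bool) :
    l.foldl (fun s _ => false :: s) s = List.replicate l.length false ++ s := by
  induction l generalizing s with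
  | nil => rfl
  | cons b l ih =>
    rw [List.foldl_cons, ih, List.length_cons, List.replicate_succ', List.append_assoc]
    rfl

theorem det_unary (a b : ℕ) (hab : a ≠ b := by simp) (ha : a < vs.length := by simp)
    (hb : b < vs.length := by simp) :
    Det A (unary a b) (St q vs lo) (4 * (vs.getD a []).length + 1)
      (St q ((vs.set a []).set b (List.replicate (vs.getD a []).length false ++ vs.getD b [])) lo) := by
  have := det_loop_list (A := A) (r := a)
    (p := .seq (.pop a) (.push b false)) (t := 3)
    (fun l s => St q ((vs.set a l).set b s) lo) (fun _ s => false :: s) (fun _ _ => True)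
    (fun l s => by rw [St_reg (by simpa)]; grind)
    (fun c l s _ => by
      refine ((det_pop a (by simpa)).seq (det_push b _ (by simpa))).of_eq ?_
      exact St_congr fun n => by grind)
    (fun _ _ _ _ => trivial) (vs.getD a []) (vs.getD b []) trivial
  rw [set_getD_self, set_getD_self, foldl_replicate] at this
  exact this

/-- The string `y`, truncated or padded with zeros to the length `n`. -/
def fit (n : ℕ) (y : List Bool) : List Bool := (y ++ List.replicate n false).take n

@[simp] theorem length_fit (n : ℕ) (y : List Bool) : (fit n y).length = n := by
  simp [fit]

theorem fit_nil_succ (n : ℕ) : fit (n + 1) [] = false :: fit n [] := by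
  simp [fit, List.replicate_succ]

theorem fit_cons_succ (n : ℕ) (b : Bool) (y : List Bool) : fit (n + 1) (b :: y) = b :: fit n y := by
  simp [fit, List.replicate_succ', ← List.append_assoc, List.take_append]

theorem fit_append_eq (n : ℕ) (y z : List Bool) (h : y.length = n) : fit n (y ++ z) = y := by
  subst h; simp [fit]

theorem fit_eq_self {n : ℕ} {y : List Bool} (h : y.length = n) : fit n y = y := by
  simpa using fit_append_eq n y [] h

/-- Move bits from the stack `b` onto the stack `c`, one for each element of the stack `a`, using
zeros if the stack `b` gets empty. -/
def transfer (a b c : ℕ) : Prog :=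
  .loop a (.seq (.pop a) (.branch b (.push c false) (.seq (.pop b) (.push c false))
    (.seq (.pop b) (.push c true))))

theorem det_transfer (a b c : ℕ) (hab : a ≠ b := by simp) (hac : a ≠ c := by simp)
    (hbc : b ≠ c := by simp) (ha : a < vs.length := by simp)
    (hb : b < vs.length := by simp) (hc : c < vs.length := by simp) :
    Det A (transfer a b c) (St q vs lo) (7 * (vs.getD a []).length + 1)
      (St q (((vs.set a []).set b ((vs.getD b []).drop (vs.getD a []).length)).set c
        ((fit (vs.getD a []).length (vs.getD b [])).reverse ++ vs.getD c [])) lo) := by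
  have := det_loop_list (A := A) (r := a)
    (p := .seq (.pop a) (.branch b (.push c false) (.seq (.pop b) (.push c false))
      (.seq (.pop b) (.push c true)))) (t := 6)
    (fun l (s : List Bool × List Bool) => St q (((vs.set a l).set b s.1).set c s.2) lo)
    (fun _ s => (s.1.tail, s.1.headD false :: s.2)) (fun _ _ => True)
    (fun l s => by rw [St_reg (by simpa)]; grind)
    (fun d l s _ => by
      refine ((det_pop a (by simpa)).seq (s := 4)
        (m'' := St q (((vs.set a l).set b s.1.tail).set c (s.1.headD false :: s.2)) lo) ?_)
      have e : (((vs.set a (d :: l)).set b s.1).set c s.2).set a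
        ((((vs.set a (d :: l)).set b s.1).set c s.2).getD a []).tail =
          (((vs.set a l).set b s.1).set c s.2) :=
        List.ext_getElem? fun n => by grind
      rw [e]
      obtain ⟨s1, s2⟩ := s
      refine det_branch ?_ ?_ ?_ <;> rw [St_reg (by simpa)] <;> intros <;>
        rename_i hw
      · refine ((det_push c false (by simpa)).mono (by simp)).of_eq ?_
        exact St_congr fun n => by grind
      all_goals
        refine ((det_pop b (by simpa)).seq (det_push c _ (by simpa))).of_eq ?_
        exact St_congr fun n => by grind)
    (fun _ _ _ _ => trivial) (vs.getD a []) (vs.getD b [], vs.getD c []) trivial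
  have e : ∀ l s s' : List Bool, l.foldl (fun (s : List Bool × List Bool) _ =>
      (s.1.tail, s.1.headD false :: s.2)) (s, s') =
        (s.drop l.length, (fit l.length s).reverse ++ s') := by
    intro l
    induction l with
    | nil => simp [fit]
    | cons b l ih =>
      intro s s'
      rw [List.foldl_cons, ih]
      cases s with
      | nil => simp [fit_nil_succ]
      | cons c s => simp [fit_cons_succ]
  rw [e, set_getD_self, set_getD_self, set_getD_self] at this
  exact this

/-! ### Self-delimiting strings -/

/-- The self-delimiting encoding of a string: a one before every bit, and a final zero. -/
def enc (w : List Bool) : List Bool := w.flatMap (fun b => [true, b]) ++ [false]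

/-- Split the string into the self-delimiting string at its beginning and the rest. -/
def field : List Bool → List Bool × List Bool
  | true :: b :: l => (b :: (field l).1, (field l).2)
  | false :: l => ([], l)
  | [true] => ([], [])
  | [] => ([], [])

theorem field_enc (w l : List Bool) : field (enc w ++ l) = (w, l) := by
  induction w with
  | nil => rfl
  | cons b w ih =>
    have : enc (b :: w) ++ l = true :: b :: (enc w ++ l) := rfl
    rw [this, field, ih]

theorem length_enc (w : List Bool) : (enc w).length = 2 * w.length + 1 := by
  induction w with
  | nil => rfl
  | cons b w ih =>
    have : enc (b :: w) = true :: b :: enc w := rfl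
    rw [this]; simp [ih]; ring

theorem length_field (l : List Bool) : (field l).1.length + (field l).2.length ≤ l.length := by
  fun_induction field l <;> simp at * ; omega

theorem length_field_lt (b : Bool) (l : List Bool) :
    (field (b :: l)).1.length + (field (b :: l)).2.length < (b :: l).length := by
  cases b with
  | false => simp [field]
  | true =>
    cases l with
    | nil => simp [field]
    | cons c l => have := length_field l; simp [field]; omega

/-- Split a string into self-delimiting strings. -/
def fields : List Bool → List (List Bool)
  | [] => []
  | b :: l => (field (b :: l)).1 :: fields (field (b :: l)).2
termination_by l => l.length
decreasing_by have := length_field_lt b l; omega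

theorem fields_flatMap_enc (rs : List (List Bool)) : fields (rs.flatMap enc) = rs := by
  induction rs with
  | nil => simp [fields]
  | cons r rs ih =>
    have hne : enc r ++ rs.flatMap enc ≠ [] := by simp [enc]
    obtain ⟨b, l, hbl⟩ := List.exists_cons_of_ne_nil hne
    rw [List.flatMap_cons, hbl, fields, ← hbl, field_enc, ih]

/-- Move the self-delimiting string at the top of the stack `a` onto the stack `b`, reversing its
order and decoding it; the stack `g` is auxiliary and has to be empty. -/
def readField (a b g : ℕ) : Prog :=
  .seq (.push g false) (.loop g (.branch a (.pop g) (.seq (.pop a) (.pop g))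
    (.seq (.pop a) (.branch a .skip (.seq (.pop a) (.push b false)) (.seq (.pop a) (.push b true))))))

theorem det_readField (a b g : ℕ) (hg : vs.getD g [] = [] := by rfl) (hab : a ≠ b := by simp)
    (hac : a ≠ g := by simp) (hbc : b ≠ g := by simp) (ha' : a < vs.length := by simp)
    (hb' : b < vs.length := by simp) (hg' : g < vs.length := by simp) :
    Det A (readField a b g) (St q vs lo) (4 * (vs.getD a []).length + 20)
      (St q ((vs.set a (field (vs.getD a [])).2).set b
        ((field (vs.getD a [])).1.reverse ++ vs.getD b [])) lo) := by
  have hfin : ∀ x y, ((vs.set a x).set b y).set g [] = (vs.set a x).set b y := fun x y =>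
    List.ext_getElem? fun n => by grind
  set body : Prog := .branch a (.pop g) (.seq (.pop a) (.pop g))
    (.seq (.pop a) (.branch a .skip (.seq (.pop a) (.push b false))
      (.seq (.pop a) (.push b true)))) with hbody
  set S : List Bool → List Bool → List Bool → Mem := fun l u w =>
    St q (((vs.set a l).set b u).set g w) lo with hS
  have hSa : ∀ l u w, (S l u w).reg a = l := by intro l u w; rw [hS, St_reg (by simpa)]; grind
  have hSg : ∀ l u w, (S l u w).reg g = w := by intro l u w; rw [hS, St_reg (by simpa)]; grind
  have popa : ∀ l u w, Det A (.pop a) (S l u w) 1 (S l.tail u w) := fun l u w =>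
    (det_pop a (by simpa)).of_eq (by rw [hS]; exact St_congr fun n => by grind)
  have popg : ∀ l u w, Det A (.pop g) (S l u w) 1 (S l u w.tail) := fun l u w =>
    (det_pop g (by simpa)).of_eq (by rw [hS]; exact St_congr fun n => by grind)
  have pushb : ∀ l u w c, Det A (.push b c) (S l u w) 1 (S l (c :: u) w) := fun l u w c =>
    (det_push b c (by simpa)).of_eq (by rw [hS]; exact St_congr fun n => by grind)
  have loop_end : ∀ l u, Det A (.loop g body) (S l u []) 1 (S l u []) := fun l u =>
    exec_loop_nil (hSg l u [])
  have det_loop : ∀ {m m' m'' : Mem} {t s}, m.reg g ≠ [] → Det A body m t m' →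
      Det A (.loop g body) m' s m'' → Det A (.loop g body) m (t + s + 1) m'' := by
    intro m m' m'' t s h0 h1 h2
    have := exec_loop_cons (ν := fun _ => PMF.pure m'') h0 h1 (fun m₁ hm₁ => by
      rw [PMF.mem_support_pure_iff] at hm₁
      rw [hm₁]; exact h2)
    simpa [Det] using this
  have main : ∀ l u, Det A (.loop g body) (S l u [false]) (4 * l.length + 17)
      (S (field l).2 ((field l).1.reverse ++ u) []) := by
    intro l
    fun_induction field l with
    | case1 c l ih =>
      intro u
      refine (det_loop (t := 7) (m' := S l (c :: u) [false]) (by simp [hSg]) ?_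
        (by simpa using ih (c :: u))).mono (by simp; omega)
      refine det_branch (by simp [hSa]) (by simp [hSa]) fun _ _ => ?_
      refine (popa _ _ _).seq (s := 4) ?_
      refine det_branch (by simp [hSa]) (fun w hw => ?_) (fun w hw => ?_) <;>
        rw [hSa] at hw <;> simp only [List.tail_cons, List.cons.injEq] at hw <;>
        rw [hw.1] <;> exact (popa _ _ _).seq (pushb _ _ _ _)
    | case2 l =>
      intro u
      refine (det_loop (t := 4) (m' := S l u []) (by simp [hSg]) ?_ (loop_end _ _)).mono
        (by omega)
      exact det_branch (by simp [hSa]) (fun _ _ => (popa _ _ _).seq (popg _ _ _)) (by simp [hSa])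
    | case3 =>
      intro u
      refine (det_loop (t := 7) (m' := S [] u [false]) (by simp [hSg]) ?_
        (det_loop (t := 7) (m' := S [] u []) (by simp [hSg]) ?_ (loop_end _ _))).mono
        (by omega)
      · refine Det.mono (det_branch (t := 6) (by simp [hSa]) (by simp [hSa]) fun _ _ => ?_) le_rfl
        refine (popa _ _ _).seq (s := 4) ?_
        exact det_branch (fun _ => (det_skip _).mono (by simp)) (by simp [hSa]) (by simp [hSa])
      · exact (det_branch (fun _ => popg _ _ _) (by simp [hSa]) (by simp [hSa])).mono (by simp)
    | case4 =>
      intro u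
      refine (det_loop (t := 4) (m' := S [] u []) (by simp [hSg]) ?_ (loop_end _ _)).mono
        (by omega)
      exact (det_branch (fun _ => popg _ _ _) (by simp [hSa]) (by simp [hSa])).mono (by simp)
  have h0 : Det A (.push g false) (St q vs lo) 1 (S (vs.getD a []) (vs.getD b []) [false]) :=
    (det_push g false (by simpa)).of_eq (by
      simp only [hS, set_getD_self, hg])
  refine ((h0.seq (main _ _)).of_eq ?_).mono (by omega)
  simp only [hS, hfin]

/-- Push the self-delimiting encoding of the reversal of the stack `a` onto the stack `b`, emptying
the stack `a`. -/
def encode (a b : ℕ) : Prog :=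
  .seq (.push b false) (.loop a (.branch a .skip
    (.seq (.pop a) (.seq (.push b false) (.push b true)))
    (.seq (.pop a) (.seq (.push b true) (.push b true)))))

theorem det_encode (a b : ℕ) (hab : a ≠ b := by simp) (ha : a < vs.length := by simp)
    (hb : b < vs.length := by simp) :
    Det A (encode a b) (St q vs lo) (7 * (vs.getD a []).length + 3)
      (St q ((vs.set a []).set b (enc (vs.getD a []).reverse ++ vs.getD b [])) lo) := by
  have := det_loop_list (A := A) (r := a)
    (p := .branch a .skip
      (.seq (.pop a) (.seq (.push b false) (.push b true)))
      (.seq (.pop a) (.seq (.push b true) (.push b true)))) (t := 6)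
    (fun l s => St q ((vs.set a l).set b s) lo) (fun c s => true :: c :: s) (fun _ _ => True)
    (fun l s => by rw [St_reg (by simpa)]; grind)
    (fun c l s _ => by
      refine det_branch ?_ ?_ ?_ <;> rw [St_reg (by simpa)] <;> intros <;>
        rename_i hw
      · grind
      all_goals
        refine ((det_pop a (by simpa)).seq ((det_push b _ (by simpa)).seq
          (det_push b _ (by simpa)))).of_eq ?_
        exact St_congr fun n => by grind)
    (fun _ _ _ _ => trivial) (vs.getD a []) (false :: vs.getD b []) trivial
  have e : ∀ l s : List Bool, l.foldl (fun s c => true :: c :: s) (false :: s) =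
      enc l.reverse ++ s := by
    intro l
    induction l using List.reverseRecOn with
    | nil => intro s; simp [enc]
    | append_singleton l b ih => intro s; rw [List.foldl_append, ih]; simp [enc]
  rw [e, set_getD_self] at this
  exact ((det_push b false hb).seq this).mono (by omega)

/-! ### Subroutines -/

/-- The program `p` with the numbers of all stacks increased by `d`. -/
def Prog.shift (d : ℕ) : Prog → Prog
  | .skip => .skip
  | .push r b => .push (r + d) b
  | .pop r => .pop (r + d)
  | .seq p q => .seq (p.shift d) (q.shift d)
  | .branch r pe p0 p1 => .branch (r + d) (pe.shift d) (p0.shift d) (p1.shift d)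
  | .loop r p => .loop (r + d) (p.shift d)
  | .toss r => .toss (r + d)
  | .query r t => .query (r + d) (t + d)
  | .reset => .reset
  | .had r => .had (r + d)
  | .tee r => .tee (r + d)
  | .cnot r s => .cnot (r + d) (s + d)
  | .qquery r l t => .qquery (r + d) (l + d) (t + d)
  | .measure r t => .measure (r + d) (t + d)

theorem Prog.Classical.shift {p : Prog} (h : p.Classical) (d : ℕ) : (p.shift d).Classical := by
  induction p <;> simp_all [Prog.Classical, Prog.shift]

/-- The memory `m` with the stacks `vs` inserted before its own. -/
def Mem.above (vs : List (List Bool)) (m : Mem) : Mem := St m.qst vs m.reg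

theorem Mem.above_reg (m : Mem) (r : ℕ) : (m.above vs).reg (r + vs.length) = m.reg r :=
  regs_add _ _ _

theorem Mem.above_set (m : Mem) (r : ℕ) (w : List Bool) :
    (m.above vs).set (r + vs.length) w = (m.set r w).above vs := by
  simp [Mem.above, St, Mem.set, regs_update_add]

theorem Mem.above_apply (m : Mem) (U : QState → QState) :
    (m.above vs).apply U = (m.apply U).above vs := rfl

/-- A step of a shifted program is a step of the original one on the stacks above `vs`. -/
theorem step_shift (c : Config) :
    step A (c.1.map (Prog.shift vs.length), c.2.above vs) =
      (step A c).map fun c => (c.1.map (Prog.shift vs.length), c.2.above vs) := by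
  obtain ⟨l, m⟩ := c
  cases l with
  | nil => simp [step, PMF.pure_map]
  | cons p l =>
    have hq : (m.above vs).qst = m.qst := rfl
    cases p <;>
      simp only [step, Prog.shift, List.map_cons, PMF.pure_map, PMF.map_bind, Mem.push, Mem.addr,
        Mem.above_reg, Mem.above_set, Mem.above_apply, hq]
    case query => rw [Mem.above_reg]
    all_goals split <;> simp [PMF.pure_map, Prog.shift]

theorem run_shift (t : ℕ) (c : Config) :
    run A t (c.1.map (Prog.shift vs.length), c.2.above vs) =
      (run A t c).map fun c => (c.1.map (Prog.shift vs.length), c.2.above vs) := by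
  induction t generalizing c with
  | zero => simp [run, PMF.pure_map]
  | succ t ih =>
    rw [run, step_shift, PMF.bind_map, run, PMF.map_bind]
    exact congrArg _ (funext ih)

/-- A shifted program acts on the upper stacks as the original program acts on all stacks. -/
theorem exec_shift {p : Prog} {m : Mem} {t : ℕ}
    (h : ∀ c ∈ (run A t ([p], m)).support, c.1 = []) :
    Exec A (p.shift vs.length) (m.above vs) t
      ((run A t ([p], m)).map fun c => c.2.above vs) := by
  have h1 := run_shift (A := A) (vs := vs) t ([p], m)
  unfold Exec ExecL
  simp only [List.map_cons, List.map_nil] at h1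
  rw [h1, PMF.map_comp]
  simp only [PMF.map]
  refine pmf_bind_congr fun c hc => ?_
  simp [h c hc]

/-- A number that exceeds the numbers of all stacks that the program uses. -/
def Prog.bound : Prog → ℕ
  | .skip | .reset => 0
  | .push r _ | .pop r | .toss r | .had r | .tee r => r + 1
  | .seq p q => max p.bound q.bound
  | .branch r pe p0 p1 => max (r + 1) (max pe.bound (max p0.bound p1.bound))
  | .loop r p => max (r + 1) p.bound
  | .query r t | .measure r t | .cnot r t => max (r + 1) (t + 1)
  | .qquery r l t => max (r + 1) (max (l + 1) (t + 1))

/-- A step leaves the stacks with large numbers unchanged, and pushes at most one bit on each stack.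
-/
theorem step_bound {s : ℕ} {c : Config} (h : ∀ p ∈ c.1, p.bound ≤ s) :
    ∀ c' ∈ (step A c).support, (∀ p ∈ c'.1, p.bound ≤ s) ∧
      (∀ r, s ≤ r → c'.2.reg r = c.2.reg r) ∧
        ∀ r, (c'.2.reg r).length ≤ (c.2.reg r).length + 1 := by
  obtain ⟨l, m⟩ := c
  have hset : ∀ (m : Mem) r w, r < s → w.length ≤ (m.reg r).length + 1 →
      (∀ r', s ≤ r' → (m.set r w).reg r' = m.reg r') ∧
        ∀ r', ((m.set r w).reg r').length ≤ (m.reg r').length + 1 := by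
    intro m r w hr hw
    refine ⟨fun r' hr' => ?_, fun r' => ?_⟩ <;> simp only [Mem.set, Function.update_apply]
    · rw [if_neg (by omega)]
    · split_ifs with e
      · subst e; exact hw
      · omega
  cases l with
  | nil => simp [step]
  | cons p l =>
    simp only [List.forall_mem_cons] at h
    obtain ⟨hp, hl⟩ := h
    cases p with
    | branch r pe p0 p1 =>
      simp only [Prog.bound, max_le_iff] at hp
      simp only [step]
      split <;> simp_all
    | loop r p =>
      simp only [Prog.bound, max_le_iff] at hp
      simp only [step]
      split <;> simp_all [Prog.bound]
    | push r b =>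
      simp only [Prog.bound] at hp
      simp only [step, PMF.mem_support_pure_iff, forall_eq]
      exact ⟨hl, hset m r _ (by omega) (by simp)⟩
    | pop r =>
      simp only [Prog.bound] at hp
      simp only [step, PMF.mem_support_pure_iff, forall_eq]
      exact ⟨hl, hset m r _ (by omega) (by simp; omega)⟩
    | toss r =>
      simp only [Prog.bound] at hp
      simp only [step, PMF.mem_support_bind_iff, PMF.mem_support_pure_iff]
      rintro c' ⟨b, _, rfl⟩
      exact ⟨hl, hset m r _ (by omega) (by simp)⟩
    | query r t =>
      simp only [Prog.bound, max_le_iff] at hp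
      simp only [step, PMF.mem_support_pure_iff, forall_eq]
      exact ⟨hl, hset m t _ (by omega) (by simp)⟩
    | measure r t =>
      simp only [Prog.bound, max_le_iff] at hp
      simp only [step, PMF.mem_support_bind_iff, PMF.mem_support_pure_iff]
      rintro c' ⟨b, _, rfl⟩
      exact ⟨hl, hset (m.apply (proj (m.addr r) b)) t _ (by omega) (by simp)⟩
    | seq p q =>
      simp only [Prog.bound, max_le_iff] at hp
      simp only [step, PMF.mem_support_pure_iff, forall_eq]
      simp_all
    | _ =>
      simp only [step, PMF.mem_support_pure_iff, forall_eq]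
      simpa [Mem.apply] using hl

/-- After a run, the stacks with large numbers are unchanged, and the heights of all stacks have
increased at most by the time. This makes it possible to clear the stacks of a subroutine. -/
theorem run_bound {s : ℕ} (t : ℕ) {c : Config} (h : ∀ p ∈ c.1, p.bound ≤ s) :
    ∀ c' ∈ (run A t c).support, (∀ r, s ≤ r → c'.2.reg r = c.2.reg r) ∧
        ∀ r, (c'.2.reg r).length ≤ (c.2.reg r).length + t := by
  induction t generalizing c with
  | zero => simp [run]
  | succ t ih =>
    simp only [run, PMF.mem_support_bind_iff]
    rintro c' ⟨d, hd, hc'⟩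
    obtain ⟨h1, h2, h3⟩ := step_bound h d hd
    obtain ⟨h4, h5⟩ := ih h1 c' hc'
    refine ⟨fun r hr => (h4 r hr).trans (h2 r hr), fun r => ?_⟩
    have := h3 r
    have := h5 r
    omega

/-- Empty the stacks `d, …, d + s - 1`. -/
def clearAll (d : ℕ) : ℕ → Prog
  | 0 => .skip
  | s + 1 => .seq (clearAll d s) (clear (s + d))

/-- Clearing the stacks that a subroutine may have used, when their heights are at most `u`. -/
theorem det_clearAll (s : ℕ) (m : Mem) (u : ℕ) (hu : ∀ r, (m.reg r).length ≤ u) :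
    Det A (clearAll vs.length s) (m.above vs) ((2 * u + 2) * s + 1)
      (St m.qst vs fun r => if r < s then [] else m.reg r) := by
  induction s with
  | zero => exact (det_skip (m.above vs)).mono (by simp)
  | succ s ih =>
    set m' : Mem := ⟨fun r => if r < s then [] else m.reg r, m.qst⟩
    have h := det_loop_list (A := A) (r := s + vs.length) (p := .pop (s + vs.length)) (t := 1)
      (fun l (_ : Unit) => (m'.set s l).above vs) (fun _ s => s) (fun _ _ => True)
      (fun l _ => by rw [Mem.above_reg]; simp [Mem.set])
      (fun b l _ _ => ExecL.of_step
        (c := ([], (((m'.set s (b :: l)).above vs).set (s + vs.length)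
          ((((m'.set s (b :: l)).above vs).reg (s + vs.length)).tail)))) rfl (by
        rw [Mem.above_reg, Mem.above_set]
        simpa [Mem.set] using execL_nil 0 _))
      (fun _ _ _ _ => trivial) (m'.reg s) () trivial
    have e1 : m'.set s (m'.reg s) = m' := by simp [Mem.set]
    have e2 : (m'.set s []).above vs = St m.qst vs fun r => if r < s + 1 then [] else m.reg r := by
      rw [Mem.above]
      congr 1
      funext r
      simp only [Mem.set, Function.update_apply, m']
      grind
    rw [e1, e2] at h
    have e3 : m'.reg s = m.reg s := by simp [m']
    rw [e3] at h
    refine (ih.seq h).mono ?_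
    have := hu s
    nlinarith

local infixr:60 " ;; " => Prog.seq

/-- Sequential composition when the distribution of the intermediate memory is the image of a
distribution on a type `σ`. -/
theorem Exec.seq_map {σ : Type*} {p p' : Prog} {m : Mem} {t s : ℕ} {μ : PMF σ} {f : σ → Mem}
    {ν : σ → PMF Mem} (h : Exec A p m t (μ.map f))
    (hq : ∀ c ∈ μ.support, Exec A p' (f c) s (ν c)) :
    Exec A (p ;; p') m (t + s + 1) (μ.bind ν) := by
  set ν' : Mem → PMF Mem := fun m' => (run A s ([p'], m')).map Prod.snd
  have hν : ∀ c ∈ μ.support, ν' (f c) = ν c := fun c hc => (ExecL.eq_snd (hq c hc)).symm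
  have := h.seq (ν := ν') (q := p') (s := s) (fun m' hm' => by
    rw [PMF.mem_support_map_iff] at hm'
    obtain ⟨c, hc, rfl⟩ := hm'
    rw [hν c hc]; exact hq c hc)
  rw [PMF.bind_map] at this
  rwa [pmf_bind_congr (f := ν' ∘ f) (g := ν) hν] at this

theorem Exec.seq_map_det {σ : Type*} {p p' : Prog} {m : Mem} {t s : ℕ} {μ : PMF σ}
    {f g : σ → Mem} (h : Exec A p m t (μ.map f))
    (hq : ∀ c ∈ μ.support, Det A p' (f c) s (g c)) :
    Exec A (p ;; p') m (t + s + 1) (μ.map g) := h.seq_map hq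

theorem initial_eq (B : Prog) (x : List Bool) (k n : ℕ) :
    initial B x k = ([B], St (ket ∅) (x :: List.replicate k false :: List.replicate n [])
      fun _ => []) := by
  have h : ∀ n, regs (List.replicate n []) (fun _ => []) = fun _ => [] := by
    intro n
    induction n with
    | zero => rfl
    | succ n ih => funext r; cases r <;> simp [regs, List.replicate_succ, ih]
  simp only [initial, St]
  congr
  funext r
  match r with
  | 0 => rfl
  | 1 => rfl
  | r + 2 => simp [regs, h]

theorem haltsWithin_of_exec {B : Prog} {x : List Bool} {k t : ℕ} {μ : PMF Mem}
    (h : Exec A B (initial B x k).2 t μ) : HaltsWithin A B x k t := ExecL.halts h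

theorem output_of_exec {B : Prog} {x : List Bool} {k t : ℕ} {μ : PMF Mem}
    (h : Exec A B (initial B x k).2 t μ) : output A B x k t = μ.map fun m => m.reg 2 := by
  have h1 : run A t (initial B x k) = μ.map (Prod.mk []) := h
  simp only [output, h1, PMF.map_comp]
  rfl

theorem HaltsWithin.mono {B : Prog} {x : List Bool} {k t t' : ℕ} (h : HaltsWithin A B x k t)
    (ht : t ≤ t') : HaltsWithin A B x k t' :=
  haltsWithin_of_exec (Exec.mono (execL_of_halts h) ht)

/-- Running an algorithm longer than it needs does not change the output. -/
theorem output_mono {B : Prog} {x : List Bool} {k t t' : ℕ} (h : HaltsWithin A B x k t)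
    (ht : t ≤ t') : output A B x k t' = output A B x k t := by
  have h1 : Exec A B (initial B x k).2 t _ := execL_of_halts h
  rw [output_of_exec h1, output_of_exec (h1.mono ht)]

/-- Calling `B` as a subroutine, with input and output on the first stacks above `vs`. -/
theorem exec_call {B : Prog} {x : List Bool} {k t : ℕ} (h : HaltsWithin A B x k t) :
    Exec A (B.shift vs.length) (St (ket ∅) (vs ++ [x, List.replicate k false]) fun _ => []) t
      ((run A t (initial B x k)).map fun c =>
        St c.2.qst (vs ++ [c.2.reg 0, c.2.reg 1, c.2.reg 2]) fun r => c.2.reg (r + 3)) := by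
  have h1 := exec_shift (vs := vs) h
  have e1 : (initial B x k).2.above vs =
      St (ket ∅) (vs ++ [x, List.replicate k false]) fun _ => [] := by
    rw [initial_eq B x k 0]
    simp only [Mem.above, St, regs_append]
    rfl
  have e2 : (fun c : Config => c.2.above vs) = fun c =>
      St c.2.qst (vs ++ [c.2.reg 0, c.2.reg 1, c.2.reg 2]) fun r => c.2.reg (r + 3) := by
    funext c
    simp only [Mem.above, St, regs_append]
    congr 2
    funext r
    match r with
    | 0 => rfl
    | 1 => rfl
    | 2 => rfl
    | r + 3 => rfl
  rw [← e1, ← e2]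
  exact h1

/-! ### Computing polynomials -/

theorem eval_mono (p : Polynomial ℕ) {a b : ℕ} (h : a ≤ b) : p.eval a ≤ p.eval b := by
  rw [Polynomial.eval_eq_sum, Polynomial.eval_eq_sum]
  exact Finset.sum_le_sum fun i _ => Nat.mul_le_mul_left _ (Nat.pow_le_pow_left h i)

/-- The specification of a program that computes the polynomial `p`, in unary, in time `T`, with its
argument on the stack `a`, its value on the stack `b`, and the auxiliary stacks `c` and `e`. -/
def Computes (P : Prog) (p T : Polynomial ℕ) (a b c e : ℕ) : Prop :=
  ∀ (A : Set (List Bool)) (q : QState)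
      (vs : List (List Bool)) (lo : ℕ → List Bool) (n : ℕ), a < vs.length → b < vs.length →
      c < vs.length → e < vs.length → vs.getD a [] = List.replicate n false → vs.getD b [] = [] →
      vs.getD c [] = [] → vs.getD e [] = [] →
      Det A P (St q vs lo) (T.eval n)
        (St q (vs.set b (List.replicate (p.eval n) false)) lo)

/-- The values of a polynomial can be computed in polynomial time, by Horner's rule. -/
theorem exists_polyProg (p : Polynomial ℕ) (a b c e : ℕ) (hab : a ≠ b) (hac : a ≠ c) (hae : a ≠ e)
    (hbc : b ≠ c) (hbe : b ≠ e) (hce : c ≠ e) :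
    ∃ (P : Prog) (T : Polynomial ℕ), P.Classical ∧ Computes P p T a b c e := by
  induction p using Polynomial.recOnHorner with
  | M0 =>
    refine ⟨.skip, 1, trivial, fun A q vs lo n ha hb hc he va vb vc ve => ?_⟩
    refine ((det_skip _).of_eq ?_).mono (by simp)
    exact St_congr fun i => by simp; rw [← vb, set_getD_self]
  | MC p r _ _ ih =>
    obtain ⟨P, T, hP, h⟩ := ih
    have hpush : ∀ r : ℕ, ∃ R : Prog, R.Classical ∧ ∀ (A : Set (List Bool)) (q : QState)
        (vs : List (List Bool)) (lo : ℕ → List Bool) (n : ℕ), b < vs.length →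
        Det A R (St q (vs.set b (List.replicate n false)) lo) (2 * r + 1)
          (St q (vs.set b (List.replicate (n + r) false)) lo) := by
      intro r
      induction r with
      | zero => exact ⟨.skip, trivial, fun A q vs lo n _ => det_skip _⟩
      | succ r ih =>
        obtain ⟨R, hR, h⟩ := ih
        refine ⟨R ;; .push b false, ⟨hR, trivial⟩, fun A q vs lo n hb => ?_⟩
        refine (((h A q vs lo n hb).seq (det_push b false (by simpa))).of_eq ?_).mono (by omega)
        rw [getD_set_eq hb, List.set_set, ← List.replicate_succ, ← add_assoc]
    obtain ⟨R, hR, hr⟩ := hpush r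
    refine ⟨P ;; R, T + Polynomial.C (2 * r + 2), ⟨hP, hR⟩,
      fun A q vs lo n ha hb hc he va vb vc ve => ?_⟩
    refine (((h A q vs lo n ha hb hc he va vb vc ve).seq (hr A q vs lo _ hb)).of_eq ?_).mono ?_
    · simp
    · rw [Polynomial.eval_add, Polynomial.eval_C]; omega
  | MX p _ ih =>
    obtain ⟨P, T, hP, h⟩ := ih
    refine ⟨P ;; unary b c ;; .loop c (.pop c ;; copyRev a b e),
      T + (4 * p + 20 + (12 * Polynomial.X + 20) * p), ⟨hP, by simp [unary, Prog.Classical],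
      by simp [copyRev, dup, move, Prog.Classical]⟩,
      fun A q vs lo n ha hb hc he va vb vc ve => ?_⟩
    have hl := det_loop_list (A := A) (r := c) (p := .pop c ;; copyRev a b e) (t := 12 * n + 5)
      (fun l s => St q ((vs.set c l).set b (List.replicate s false)) lo) (fun _ s => s + n)
      (fun _ _ => True) (fun l s => by rw [St_reg (by simpa)]; grind)
      (fun d l s _ => by
        refine ((det_pop c (by simpa)).seq (det_copyRev a b e ?_ hab hae hbe (by simpa) (by simpa)
          (by simpa))).of_eq ?_ |>.mono ?_
        · grind
        · have h1 : (((vs.set c (d :: l)).set b (List.replicate s false)).set c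
            (((vs.set c (d :: l)).set b (List.replicate s false)).getD c []).tail).getD a [] =
              List.replicate n false := by rw [← va]; grind
          rw [h1, add_comm s n, List.replicate_add, List.reverse_replicate]
          exact St_congr fun i => by grind
        · have h1 : (((vs.set c (d :: l)).set b (List.replicate s false)).set c
            (((vs.set c (d :: l)).set b (List.replicate s false)).getD c []).tail).getD a [] =
              List.replicate n false := by rw [← va]; grind
          rw [h1, List.length_replicate]; omega)
      (fun _ _ _ _ => trivial) (List.replicate (p.eval n) false) 0 trivial
    have hf : ∀ (l : List Bool) (s : ℕ), l.foldl (fun s _ => s + n) s = s + l.length * n := by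
      intro l
      induction l with
      | nil => simp
      | cons b l ih => intro s; rw [List.foldl_cons, ih, List.length_cons]; ring
    rw [hf, List.length_replicate, zero_add] at hl
    refine (((h A q vs lo n ha hb hc he va vb vc ve).seq
      (((det_unary b c hbc (by simpa) (by simpa)).of_eq ?_).seq hl)).of_eq ?_).mono ?_
    · rw [getD_set_eq hb, getD_set_ne hbc, vc, List.append_nil, List.length_replicate]
      exact St_congr fun i => by simp only [List.replicate_zero]; grind
    · rw [Polynomial.eval_mul_X]
      refine St_congr fun i => ?_
      generalize List.replicate (Polynomial.eval n p * n) false = y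
      grind
    · rw [getD_set_eq hb]
      simp
      nlinarith

/-! ### Expectations and variation distance -/

/-- The expectation of a nonnegative function. -/
def ex {α : Type*} (P : PMF α) (f : α → ℝ≥0∞) : ℝ≥0∞ := ∑' a, P a * f a

section

variable {α β : Type*}

theorem ex_pure (a : α) (f : α → ℝ≥0∞) : ex (PMF.pure a) f = f a := by
  classical
  rw [ex, tsum_eq_single a]
  · simp
  · intro b hb; simp [hb]

theorem ex_bind (P : PMF α) (g : α → PMF β) (f : β → ℝ≥0∞) :
    ex (P.bind g) f = ex P fun a => ex (g a) f := by
  simp only [ex, PMF.bind_apply, ← ENNReal.tsum_mul_right, ← ENNReal.tsum_mul_left]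
  rw [ENNReal.tsum_comm]
  simp only [mul_assoc]

theorem ex_map (P : PMF α) (g : α → β) (f : β → ℝ≥0∞) : ex (P.map g) f = ex P (f ∘ g) := by
  rw [PMF.map, ex_bind]
  simp only [Function.comp_def, ex_pure]

theorem ex_const (P : PMF α) (c : ℝ≥0∞) : (ex P fun _ => c) = c := by
  rw [ex, ENNReal.tsum_mul_right, P.tsum_coe, one_mul]

theorem ex_mono_support {P : PMF α} {f g : α → ℝ≥0∞} (h : ∀ a ∈ P.support, f a ≤ g a) :
    ex P f ≤ ex P g := by
  refine ENNReal.tsum_le_tsum fun a => ?_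
  by_cases ha : P a = 0
  · simp [ha]
  · gcongr; exact h a ha

theorem ex_mono {P : PMF α} {f g : α → ℝ≥0∞} (h : ∀ a, f a ≤ g a) : ex P f ≤ ex P g :=
  ex_mono_support fun a _ => h a

theorem ex_le_const {P : PMF α} {f : α → ℝ≥0∞} {c : ℝ≥0∞} (h : ∀ a ∈ P.support, f a ≤ c) :
    ex P f ≤ c := (ex_mono_support h).trans_eq (ex_const P c)

theorem ex_add (P : PMF α) (f g : α → ℝ≥0∞) : (ex P fun a => f a + g a) = ex P f + ex P g := by
  simp only [ex, mul_add, ENNReal.tsum_add]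

theorem ex_mul_left (P : PMF α) (c : ℝ≥0∞) (f : α → ℝ≥0∞) :
    (ex P fun a => c * f a) = c * ex P f := by
  simp only [ex, ← ENNReal.tsum_mul_left]
  refine tsum_congr fun a => by ring

theorem ex_mul_right (P : PMF α) (c : ℝ≥0∞) (f : α → ℝ≥0∞) :
    (ex P fun a => f a * c) = ex P f * c := by
  simp only [ex, ← ENNReal.tsum_mul_right, mul_assoc]

theorem ex_tsum {ι : Type*} (P : PMF α) (f : ι → α → ℝ≥0∞) :
    (ex P fun a => ∑' i, f i a) = ∑' i, ex P (f i) := by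
  simp only [ex, ← ENNReal.tsum_mul_left]
  rw [ENNReal.tsum_comm]

theorem ex_comm (P : PMF α) (Q : PMF β) (f : α → β → ℝ≥0∞) :
    (ex P fun a => ex Q fun b => f a b) = ex Q fun b => ex P fun a => f a b := by
  simp only [ex, ← ENNReal.tsum_mul_left]
  rw [ENNReal.tsum_comm]
  refine tsum_congr fun b => tsum_congr fun a => by ring

open scoped Classical in
/-- The probability of the event `E`. -/
def prob (P : PMF α) (E : α → Prop) : ℝ≥0∞ := ex P fun a => if E a then 1 else 0

theorem toOuterMeasure_eq_prob (P : PMF α) (E : Set α) : P.toOuterMeasure E = prob P (· ∈ E) := by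
  classical
  rw [PMF.toOuterMeasure_apply, prob, ex]
  refine tsum_congr fun a => ?_
  by_cases h : a ∈ E <;> simp [h]

theorem prob_le_one (P : PMF α) (E : α → Prop) : prob P E ≤ 1 :=
  ex_le_const fun a _ => by split_ifs <;> simp

theorem prob_mono {P : PMF α} {E F : α → Prop} (h : ∀ a ∈ P.support, E a → F a) :
    prob P E ≤ prob P F :=
  ex_mono_support fun a ha => by
    have := h a ha
    split_ifs <;> simp_all

theorem prob_compl (P : PMF α) (E : α → Prop) : prob P E + prob P (fun a => ¬ E a) = 1 := by
  rw [prob, prob, ← ex_add]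
  refine Eq.trans ?_ (ex_const P 1)
  congr 1
  funext a
  by_cases h : E a <;> simp [h]

theorem prob_map (P : PMF α) (g : α → β) (E : β → Prop) :
    prob (P.map g) E = prob P fun a => E (g a) := by
  rw [prob, ex_map]; rfl

theorem prob_bind (P : PMF α) (g : α → PMF β) (E : β → Prop) :
    prob (P.bind g) E = ex P fun a => prob (g a) E := ex_bind _ _ _

/-- Markov's inequality. -/
theorem prob_le_of_le {P : PMF α} {E : α → Prop} {f : α → ℝ≥0∞} (h : ∀ a ∈ P.support, E a → 1 ≤ f a) :
    prob P E ≤ ex P f :=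
  ex_mono_support fun a ha => by
    split_ifs with hE
    · exact h a ha hE
    · simp

theorem prob_ne_top (P : PMF α) (E : α → Prop) : prob P E ≠ ∞ :=
  ne_top_of_le_ne_top ENNReal.one_ne_top (prob_le_one P E)

/-- The event `E` is at most by `ε` more likely under `P` than under `D`, and the same holds for the
expectation of every function with values in `[0, 1]`. -/
def Close (P D : PMF α) (ε : ℝ≥0∞) : Prop :=
  ∀ f : α → ℝ≥0∞, (∀ a, f a ≤ 1) → ex P f ≤ ex D f + ε

theorem Close.prob_le {P D : PMF α} {ε : ℝ≥0∞} (h : Close P D ε) (E : α → Prop) :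
    prob P E ≤ prob D E + ε := h _ fun a => by split_ifs <;> simp

theorem Close.map {P D : PMF α} {ε : ℝ≥0∞} (h : Close P D ε) (g : α → β) :
    Close (P.map g) (D.map g) ε := fun f hf => by
  rw [ex_map, ex_map]; exact h _ fun a => hf _

theorem Close.mono {P D : PMF α} {ε ε' : ℝ≥0∞} (h : Close P D ε) (hε : ε ≤ ε') : Close P D ε' :=
  fun f hf => (h f hf).trans (by gcongr)

end

section

variable {P D : PMF (List Bool)}

theorem tsum_sub_comm (P D : PMF (List Bool)) : ∑' y, (P y - D y) = ∑' y, (D y - P y) := by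
  have h : ∑' y, (P y - D y) + 1 = ∑' y, (D y - P y) + 1 := by
    nth_rw 1 [← D.tsum_coe]
    rw [← P.tsum_coe, ← ENNReal.tsum_add, ← ENNReal.tsum_add]
    refine tsum_congr fun y => ?_
    rcases le_total (P y) (D y) with hy | hy
    · rw [tsub_eq_zero_of_le hy, tsub_add_cancel_of_le hy, zero_add]
    · rw [tsub_eq_zero_of_le hy, tsub_add_cancel_of_le hy, zero_add]
  exact (ENNReal.add_left_inj ENNReal.one_ne_top).mp h

theorem tsum_sub_ne_top (P D : PMF (List Bool)) : ∑' y, (P y - D y) ≠ ∞ :=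
  ne_top_of_le_ne_top ENNReal.one_ne_top
    ((ENNReal.tsum_le_tsum fun _ => tsub_le_self).trans_eq P.tsum_coe)

/-- The positive and the negative part of `P - D` have the same sum. -/
theorem tvDist_eq (P D : PMF (List Bool)) : tvDist P D = (∑' y, (P y - D y)).toReal := by
  have h : ∀ y, |(P y).toReal - (D y).toReal| = ((P y - D y) + (D y - P y)).toReal := by
    intro y
    have hP := P.apply_ne_top y
    have hD := D.apply_ne_top y
    rcases le_total (P y) (D y) with hy | hy
    · rw [tsub_eq_zero_of_le hy, zero_add, ENNReal.toReal_sub_of_le hy hD, abs_sub_comm,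
        abs_of_nonneg (sub_nonneg.mpr (ENNReal.toReal_mono hD hy))]
    · rw [tsub_eq_zero_of_le hy, add_zero, ENNReal.toReal_sub_of_le hy hP,
        abs_of_nonneg (sub_nonneg.mpr (ENNReal.toReal_mono hP hy))]
  have hne : ∀ y, (P y - D y) + (D y - P y) ≠ ∞ := fun y =>
    ENNReal.add_ne_top.mpr ⟨ENNReal.sub_ne_top (P.apply_ne_top y),
      ENNReal.sub_ne_top (D.apply_ne_top y)⟩
  rw [tvDist]
  simp only [h]
  rw [← ENNReal.tsum_toReal_eq hne, ENNReal.tsum_add, ← tsum_sub_comm P D,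
    ENNReal.toReal_add (tsum_sub_ne_top P D) (tsum_sub_ne_top P D)]
  ring

theorem close_of_tvDist {r : ℝ} (h : tvDist P D ≤ r) : Close P D (ENNReal.ofReal r) := by
  intro f hf
  have h1 : ∑' y, (P y - D y) ≤ ENNReal.ofReal r := by
    rw [← ENNReal.ofReal_toReal (tsum_sub_ne_top P D), ← tvDist_eq]
    exact ENNReal.ofReal_le_ofReal h
  calc ex P f ≤ ∑' y, (D y * f y + (P y - D y)) := by
        refine ENNReal.tsum_le_tsum fun y => ?_
        calc P y * f y ≤ (D y + (P y - D y)) * f y := by gcongr; exact le_add_tsub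
          _ = D y * f y + (P y - D y) * f y := add_mul _ _ _
          _ ≤ D y * f y + (P y - D y) * 1 := by gcongr; exact hf y
          _ = _ := by rw [mul_one]
    _ = ex D f + ∑' y, (P y - D y) := ENNReal.tsum_add
    _ ≤ _ := by gcongr

theorem tvDist_comm (P D : PMF (List Bool)) : tvDist P D = tvDist D P := by
  rw [tvDist_eq, tvDist_eq, tsum_sub_comm]

theorem tvDist_self (P : PMF (List Bool)) : tvDist P P = 0 := by
  simp [tvDist]

/-- A bound for the variation distance follows from one for the probabilities of events. -/
theorem tvDist_le_of_prob {r : ℝ} (hr : 0 ≤ r)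
    (h : ∀ E : List Bool → Prop, prob P E ≤ prob D E + ENNReal.ofReal r) : tvDist P D ≤ r := by
  classical
  have h1 := h fun y => D y ≤ P y
  have h2 : prob P (fun y => D y ≤ P y) = prob D (fun y => D y ≤ P y) + ∑' y, (P y - D y) := by
    rw [prob, prob, ex, ex, ← ENNReal.tsum_add]
    refine tsum_congr fun y => ?_
    split_ifs with hy
    · simp [add_tsub_cancel_of_le hy]
    · simp [tsub_eq_zero_of_le (not_le.mp hy).le]
  rw [h2] at h1
  have h3 := (ENNReal.add_le_add_iff_left (prob_ne_top _ _)).mp h1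
  rw [tvDist_eq]
  exact ENNReal.toReal_le_of_le_ofReal hr h3

end

/-! ### From sampling to searching -/

/-- On a string that encodes `x` and `0^k`, sample the output of `B` on the input `⟨x, 0^(k + 1)⟩`,
adjusted to the length of the string. -/
def samplerProg (B : Prog) : Prog :=
  (copyRev 0 3 5 ;; readField 0 4 5 ;; move 4 7 ;; readField 0 4 5 ;; unary 4 8 ;;
    .push 8 false) ;; B.shift 7 ;; transfer 3 9 5 ;; move 5 2

theorem exec_samplerProg {B : Prog} {z : List Bool} {e t : ℕ}
    (h : HaltsWithin A B (field z).1 ((field (field z).2).1.length + 1) t) :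
    ∃ μ, Exec A (samplerProg B) (initial (samplerProg B) z e).2 (100 * z.length + 100 + t) μ ∧
      μ.map (fun m => m.reg 2) =
        (output A B (field z).1 ((field (field z).2).1.length + 1) t).map (fit z.length) := by
  set x := (field z).1 with hx
  set w := (field z).2 with hw
  have l1 := length_field z
  have l2 := length_field w
  rw [← hx, ← hw] at l1
  have e1 : List.replicate ((field w).1.length + 1) false =
      false :: List.replicate (field w).1.length false := rfl
  have pre : Det A (copyRev 0 3 5 ;; readField 0 4 5 ;; move 4 7 ;; readField 0 4 5 ;; unary 4 8 ;;
      .push 8 false) (initial (samplerProg B) z e).2 (60 * z.length + 80)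
      (St (ket ∅) ([(field w).2, List.replicate e false, [], z.reverse, [], [], []] ++
        [x, List.replicate ((field w).1.length + 1) false]) fun _ => []) := by
    rw [initial_eq _ z e 7]
    refine ((det_copyRev 0 3 5).seq ((det_readField 0 4 5).seq ((det_move 4 7).seq
      ((det_readField 0 4 5).seq ((det_unary 4 8).seq (det_push 8 false)))))).of_eq ?_ |>.mono ?_
    · simp [List.replicate_succ, ← hx, ← hw]
    · simp [List.replicate_succ, ← hx, ← hw]
      omega
  have call := exec_call (vs := [(field w).2, List.replicate e false, [], z.reverse, [], [], []]) h
  have post : ∀ (q : QState) (u0 u1 u2 : List Bool) (lo : ℕ → List Bool),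
      Det A (transfer 3 9 5 ;; move 5 2) (St q
        ([(field w).2, List.replicate e false, [], z.reverse, [], [], []] ++ [u0, u1, u2]) lo)
        (12 * z.length + 3) (St q ([(field w).2, List.replicate e false, fit z.length u2, [], [], [],
          []] ++ [u0, u1, u2.drop z.length]) lo) := by
    intro q u0 u1 u2 lo
    refine ((det_transfer 3 9 5).seq (det_move 5 2)).of_eq ?_ |>.mono ?_
    · simp
    · simp; omega
  refine ⟨_, (pre.seq_exec (call.seq_map_det fun c _ => post _ _ _ _ _)).mono (by omega), ?_⟩
  rw [PMF.map_comp, output, PMF.map_comp]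
  rfl

/-- The search algorithm that runs the sampling algorithm `C` on the string that encodes `x` and
`0^(2k)`, padded to the length of the solutions, which the program `P` computes. -/
def searchProg (P C : Prog) : Prog :=
  (move 0 5 ;; copyRev 5 0 6 ;; unary 0 3 ;; P ;; copyRev 4 8 6 ;; copyRev 1 6 7 ;;
    copyRev 1 6 7 ;; copyRev 6 9 7 ;; encode 6 8 ;; encode 5 8) ;; C.shift 8 ;; transfer 4 10 5 ;;
    move 5 2

theorem exec_searchProg {P C : Prog} {p T : Polynomial ℕ} {x z : List Bool} {k t : ℕ}
    (hP : Computes P p T 3 4 6 7)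
    (hz : z = enc x ++ (enc (List.replicate (k + k) false) ++ List.replicate (p.eval x.length) false))
    (h : HaltsWithin A C z (k + k) t) :
    ∃ μ, Exec A (searchProg P C) (initial (searchProg P C) x k).2
      (100 * x.length + 100 * k + 100 + 100 * p.eval x.length + T.eval x.length + t) μ ∧
      μ.map (fun m => m.reg 2) =
        (output A C z (k + k) t).map (fit (p.eval x.length)) := by
  set m := p.eval x.length
  have pre : Det A (move 0 5 ;; copyRev 5 0 6 ;; unary 0 3 ;; P ;; copyRev 4 8 6 ;; copyRev 1 6 7 ;;
      copyRev 1 6 7 ;; copyRev 6 9 7 ;; encode 6 8 ;; encode 5 8)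
      (initial (searchProg P C) x k).2
      (80 * x.length + 80 * k + 80 + 80 * m + T.eval x.length)
      (St (ket ∅) ([[], List.replicate k false, [], List.replicate x.length false,
        List.replicate m false, [], [], []] ++ [z, List.replicate (k + k) false]) fun _ => []) := by
    rw [initial_eq _ x k 8]
    refine ((det_move 0 5).seq ((det_copyRev 5 0 6).seq ((det_unary 0 3).seq
      ((hP _ _ _ _ x.length (by simp) (by simp) (by simp) (by simp) (by simp) rfl rfl rfl).seq
      ((det_copyRev 4 8 6).seq ((det_copyRev 1 6 7).seq ((det_copyRev 1 6 7).seq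
        ((det_copyRev 6 9 7).seq
        ((det_encode 6 8).seq (det_encode 5 8)))))))))).of_eq ?_ |>.mono ?_
    · simp [List.replicate_succ, hz]
      rfl
    · simp [List.replicate_succ]
      omega
  have call := exec_call (vs := [[], List.replicate k false, [], List.replicate x.length false,
        List.replicate m false, [], [], []]) h
  have post : ∀ (q : QState) (u0 u1 u2 : List Bool) (lo : ℕ → List Bool),
      Det A (transfer 4 10 5 ;; move 5 2) (St q
        ([[], List.replicate k false, [], List.replicate x.length false,
        List.replicate m false, [], [], []] ++ [u0, u1, u2]) lo)
        (12 * m + 3) (St q ([[], List.replicate k false, fit m u2, List.replicate x.length false,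
        [], [], [], []] ++ [u0, u1, u2.drop m]) lo) := by
    intro q u0 u1 u2 lo
    refine ((det_transfer 4 10 5).seq (det_move 5 2)).of_eq ?_ |>.mono ?_
    · simp
    · simp; omega
  refine ⟨_, (pre.seq_exec (call.seq_map_det fun c _ => post _ _ _ _ _)).mono (by omega), ?_⟩
  rw [PMF.map_comp, output, PMF.map_comp]
  rfl

theorem FBPPRel_subset (A : Set (List Bool)) : FBPPRel A ⊆ FBQPRel A :=
  fun _ ⟨B, _, hB⟩ => ⟨B, hB⟩

theorem SampPRel_subset (A : Set (List Bool)) : SampPRel A ⊆ SampBQPRel A :=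
  fun _ ⟨B, _, hB⟩ => ⟨B, hB⟩

/-- A quantum algorithm for a search problem is itself a sampling problem in `SampBQP`. -/
theorem FBPPRel_eq_of_SampPRel_eq (h : SampPRel A = SampBQPRel A) : FBPPRel A = FBQPRel A := by
  refine (FBPPRel_subset A).antisymm ?_
  rintro R ⟨B, TB, hB⟩
  obtain ⟨p, hp⟩ := R.exists_length
  -- the sampling problem: the output of `B`, with the required precision encoded in the input
  let dist : List Bool → PMF (List Bool) := fun z =>
    (output A B (field z).1 ((field (field z).2).1.length + 1)
      (TB.eval ((field z).1.length + ((field (field z).2).1.length + 1)))).map (fit z.length)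
  have hlen : ∀ z, ∀ y ∈ (dist z).support, y.length = (Polynomial.X : Polynomial ℕ).eval z.length := by
    intro z y hy
    rw [PMF.mem_support_map_iff] at hy
    obtain ⟨u, _, rfl⟩ := hy
    simp
  let S : SamplingProblem := ⟨dist, Polynomial.X, hlen⟩
  have hS : S ∈ SampBQPRel A := by
    refine ⟨samplerProg B, 100 * Polynomial.X + 100 + TB.comp (Polynomial.X + 1), fun z e _ => ?_⟩
    obtain ⟨μ, h1, h2⟩ := exec_samplerProg (e := e)
      (hB (field z).1 ((field (field z).2).1.length + 1) (Nat.succ_pos _)).1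
    have h3 := h1.mono (t' := (100 * Polynomial.X + 100 + TB.comp (Polynomial.X + 1)).eval
      (z.length + e)) (by
        have l1 := length_field z
        have l2 := length_field (field z).2
        have := eval_mono TB (show (field z).1.length + ((field (field z).2).1.length + 1) ≤
          z.length + e + 1 by omega)
        simp
        omega)
    refine ⟨haltsWithin_of_exec h3, ?_⟩
    rw [output_of_exec h3, h2]
    exact (tvDist_self _).trans_le (by positivity)
  rw [← h] at hS
  obtain ⟨C, hC, TC, hSC⟩ := hS
  obtain ⟨P, T, hPc, hP⟩ := exists_polyProg p 3 4 6 7 (by simp) (by simp) (by simp) (by simp)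
    (by simp) (by simp)
  refine ⟨searchProg P C, ⟨by simp [move, copyRev, dup, unary, encode, hPc, Prog.Classical],
    hC.shift 8, by simp [transfer, move, Prog.Classical]⟩,
    100 * Polynomial.X + 100 + 100 * p + T +
      TC.comp (10 * Polynomial.X + p + 2), fun x k hk => ?_⟩
  set z := enc x ++ (enc (List.replicate (k + k) false) ++
    List.replicate (p.eval x.length) false) with hz
  have hzl : z.length = 2 * x.length + 4 * k + p.eval x.length + 2 := by
    simp [hz, length_enc]; omega
  obtain ⟨hH, htv⟩ := hSC z (k + k) (by omega)
  obtain ⟨μ, h1, h2⟩ := exec_searchProg hP hz hH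
  set T' := (100 * Polynomial.X + 100 + 100 * p + T +
      TC.comp (10 * Polynomial.X + p + 2)).eval (x.length + k) with hT'
  have h3 := h1.mono (t' := T') (by
        have e1 := eval_mono p (show x.length ≤ x.length + k by omega)
        have e2 := eval_mono T (show x.length ≤ x.length + k by omega)
        have e3 := eval_mono TC (show z.length + (k + k) ≤
          10 * (x.length + k) + p.eval (x.length + k) + 2 by omega)
        simp [hT']
        omega)
  refine ⟨haltsWithin_of_exec h3, ?_⟩
  rw [output_of_exec h3, h2, toOuterMeasure_eq_prob, prob_map]
  set E : List Bool → Prop := fun y => fit (p.eval x.length) y ∈ R.sol x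
  have hkr : (0 : ℝ) < k := by exact_mod_cast hk
  have hclose := (close_of_tvDist ((tvDist_comm _ _).trans_le htv)).prob_le E
  have f1 : (field z).1 = x := by rw [hz, field_enc]
  have f2 : (field (field z).2).1.length = k + k := by rw [hz, field_enc, field_enc]; simp
  have hB' := (hB x (k + k + 1) (Nat.succ_pos _)).2
  have hge : 1 - 1 / ((k + k + 1 : ℕ) : ℝ) ≤ (prob (S.dist z) E).toReal := by
    refine hB'.trans ?_
    rw [toOuterMeasure_eq_prob]
    refine ENNReal.toReal_mono (prob_ne_top _ _) ?_
    simp only [S, dist, f1, f2, prob_map]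
    refine prob_mono fun y _ hy => ?_
    have hl := hp x y hy
    have e : fit z.length y = y ++ List.replicate (z.length - y.length) false := by
      rw [fit, List.take_append, List.take_of_length_le (by omega), List.take_replicate,
        min_eq_left (by omega)]
    simp only [E]
    rwa [e, fit_append_eq _ _ _ hl]
  have hle : (prob (S.dist z) E).toReal ≤ (prob (output A C z (k + k)
      (TC.eval (z.length + (k + k)))) E).toReal + 1 / ((k + k : ℕ) : ℝ) := by
    have := ENNReal.toReal_mono (ENNReal.add_ne_top.mpr ⟨prob_ne_top _ _, ENNReal.ofReal_ne_top⟩)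
      hclose
    rwa [ENNReal.toReal_add (prob_ne_top _ _) ENNReal.ofReal_ne_top,
      ENNReal.toReal_ofReal (by positivity)] at this
  have h5 : 1 / ((k + k + 1 : ℕ) : ℝ) ≤ 1 / ((k + k : ℕ) : ℝ) := by
    apply one_div_le_one_div_of_le <;> push_cast <;> linarith
  have h6 : 1 / ((k + k : ℕ) : ℝ) + 1 / ((k + k : ℕ) : ℝ) = 1 / k := by
    push_cast; field_simp
  linarith

/-! ### Sampling and bisection -/

/-- The number with the binary digits `r`, least significant digit first. -/
def val (r : List Bool) : ℕ := r.foldr (fun b v => 2 * v + b.toNat) 0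

/-- The lexicographic comparison of `y` with an initial segment `w`: the string `y`, padded with
zeros, precedes all continuations of `w`. -/
def lt : List Bool → List Bool → Bool
  | [], _ => false
  | true :: w, y => if y.headD false then lt w y.tail else true
  | false :: w, y => if y.headD false then false else lt w y.tail

/-- A step of the search for a quantile: append to `w` the bit `0` if at least `i` of `K` samples
from `P` precede `w1`, and the bit `1` otherwise. -/
def bisectStep (P : PMF (List Bool)) (K i : ℕ) (w : List Bool) : PMF (List Bool) :=
  (kfold (fun _ s => P.map fun y => if lt (w ++ [true]) y then s - 1 else s)
    (List.replicate K false) i).map fun s => w ++ [decide (s ≠ 0)]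

/-- The search for a quantile of `P` among the strings of length `m`. -/
def bisect (P : PMF (List Bool)) (m K i : ℕ) : PMF (List Bool) :=
  kfold (fun _ w => bisectStep P K i w) (List.replicate m false) []

/-- The string that the algorithm produces for the field `r`: a sample from `P` if the available
time `k` does not reach `2^|r|`, and an estimate of the quantile of `P` at `val r / 2^|r|`
otherwise. -/
def coord (P : PMF (List Bool)) (m k j : ℕ) (r : List Bool) : PMF (List Bool) :=
  if 2 ^ r.length ≤ k then bisect P m (2 ^ r.length * j) (val r * j + 1) else P

/-- Independent samples from the distributions `f r`, for `r` in a list. -/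
def seqP {α β : Type*} (f : α → PMF β) : List α → PMF (List β)
  | [] => PMF.pure []
  | r :: rs => (f r).bind fun y => (seqP f rs).map (y :: ·)

/-! ### The algorithm for the search problem -/

/-- The memory of the search algorithm between two calls of the sampling algorithm. The stacks are
used as follows: 0, input; 1, the number `k` (in unary); 2, output; 3, a string of the length of the
input; 4, the string `x`; 5, the length `m` of the samples; 6, the precision of the samples; 7, the
number `j` that controls how many samples are taken; 8, the strings produced so far, reversed; 9,
the current field, reversed; 10, the current sample; 11, the quotient of `k` by a power of two; 12,
the number of samples; 13, the quantile times the number of samples; 14, the initial segment of the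
quantile, reversed; 15, a copy of it; 16, 17, 18, counters; 19 to 21, auxiliary. -/
def QM (k m kk j : ℕ) (zl x z acc r y h pw ix wr tmp it ki mi : List Bool) : Mem :=
  St (ket ∅) [z, List.replicate k false, [], zl, x, List.replicate m false,
    List.replicate kk false, List.replicate j false, acc, r, y, h, pw, ix, wr, tmp, it, ki, mi,
    [], [], []] fun _ => []

/-- Put a sample, adjusted to length `m`, on the stack 10. -/
def sampleProg (B : Prog) : Prog :=
  (copyRev 4 19 20 ;; move 19 22 ;; copyRev 6 23 20) ;; B.shift 22 ;;
    (copyRev 5 19 20 ;; transfer 19 24 20 ;; move 20 10) ;; clearAll 22 (max 3 B.bound) ;; .reset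

/-- A sample is taken with all stacks and the quantum memory of the algorithm `B` restored to their
initial state, so that the next call of `B` is independent of this one. -/
theorem exec_sampleProg {B : Prog} {k m kk j t D : ℕ}
    {zl x z acc r h pw ix wr tmp it ki mi : List Bool} (hB : HaltsWithin A B x kk t)
    (hx : x.length ≤ D) (hm : m ≤ D) (hkk : kk ≤ D) :
    Exec A (sampleProg B) (QM k m kk j zl x z acc r [] h pw ix wr tmp it ki mi)
      (100 * D + 100 + t + (2 * (D + t) + 2) * max 3 B.bound)
      (((output A B x kk t).map (fit m)).map fun y =>
        QM k m kk j zl x z acc r y h pw ix wr tmp it ki mi) := by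
  set vs := [z, List.replicate k false, [], zl, x, List.replicate m false,
    List.replicate kk false, List.replicate j false, acc, r, [], h, pw, ix, wr, tmp, it, ki, mi,
    [], [], []] with hvs
  have pre : Det A (copyRev 4 19 20 ;; move 19 22 ;; copyRev 6 23 20)
      (QM k m kk j zl x z acc r [] h pw ix wr tmp it ki mi) (50 * D + 50)
      (St (ket ∅) (vs ++ [x, List.replicate kk false]) fun _ => []) := by
    have e : QM k m kk j zl x z acc r [] h pw ix wr tmp it ki mi =
        St (ket ∅) (vs ++ [[], []]) fun _ => [] := by
      rw [QM, St, St, regs_append]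
      congr 2
      funext r
      match r with
      | 0 => rfl
      | 1 => rfl
      | r + 2 => rfl
    rw [e, hvs]
    refine ((det_copyRev 4 19 20).seq ((det_move 19 22).seq (det_copyRev 6 23 20))).of_eq ?_
      |>.mono ?_
    · simp
    · simp; omega
  have call := exec_call (vs := vs) hB
  have post : ∀ c ∈ (run A t (initial B x kk)).support,
      Det A ((copyRev 5 19 20 ;; transfer 19 24 20 ;; move 20 10) ;;
        clearAll 22 (max 3 B.bound) ;; .reset)
        (St c.2.qst (vs ++ [c.2.reg 0, c.2.reg 1, c.2.reg 2]) fun r => c.2.reg (r + 3))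
        (30 * D + 20 + (2 * (D + t) + 2) * max 3 B.bound)
        (QM k m kk j zl x z acc r (fit m (c.2.reg 2)) h pw ix wr tmp it ki mi) := by
    intro c hc
    set vs' := [z, List.replicate k false, [], zl, x, List.replicate m false,
      List.replicate kk false, List.replicate j false, acc, r, fit m (c.2.reg 2), h, pw, ix, wr,
      tmp, it, ki, mi, [], [], []] with hvs'
    have d1 : Det A (copyRev 5 19 20 ;; transfer 19 24 20 ;; move 20 10)
        (St c.2.qst (vs ++ [c.2.reg 0, c.2.reg 1, c.2.reg 2]) fun r => c.2.reg (r + 3))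
        (30 * m + 10) (St c.2.qst (vs' ++ [c.2.reg 0, c.2.reg 1, (c.2.reg 2).drop m])
          fun r => c.2.reg (r + 3)) := by
      rw [hvs, hvs']
      refine ((det_copyRev 5 19 20).seq ((det_transfer 19 24 20).seq (det_move 20 10))).of_eq ?_
        |>.mono ?_
      · simp
      · simp; omega
    set m' : Mem := c.2.set 2 ((c.2.reg 2).drop m) with hm'
    have e1 : St c.2.qst (vs' ++ [c.2.reg 0, c.2.reg 1, (c.2.reg 2).drop m])
          (fun r => c.2.reg (r + 3)) = m'.above vs' := by
      change _ = St c.2.qst vs' m'.reg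
      rw [St, St, regs_append]
      congr 2
      funext r
      match r with
      | 0 => rfl
      | 1 => rfl
      | 2 => simp [regs, hm', Mem.set]
      | r + 3 => simp [regs, hm', Mem.set]
    rw [e1] at d1
    obtain ⟨hb1, hb2⟩ := run_bound (s := max 3 B.bound) t (c := initial B x kk)
      (by simp [initial]) c hc
    have hini : ∀ r, ((initial B x kk).2.reg r).length ≤ D := by
      intro r
      simp only [initial]
      split_ifs <;> simp [hx, hkk]
    have d2 := det_clearAll (A := A) (vs := vs') (max 3 B.bound) m' (D + t) (fun r => by
      have h1 := hb2 r
      have h2 := hini r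
      simp only [hm', Mem.set, Function.update_apply]
      split_ifs with e
      · subst e; simp; omega
      · omega)
    have e2 : (fun r => if r < max 3 B.bound then [] else m'.reg r) = fun _ => [] := by
      funext r
      split_ifs with hr
      · rfl
      · have h3 := hb1 r (by omega)
        simp only [hm', Mem.set, Function.update_apply]
        rw [if_neg (by omega), h3]
        simp only [initial]
        rw [if_neg (by omega), if_neg (by omega)]
    rw [e2] at d2
    exact (d1.seq (d2.seq det_reset)).mono (by omega)
  rw [output, PMF.map_comp, PMF.map_comp]
  exact (pre.seq_exec (call.seq_map_det post)).mono (by omega)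

/-- Compare the string on the stack 15 with the sample on the stack 10, emptying both stacks, and
pop the stack 16 if the sample precedes the string. -/
def compareProg : Prog :=
  .loop 15 (.branch 15 .skip (.branch 10 (.pop 15 ;; .pop 10) (.pop 15 ;; .pop 10) (clear 15))
    (.branch 10 (.pop 16 ;; clear 15) (.pop 16 ;; clear 15) (.pop 15 ;; .pop 10))) ;; clear 10

theorem det_loop_cons {r : ℕ} {p : Prog} {m m' m'' : Mem} {t s : ℕ} (hr : m.reg r ≠ [])
    (h : Det A p m t m') (h' : Det A (.loop r p) m' s m'') :
    Det A (.loop r p) m (t + s + 1) m'' := by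
  have := exec_loop_cons (ν := fun _ => PMF.pure m'') hr h (fun m₁ hm₁ => by
      rw [PMF.mem_support_pure_iff] at hm₁
      rw [hm₁]; exact h')
  simpa [Det] using this

theorem det_compareProg {k m kk j : ℕ} {zl x z acc r h pw ix wr it ki mi : List Bool}
    (w y : List Bool) :
    Det A compareProg (QM k m kk j zl x z acc r y h pw ix wr w it ki mi)
      (10 * w.length + 2 * y.length + 10)
      (QM k m kk j zl x z acc r [] h pw ix wr [] (if lt w y then it.tail else it) ki mi) := by
  have key : ∃ y', y'.length ≤ y.length ∧ Det A (.loop 15 (.branch 15 .skip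
      (.branch 10 (.pop 15 ;; .pop 10) (.pop 15 ;; .pop 10) (clear 15))
      (.branch 10 (.pop 16 ;; clear 15) (.pop 16 ;; clear 15) (.pop 15 ;; .pop 10))))
      (QM k m kk j zl x z acc r y h pw ix wr w it ki mi) (10 * w.length + 1)
      (QM k m kk j zl x z acc r y' h pw ix wr [] (if lt w y then it.tail else it) ki mi) := by
    induction w generalizing y with
    | nil => exact ⟨y, le_rfl, exec_loop_nil rfl⟩
    | cons b w ih =>
      have hne : (QM k m kk j zl x z acc r y h pw ix wr (b :: w) it ki mi).reg 15 ≠ [] :=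
        List.cons_ne_nil b w
      -- the first bits agree
      have same : ∀ i, Det A (.pop 15 ;; .pop 10)
          (QM k m kk j zl x z acc r y h pw ix wr (b :: w) i ki mi) 3
          (QM k m kk j zl x z acc r y.tail h pw ix wr w i ki mi) := fun i =>
        (det_pop 15).seq (det_pop 10)
      have done : ∀ i, Det A (clear 15)
          (QM k m kk j zl x z acc r y h pw ix wr (b :: w) i ki mi) (2 * w.length + 3)
          (QM k m kk j zl x z acc r y h pw ix wr [] i ki mi) := fun i =>
        (det_clear 15).mono (by simp; omega)
      have less : Det A (.pop 16 ;; clear 15)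
          (QM k m kk j zl x z acc r y h pw ix wr (b :: w) it ki mi) (2 * w.length + 5)
          (QM k m kk j zl x z acc r y h pw ix wr [] it.tail ki mi) :=
        ((det_pop 16).seq (done it.tail)).mono (by omega)
      obtain ⟨y', hy', hd⟩ := ih y.tail
      have fin : ∀ i, Det A (.loop 15 (.branch 15 .skip
          (.branch 10 (.pop 15 ;; .pop 10) (.pop 15 ;; .pop 10) (clear 15))
          (.branch 10 (.pop 16 ;; clear 15) (.pop 16 ;; clear 15) (.pop 15 ;; .pop 10))))
          (QM k m kk j zl x z acc r y h pw ix wr [] i ki mi) 1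
          (QM k m kk j zl x z acc r y h pw ix wr [] i ki mi) := fun i => exec_loop_nil rfl
      have hreg : ∀ i, (QM k m kk j zl x z acc r y h pw ix wr (b :: w) i ki mi).reg 15 = b :: w :=
        fun _ => rfl
      have hreg' : ∀ w i, (QM k m kk j zl x z acc r y h pw ix wr w i ki mi).reg 10 = y :=
        fun _ _ => rfl
      cases b with
      | false =>
        cases hb : y.headD false with
        | false =>
          refine ⟨y', by simp at hy'; omega, ?_⟩
          have e : lt (false :: w) y = lt w y.tail := by simp only [lt, hb]; simp
          rw [e]
          refine (det_loop_cons hne (det_branch (t := 4) (by simp [hreg]) (fun _ _ => ?_)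
            (by simp [hreg])) hd).mono (by simp; omega)
          exact det_branch (fun _ => same _) (fun _ _ => same _) fun u hu => by
            rw [hreg'] at hu; simp [hu] at hb
        | true =>
          refine ⟨y, le_rfl, ?_⟩
          have e : lt (false :: w) y = false := by simp only [lt, hb]; simp
          rw [e]
          refine (det_loop_cons hne (det_branch (t := 2 * w.length + 4) (by simp [hreg])
            (fun _ _ => ?_) (by simp [hreg])) (fin _)).mono (by simp; omega)
          exact det_branch (fun hu => by rw [hreg'] at hu; simp [hu] at hb)
            (fun u hu => by rw [hreg'] at hu; simp [hu] at hb) fun _ _ => done _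
      | true =>
        cases hb : y.headD false with
        | true =>
          refine ⟨y', by simp at hy'; omega, ?_⟩
          have e : lt (true :: w) y = lt w y.tail := by simp only [lt, hb]; simp
          rw [e]
          refine (det_loop_cons hne (det_branch (t := 4) (by simp [hreg]) (by simp [hreg])
            (fun _ _ => ?_)) hd).mono (by simp; omega)
          exact det_branch (fun hu => by rw [hreg'] at hu; simp [hu] at hb)
            (fun u hu => by rw [hreg'] at hu; simp [hu] at hb) fun _ _ => same _
        | false =>
          refine ⟨y, le_rfl, ?_⟩
          have e : lt (true :: w) y = true := by simp only [lt, hb]; simp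
          rw [e]
          refine (det_loop_cons hne (det_branch (t := 2 * w.length + 6) (by simp [hreg])
            (by simp [hreg]) (fun _ _ => ?_)) (fin _)).mono (by simp; omega)
          exact det_branch (fun _ => less) (fun _ _ => less) fun u hu => by
            rw [hreg'] at hu; simp [hu] at hb
  obtain ⟨y', hy', hd⟩ := key
  exact (hd.seq (det_clear 10)).mono (by simp; omega)

/-- Append a bit to the initial segment on the stack 14, according to the number of samples that
precede its continuation by `1`. -/
def bisectStepProg (B : Prog) : Prog :=
  (copyRev 13 16 19 ;; .push 16 false ;; copyRev 12 17 19) ;;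
    .loop 17 (.pop 17 ;; sampleProg B ;; (.push 15 true ;; copyRev 14 15 19) ;; compareProg) ;;
    .branch 16 (.push 14 false) (clear 16 ;; .push 14 true) (clear 16 ;; .push 14 true)

/-- The hypothesis `hs` is the conclusion of `exec_sampleProg` for the distribution `P` of the
samples. -/
theorem exec_bisectStepProg {B : Prog} {k m kk j D ts K i : ℕ}
    {zl x z acc r h mi : List Bool} {P : PMF (List Bool)}
    (hP : ∀ y ∈ P.support, y.length = m)
    (hs : ∀ z acc r h pw ix wr tmp it ki mi, Exec A (sampleProg B)
      (QM k m kk j zl x z acc r [] h pw ix wr tmp it ki mi) ts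
      (P.map fun y => QM k m kk j zl x z acc r y h pw ix wr tmp it ki mi))
    (w : List Bool) (hw : w.length ≤ D) (hm : m ≤ D) (hK : K ≤ D) (hi : i ≤ D) :
    Exec A (bisectStepProg B)
      (QM k m kk j zl x z acc r [] h (List.replicate K false) (List.replicate i false) w.reverse
        [] [] [] mi) ((ts + 30 * D + 70) * D + 100 * D + 100)
      ((bisectStep P K (i + 1) w).map fun w' =>
        QM k m kk j zl x z acc r [] h (List.replicate K false) (List.replicate i false) w'.reverse
        [] [] [] mi) := by
  have pre : Det A (copyRev 13 16 19 ;; .push 16 false ;; copyRev 12 17 19)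
      (QM k m kk j zl x z acc r [] h (List.replicate K false) (List.replicate i false) w.reverse
        [] [] [] mi) (30 * D + 20)
      (QM k m kk j zl x z acc r [] h (List.replicate K false) (List.replicate i false) w.reverse
        [] (List.replicate (i + 1) false) (List.replicate K false) mi) := by
    refine ((det_copyRev 13 16 19).seq ((det_push 16 false).seq (det_copyRev 12 17 19))).of_eq ?_
      |>.mono ?_
    · simp [QM, List.replicate_succ]
    · simp; omega
  have hbody : ∀ (b : Bool) (l : List Bool) (s : ℕ), Exec A
      (.pop 17 ;; sampleProg B ;; (.push 15 true ;; copyRev 14 15 19) ;; compareProg)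
      (QM k m kk j zl x z acc r [] h (List.replicate K false) (List.replicate i false) w.reverse
        [] (List.replicate s false) (b :: l) mi) (ts + 24 * D + 50)
      ((P.map fun y => if lt (w ++ [true]) y then s - 1 else s).map fun s =>
        QM k m kk j zl x z acc r [] h (List.replicate K false) (List.replicate i false) w.reverse
        [] (List.replicate s false) l mi) := by
    intro b l s
    have d1 : Det A (.pop 17) (QM k m kk j zl x z acc r [] h (List.replicate K false)
        (List.replicate i false) w.reverse [] (List.replicate s false) (b :: l) mi) 1
        (QM k m kk j zl x z acc r [] h (List.replicate K false)
        (List.replicate i false) w.reverse [] (List.replicate s false) l mi) := det_pop 17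
    have d2 : ∀ y, Det A (.push 15 true ;; copyRev 14 15 19) (QM k m kk j zl x z acc r y h
        (List.replicate K false) (List.replicate i false) w.reverse [] (List.replicate s false) l mi)
        (12 * D + 5) (QM k m kk j zl x z acc r y h (List.replicate K false)
        (List.replicate i false) w.reverse (w ++ [true]) (List.replicate s false) l mi) := by
      intro y
      refine ((det_push 15 true).seq (det_copyRev 14 15 19)).of_eq ?_ |>.mono ?_
      · simp [QM]
      · simp; omega
    rw [PMF.map_comp]
    refine (d1.seq_exec ((hs _ _ _ _ _ _ _ _ _ _ _).seq_map_det (s := 24 * D + 40)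
      (g := (fun s => QM k m kk j zl x z acc r [] h (List.replicate K false)
        (List.replicate i false) w.reverse [] (List.replicate s false) l mi) ∘
        fun y => if lt (w ++ [true]) y then s - 1 else s) fun y hy => ?_)).mono (by omega)
    refine (((d2 y).seq (det_compareProg _ y)).of_eq ?_).mono ?_
    · simp only [Function.comp_apply]
      split_ifs <;> simp
    · rw [hP y hy]; simp; omega
  have hloop := exec_loop_list (A := A) (r := 17) (t := ts + 24 * D + 50)
    (fun l s => QM k m kk j zl x z acc r [] h (List.replicate K false) (List.replicate i false)
      w.reverse [] (List.replicate s false) l mi)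
    (fun _ s => P.map fun y => if lt (w ++ [true]) y then s - 1 else s) (fun _ s => s ≤ D + 1)
    (fun _ _ => rfl) (fun b l s _ => hbody b l s)
    (fun b l s hI s' hs' => by
      rw [PMF.mem_support_map_iff] at hs'
      obtain ⟨y, _, rfl⟩ := hs'
      split_ifs <;> omega)
    (List.replicate K false) (i + 1) (by omega)
  have hrange : ∀ s ∈ (kfold (fun (_ : Bool) s => P.map fun y => if lt (w ++ [true]) y then s - 1 else s)
      (List.replicate K false) (i + 1)).support, s ≤ D + 1 := by
    have : ∀ (l : List Bool) (s₀ : ℕ), s₀ ≤ D + 1 → ∀ s ∈ (kfold (fun (_ : Bool) s => P.map fun y =>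
        if lt (w ++ [true]) y then s - 1 else s) l s₀).support, s ≤ D + 1 := by
      intro l
      induction l with
      | nil => intro s₀ h₀ s hs; simp [kfold] at hs; omega
      | cons b l ih =>
        intro s₀ h₀ s hs
        rw [kfold, PMF.mem_support_bind_iff] at hs
        obtain ⟨s₁, h₁, h₂⟩ := hs
        rw [PMF.mem_support_map_iff] at h₁
        obtain ⟨y, _, rfl⟩ := h₁
        exact ih _ (by split_ifs <;> omega) s h₂
    exact this _ _ (by omega)
  rw [bisectStep, PMF.map_comp]
  refine (pre.seq_exec (hloop.seq_map_det (s := 2 * D + 20) fun s hs => ?_)).mono ?_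
  · have hsD := hrange s hs
    cases s with
    | zero =>
      refine (det_branch (t := 1) (fun _ => ?_) (fun u hu => ?_) (fun u hu => ?_)).mono (by omega)
      · refine (det_push 14 false).of_eq ?_
        simp [QM]
      · exact absurd hu (List.cons_ne_nil false u).symm
      · exact absurd hu (List.cons_ne_nil true u).symm
    | succ s =>
      have d : Det A (clear 16 ;; .push 14 true) (QM k m kk j zl x z acc r [] h
          (List.replicate K false) (List.replicate i false) w.reverse []
          (List.replicate (s + 1) false) [] mi) (2 * D + 19)
          (QM k m kk j zl x z acc r [] h (List.replicate K false) (List.replicate i false)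
            (w ++ [true]).reverse [] [] [] mi) := by
        refine ((det_clear 16).seq (det_push 14 true)).of_eq ?_ |>.mono ?_
        · simp [QM]
        · simp; omega
      have d' : Det A _ _ _ _ := det_branch (r := 16) (pe := .push 14 false) (fun hu => by
        have : List.replicate (s + 1) false = [] := hu
        simp at this) (fun _ _ => d) (fun _ _ => d)
      exact d'.mono (by omega)
  · rw [List.length_replicate]
    have : (ts + 24 * D + 50 + 1) * K ≤ (ts + 30 * D + 70) * D := Nat.mul_le_mul (by omega) hK
    omega

/-- One round of a loop, when the distribution of the memory after the round is the image of a
distribution on a type `σ`. -/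
theorem exec_loop_cons_map {σ : Type*} {r : ℕ} {p : Prog} {m : Mem} {t s : ℕ} {μ : PMF σ}
    {f : σ → Mem} {ν : σ → PMF Mem} (hr : m.reg r ≠ []) (h : Exec A p m t (μ.map f))
    (hq : ∀ c ∈ μ.support, Exec A (.loop r p) (f c) s (ν c)) :
    Exec A (.loop r p) m (t + s + 1) (μ.bind ν) := by
  set ν' : Mem → PMF Mem := fun m' => (run A s ([.loop r p], m')).map Prod.snd
  have hν : ∀ c ∈ μ.support, ν' (f c) = ν c := fun c hc => (ExecL.eq_snd (hq c hc)).symm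
  have := exec_loop_cons hr h (ν := ν') (s := s) (fun m' hm' => by
    rw [PMF.mem_support_map_iff] at hm'
    obtain ⟨c, hc, rfl⟩ := hm'
    rw [hν c hc]; exact hq c hc)
  rw [PMF.bind_map] at this
  rwa [pmf_bind_congr (f := ν' ∘ f) (g := ν) hν] at this

/-- Double the height of the stack `a`. -/
def double (a : ℕ) : Prog := copyRev a 19 20 ;; move 19 a

/-- Halve the height of the stack 11, rounding down. -/
def halve : Prog :=
  .loop 11 (.pop 11 ;; .branch 11 .skip (.pop 11 ;; .push 19 false) (.pop 11 ;; .push 19 false)) ;;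
    move 19 11

theorem det_halve {k m kk j : ℕ} {zl x z acc r y pw ix wr tmp it ki mi : List Bool} (a : ℕ) :
    Det A halve (QM k m kk j zl x z acc r y (List.replicate a false) pw ix wr tmp it ki mi)
      (15 * a + 15)
      (QM k m kk j zl x z acc r y (List.replicate (a / 2) false) pw ix wr tmp it ki mi) := by
  set S : ℕ → ℕ → Mem := fun a c => St (ket ∅) [z, List.replicate k false, [], zl, x,
    List.replicate m false, List.replicate kk false, List.replicate j false, acc, r, y,
    List.replicate a false, pw, ix, wr, tmp, it, ki, mi,
    List.replicate c false, [], []] fun _ => [] with hS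
  set body : Prog := .pop 11 ;; .branch 11 .skip (.pop 11 ;; .push 19 false)
    (.pop 11 ;; .push 19 false) with hbody
  have hl : ∀ a c, Det A (.loop 11 body) (S a c) (7 * a + 1) (S 0 (a / 2 + c)) := by
    intro a
    induction a using Nat.twoStepInduction with
    | zero =>
      intro c
      have h0 : Det A (.loop 11 body) (S 0 c) 1 (S 0 c) := exec_loop_nil rfl
      simpa using h0
    | one =>
      intro c
      refine (det_loop_cons (t := 4) (m' := S 0 c) (List.cons_ne_nil false []) ?_
        (exec_loop_nil rfl)).mono (by omega) |>.of_eq (by simp)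
      refine Det.seq (t := 1) (s := 2) (m' := S 0 c) (det_pop 11) ?_
      exact det_branch (t := 1) (fun _ => det_skip _) (fun u hu => absurd hu.symm (List.cons_ne_nil _ _))
        (fun u hu => absurd hu.symm (List.cons_ne_nil _ _))
    | more a ih _ =>
      intro c
      have h2 : (a + 2) / 2 + c = a / 2 + (c + 1) := by omega
      rw [h2]
      refine (det_loop_cons (t := 6) (m' := S a (c + 1)) (List.cons_ne_nil false _) ?_
        (ih (c + 1))).mono (by omega)
      refine Det.seq (t := 1) (s := 4) (m' := S (a + 1) c) (det_pop 11) ?_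
      have d : Det A (.pop 11 ;; .push 19 false) (S (a + 1) c) 3 (S a (c + 1)) :=
        (det_pop 11).seq (det_push 19 false)
      exact det_branch (fun hu => absurd hu (List.cons_ne_nil _ _)) (fun _ _ => d) fun _ _ => d
  refine ((hl a 0).seq (det_move 19 11)).of_eq ?_ |>.mono ?_
  · simp [QM]
  · simp; omega

theorem val_lt (r : List Bool) : val r < 2 ^ r.length := by
  induction r with
  | nil => simp [val]
  | cons b r ih =>
    have e : val (b :: r) = 2 * val r + b.toNat := rfl
    have := Bool.toNat_le b
    rw [e, List.length_cons, pow_succ]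
    omega

/-- Compute the number of samples and the quantile, from the current field. -/
def scaleProg : Prog :=
  copyRev 7 12 19 ;; .loop 9 (.branch 9 .skip (.pop 9 ;; double 13 ;; double 12)
    (.pop 9 ;; double 13 ;; copyRev 7 13 19 ;; double 12))

theorem det_scaleProg {k m kk j D : ℕ} {zl x z acc y h wr tmp it ki mi : List Bool} (r : List Bool)
    (hj : 2 ^ r.length * j ≤ D) :
    Det A scaleProg (QM k m kk j zl x z acc r.reverse y h [] [] wr tmp it ki mi)
      ((50 * D + 40) * r.length + 12 * D + 10)
      (QM k m kk j zl x z acc [] y h (List.replicate (2 ^ r.length * j) false)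
        (List.replicate (val r * j) false) wr tmp it ki mi) := by
  have hjD : j ≤ D := (Nat.le_mul_of_pos_left _ (by positivity)).trans hj
  have hl := det_loop_list (A := A) (r := 9) (p := .branch 9 .skip
    (.pop 9 ;; double 13 ;; double 12) (.pop 9 ;; double 13 ;; copyRev 7 13 19 ;; double 12))
    (t := 50 * D + 39)
    (fun l (s : ℕ × ℕ) => QM k m kk j zl x z acc l y h (List.replicate s.1 false)
      (List.replicate s.2 false) wr tmp it ki mi)
    (fun b s => (s.1 + s.1, s.2 + s.2 + b.toNat * j))
    (fun l s => 2 ^ l.length * s.1 ≤ D ∧ s.2 ≤ s.1 ∧ s.2 + j ≤ s.1)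
    (fun _ _ => rfl)
    (fun b l s hI => by
      obtain ⟨h1, h2, h3⟩ := hI
      have h4 : s.1 ≤ D := (Nat.le_mul_of_pos_left _ (by positivity)).trans h1
      cases b with
      | false =>
        refine Det.mono (det_branch (t := 50 * D + 38) (fun hu => absurd hu (List.cons_ne_nil _ _))
          (fun _ _ => ?_) (fun u hu => absurd hu (by simp [QM, St, regs]))) le_rfl
        refine ((det_pop 9).seq (((det_copyRev 13 19 20).seq (det_move 19 13)).seq
          ((det_copyRev 12 19 20).seq (det_move 19 12)))).of_eq ?_ |>.mono ?_
        · simp [QM]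
        · simp; omega
      | true =>
        refine Det.mono (det_branch (t := 50 * D + 38) (fun hu => absurd hu (List.cons_ne_nil _ _))
          (fun u hu => absurd hu (by simp [QM, St, regs])) (fun _ _ => ?_)) le_rfl
        refine ((det_pop 9).seq (((det_copyRev 13 19 20).seq (det_move 19 13)).seq
          ((det_copyRev 7 13 19).seq
          ((det_copyRev 12 19 20).seq (det_move 19 12))))).of_eq ?_ |>.mono ?_
        · simp [QM, add_comm]
        · simp; omega)
    (fun b l s hI => by
      obtain ⟨h1, h2, h3⟩ := hI
      rw [List.length_cons, pow_succ] at h1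
      refine ⟨by linarith, ?_, ?_⟩ <;> cases b <;> simp <;> omega)
    r.reverse (j, 0) (by simpa using hj)
  have hf : ∀ r : List Bool, r.reverse.foldl (fun (s : ℕ × ℕ) b => (s.1 + s.1, s.2 + s.2 + b.toNat * j))
      (j, 0) = (2 ^ r.length * j, val r * j) := by
    intro r
    induction r with
    | nil => simp [val]
    | cons b r ih =>
      rw [List.reverse_cons, List.foldl_append, ih]
      have e : val (b :: r) = 2 * val r + b.toNat := rfl
      simp only [List.foldl_cons, List.foldl_nil, e, List.length_cons, pow_succ]
      ext <;> simp <;> ring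
  rw [hf, List.length_reverse] at hl
  refine (((det_copyRev 7 12 19).of_eq ?_).seq hl).mono ?_
  · simp [QM]
  · simp
    have : (50 * D + 39 + 1) * r.length = (50 * D + 40) * r.length := by ring
    omega

/-- Search for the quantile, and put it on the stack 10. -/
def bisectProg (B : Prog) : Prog :=
  scaleProg ;; copyRev 5 18 19 ;; .loop 18 (.pop 18 ;; bisectStepProg B) ;;
    clear 12 ;; clear 13 ;; move 14 10

theorem kfold_bisectStep_length {P : PMF (List Bool)} {K i : ℕ} (l w : List Bool) :
    ∀ w' ∈ (kfold (fun (_ : Bool) w => bisectStep P K i w) l w).support,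
      w'.length = w.length + l.length := by
  induction l generalizing w with
  | nil => intro w' hw'; simp [kfold] at hw'; simp [hw']
  | cons b l ih =>
    intro w' hw'
    rw [kfold, PMF.mem_support_bind_iff] at hw'
    obtain ⟨w₁, h₁, h₂⟩ := hw'
    rw [bisectStep, PMF.mem_support_map_iff] at h₁
    obtain ⟨s, _, rfl⟩ := h₁
    rw [ih _ w' h₂]
    simp; omega

theorem bisect_length {P : PMF (List Bool)} {m K i : ℕ} :
    ∀ w ∈ (bisect P m K i).support, w.length = m := by
  intro w hw
  simpa using kfold_bisectStep_length _ _ w hw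

theorem exec_bisectProg {B : Prog} {k m kk j D ts : ℕ}
    {zl x z acc h : List Bool} {P : PMF (List Bool)} (r : List Bool)
    (hP : ∀ y ∈ P.support, y.length = m)
    (hs : ∀ z acc r h pw ix wr tmp it ki mi, Exec A (sampleProg B)
      (QM k m kk j zl x z acc r [] h pw ix wr tmp it ki mi) ts
      (P.map fun y => QM k m kk j zl x z acc r y h pw ix wr tmp it ki mi))
    (hr : r.length ≤ D) (hm : m ≤ D) (hj : 2 ^ r.length * j ≤ D) :
    Exec A (bisectProg B) (QM k m kk j zl x z acc r.reverse [] h [] [] [] [] [] [] [])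
      ((ts + 200 * D + 300) * (D + 1) * (D + 1))
      ((bisect P m (2 ^ r.length * j) (val r * j + 1)).map fun y =>
        QM k m kk j zl x z acc [] y h [] [] [] [] [] [] []) := by
  set K := 2 ^ r.length * j with hK
  set i := val r * j with hi
  have hiD : i ≤ D := (Nat.mul_le_mul_right j (val_lt r).le).trans hj
  have d1 := det_scaleProg (A := A) (D := D) (k := k) (m := m) (kk := kk) (zl := zl) (x := x) (z := z)
    (acc := acc) (y := []) (h := h) (wr := []) (tmp := []) (it := []) (ki := []) (mi := []) r hj
  have d2 : Det A (copyRev 5 18 19) (QM k m kk j zl x z acc [] [] h (List.replicate K false)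
      (List.replicate i false) [] [] [] [] []) (12 * D + 3) (QM k m kk j zl x z acc [] [] h
      (List.replicate K false) (List.replicate i false) [] [] [] [] (List.replicate m false)) := by
    refine (det_copyRev 5 18 19).of_eq ?_ |>.mono ?_
    · simp [QM]
    · simp; omega
  have d3 := exec_loop_list (A := A) (r := 18) (p := .pop 18 ;; bisectStepProg B)
    (t := (ts + 30 * D + 70) * D + 100 * D + 102)
    (fun l w => QM k m kk j zl x z acc [] [] h (List.replicate K false)
      (List.replicate i false) w.reverse [] [] [] l)
    (fun _ w => bisectStep P K (i + 1) w) (fun l w => w.length + l.length ≤ m)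
    (fun _ _ => rfl)
    (fun b l w hI => by
      have d : Det A (.pop 18) (QM k m kk j zl x z acc [] [] h (List.replicate K false)
        (List.replicate i false) w.reverse [] [] [] (b :: l)) 1
        (QM k m kk j zl x z acc [] [] h (List.replicate K false)
        (List.replicate i false) w.reverse [] [] [] l) := det_pop 18
      refine (d.seq_exec (exec_bisectStepProg hP hs w (by omega) hm hj hiD)).mono (by omega))
    (fun b l w hI w' hw' => by
      rw [bisectStep, PMF.mem_support_map_iff] at hw'
      obtain ⟨s, _, rfl⟩ := hw'
      simp at hI ⊢; omega)
    (List.replicate m false) [] (by simp)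
  have d4 : ∀ w ∈ (bisect P m K (i + 1)).support, Det A (clear 12 ;; clear 13 ;; move 14 10)
      (QM k m kk j zl x z acc [] [] h (List.replicate K false)
      (List.replicate i false) w.reverse [] [] [] []) (20 * D + 10)
      (QM k m kk j zl x z acc [] w h [] [] [] [] [] [] []) := by
    intro w hw
    have := bisect_length w hw
    refine ((det_clear 12).seq ((det_clear 13).seq (det_move 14 10))).of_eq ?_ |>.mono ?_
    · simp [QM]
    · simp; omega
  refine (d1.seq_exec (d2.seq_exec (Exec.seq_map_det d3 d4))).mono ?_
  rw [List.length_replicate]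
  have e1 : (50 * D + 40) * r.length ≤ (50 * D + 40) * D := Nat.mul_le_mul_left _ hr
  have e2 : ((ts + 30 * D + 70) * D + 100 * D + 102 + 1) * m ≤
    ((ts + 30 * D + 70) * D + 100 * D + 102 + 1) * D := Nat.mul_le_mul_left _ hm
  have e3 : (50 * D + 40) * D + 12 * D + 10 + (12 * D + 3 +
      (((ts + 30 * D + 70) * D + 100 * D + 102 + 1) * D + 1 + (20 * D + 10) + 1) + 1) + 1 ≤
      (ts + 200 * D + 300) * (D + 1) * (D + 1) := by
    ring_nf; nlinarith [Nat.zero_le (ts * D), Nat.zero_le (D ^ 2), Nat.zero_le (D ^ 3)]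
  omega

/-- Read a field, and put the string that belongs to it onto the stack 8. -/
def coordProg (B : Prog) : Prog :=
  (readField 0 9 19 ;; copyRev 1 11 19 ;; copyRev 9 18 19) ;; .loop 18 (.pop 18 ;; halve) ;;
    .branch 11 (clear 9 ;; sampleProg B) (clear 11 ;; bisectProg B) (clear 11 ;; bisectProg B) ;;
    move 10 8

theorem exec_coordProg {B : Prog} {k m kk j D ts : ℕ}
    {zl x z acc : List Bool} {P : PMF (List Bool)}
    (hP : ∀ y ∈ P.support, y.length = m)
    (hs : ∀ z acc r h pw ix wr tmp it ki mi, Exec A (sampleProg B)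
      (QM k m kk j zl x z acc r [] h pw ix wr tmp it ki mi) ts
      (P.map fun y => QM k m kk j zl x z acc r y h pw ix wr tmp it ki mi))
    (hz : z.length ≤ D) (hk : k ≤ D) (hm : m ≤ D) (hj : k * j ≤ D) :
    Exec A (coordProg B) (QM k m kk j zl x z acc [] [] [] [] [] [] [] [] [] [])
      ((ts + 300 * D + 400) * (D + 1) * (D + 1))
      ((coord P m k j (field z).1).map fun y =>
        QM k m kk j zl x (field z).2 (y.reverse ++ acc) [] [] [] [] [] [] [] [] [] []) := by
  rcases hrz : field z with ⟨r, z'⟩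
  have hlz := length_field z
  rw [hrz] at hlz
  simp only at hlz ⊢
  have d1 : Det A (readField 0 9 19 ;; copyRev 1 11 19 ;; copyRev 9 18 19)
      (QM k m kk j zl x z acc [] [] [] [] [] [] [] [] [] []) (30 * D + 40)
      (QM k m kk j zl x z' acc r.reverse [] (List.replicate k false) [] [] [] [] [] [] r) := by
    refine ((det_readField 0 9 19).seq ((det_copyRev 1 11 19).seq (det_copyRev 9 18 19))).of_eq ?_
      |>.mono ?_
    · simp [QM, hrz]
    · simp [hrz]; omega
  have d2 := det_loop_list (A := A) (r := 18) (p := .pop 18 ;; halve) (t := 15 * D + 17)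
    (fun l a => QM k m kk j zl x z' acc r.reverse [] (List.replicate a false) [] [] [] [] [] [] l)
    (fun _ a => a / 2) (fun _ a => a ≤ D) (fun _ _ => rfl)
    (fun b l a ha => by
      have d : Det A (.pop 18) (QM k m kk j zl x z' acc r.reverse [] (List.replicate a false)
        [] [] [] [] [] [] (b :: l)) 1 (QM k m kk j zl x z' acc r.reverse [] (List.replicate a false)
        [] [] [] [] [] [] l) := det_pop 18
      exact (d.seq (det_halve a)).mono (by omega))
    (fun b l a ha => (Nat.div_le_self a 2).trans ha) r k hk
  have hf : ∀ (l : List Bool) (a : ℕ), l.foldl (fun a _ => a / 2) a = a / 2 ^ l.length := by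
    intro l
    induction l with
    | nil => simp
    | cons b l ih => intro a; rw [List.foldl_cons, ih, List.length_cons, pow_succ', Nat.div_div_eq_div_mul]
  rw [hf] at d2
  have d3 : Exec A (.branch 11 (clear 9 ;; sampleProg B) (clear 11 ;; bisectProg B)
      (clear 11 ;; bisectProg B)) (QM k m kk j zl x z' acc r.reverse []
      (List.replicate (k / 2 ^ r.length) false) [] [] [] [] [] [] [])
      ((ts + 200 * D + 300) * (D + 1) * (D + 1) + 2 * D + 4)
      ((coord P m k j r).map fun y => QM k m kk j zl x z' acc [] y [] [] [] [] [] [] [] []) := by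
    rw [coord]
    by_cases hkr : 2 ^ r.length ≤ k
    · rw [if_pos hkr]
      have hne : List.replicate (k / 2 ^ r.length) false ≠ [] := by
        rw [Ne, List.replicate_eq_nil_iff]
        exact (Nat.div_pos hkr (by positivity)).ne'
      have d4 : Det A (clear 11) (QM k m kk j zl x z' acc r.reverse []
        (List.replicate (k / 2 ^ r.length) false) [] [] [] [] [] [] []) (2 * D + 1)
        (QM k m kk j zl x z' acc r.reverse [] [] [] [] [] [] [] [] []) := by
        refine (det_clear 11).mono ?_
        have := Nat.div_le_self k (2 ^ r.length)
        simp; omega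
      have d5 := d4.seq_exec (exec_bisectProg (acc := acc) (z := z') (h := []) r hP hs (D := D)
        (by omega) hm ((Nat.mul_le_mul_right j hkr).trans hj))
      refine (exec_branch (fun hu => absurd hu hne) (fun _ _ => d5) (fun _ _ => d5)).mono ?_
      omega
    · rw [if_neg hkr]
      have h0 : k / 2 ^ r.length = 0 := Nat.div_eq_of_lt (not_le.mp hkr)
      rw [h0]
      have d4 : Det A (clear 9) (QM k m kk j zl x z' acc r.reverse [] [] [] [] [] [] [] [] [])
        (2 * D + 1) (QM k m kk j zl x z' acc [] [] [] [] [] [] [] [] [] []) := by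
        refine (det_clear 9).mono ?_
        simp; omega
      have d5 := d4.seq_exec (hs z' acc [] [] [] [] [] [] [] [] [])
      refine (exec_branch (fun _ => d5) (fun u hu => absurd hu.symm (List.cons_ne_nil _ _))
        (fun u hu => absurd hu.symm (List.cons_ne_nil _ _))).mono ?_
      have : ts * 1 * 1 ≤ (ts + 200 * D + 300) * (D + 1) * (D + 1) :=
        Nat.mul_le_mul (Nat.mul_le_mul (by omega) (by omega)) (by omega)
      omega
  have hlen : ∀ y ∈ (coord P m k j r).support, y.length = m := by
    intro y hy
    rw [coord] at hy
    split_ifs at hy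
    · exact bisect_length y hy
    · exact hP y hy
  have d6 : ∀ y ∈ (coord P m k j r).support, Det A (move 10 8)
      (QM k m kk j zl x z' acc [] y [] [] [] [] [] [] [] []) (5 * D + 1)
      (QM k m kk j zl x z' (y.reverse ++ acc) [] [] [] [] [] [] [] [] [] []) := by
    intro y hy
    have := hlen y hy
    refine (det_move 10 8).mono ?_
    simp; omega
  refine (d1.seq_exec (d2.seq_exec (d3.seq_map_det d6))).mono ?_
  have e1 : (15 * D + 17 + 1) * r.length ≤ (15 * D + 17 + 1) * D := Nat.mul_le_mul_left _ (by omega)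
  have e2 : 30 * D + 40 + ((15 * D + 17 + 1) * D + 1 + ((ts + 200 * D + 300) * (D + 1) * (D + 1) +
      2 * D + 4 + (5 * D + 1) + 1) + 1) + 1 ≤ (ts + 300 * D + 400) * (D + 1) * (D + 1) := by
    ring_nf; nlinarith [Nat.zero_le (D ^ 2), Nat.zero_le (D ^ 3)]
  omega

/-- The loop over the fields of the input, by recursion along `fields`. -/
theorem exec_coordLoop {B : Prog} {k m kk j D ts : ℕ}
    {zl x : List Bool} {P : PMF (List Bool)}
    (hP : ∀ y ∈ P.support, y.length = m)
    (hs : ∀ z acc r h pw ix wr tmp it ki mi, Exec A (sampleProg B)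
      (QM k m kk j zl x z acc r [] h pw ix wr tmp it ki mi) ts
      (P.map fun y => QM k m kk j zl x z acc r y h pw ix wr tmp it ki mi))
    (hk : k ≤ D) (hm : m ≤ D) (hj : k * j ≤ D) (z acc : List Bool) (hz : z.length ≤ D) :
    Exec A (.loop 0 (coordProg B)) (QM k m kk j zl x z acc [] [] [] [] [] [] [] [] [] [])
      (((ts + 300 * D + 400) * (D + 1) * (D + 1) + 1) * z.length + 1)
      ((seqP (coord P m k j) (fields z)).map fun ys =>
        QM k m kk j zl x [] (ys.flatten.reverse ++ acc) [] [] [] [] [] [] [] [] [] []) := by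
  fun_induction fields z generalizing acc with
  | case1 =>
    have h : Exec A (.loop 0 (coordProg B)) (QM k m kk j zl x [] acc [] [] [] [] [] [] [] [] [] [])
      1 _ := exec_loop_nil rfl
    simpa [seqP, PMF.pure_map] using h
  | case2 b l ih =>
    have hlt := length_field_lt b l
    have d1 := exec_coordProg (A := A) (acc := acc) (z := b :: l) hP hs hz hk hm hj
    have h := exec_loop_cons_map (r := 0) (List.cons_ne_nil b l) d1
      fun y _ => ih (y.reverse ++ acc) (by omega)
    have e : (seqP (coord P m k j) ((field (b :: l)).1 :: fields (field (b :: l)).2)).map (fun ys =>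
        QM k m kk j zl x [] (ys.flatten.reverse ++ acc) [] [] [] [] [] [] [] [] [] []) =
        (coord P m k j (field (b :: l)).1).bind fun y =>
          (seqP (coord P m k j) (fields (field (b :: l)).2)).map fun ys =>
            QM k m kk j zl x [] (ys.flatten.reverse ++ (y.reverse ++ acc))
              [] [] [] [] [] [] [] [] [] [] := by
      rw [seqP, PMF.map_bind]
      congr 1
      funext y
      rw [PMF.map_comp]
      simp [Function.comp_def]
    rw [e]
    refine h.mono ?_
    have : (field (b :: l)).2.length + 1 ≤ (b :: l).length := by omega
    calc _ = ((ts + 300 * D + 400) * (D + 1) * (D + 1) + 1) *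
            ((field (b :: l)).2.length + 1) + 1 := by ring
      _ ≤ _ := by gcongr

/-- The algorithm for the search problem: `PK` and `PJ` compute the precision of the samples and the
number that controls how many samples are taken, from the sum of the length of the input and the
required precision. -/
def tupleProg (B PK PJ : Prog) : Prog :=
  (copyRev 0 3 19 ;; copyRev 3 20 19 ;; unary 20 18 ;; copyRev 1 18 19 ;; PK ;; PJ ;; clear 18 ;;
    readField 0 9 19 ;; move 9 4 ;; readField 0 9 19 ;; unary 9 5) ;;
    .loop 0 (coordProg B) ;; move 8 19 ;; transfer 3 19 20 ;; move 20 2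

theorem mem_support_seqP {α β : Type*} {f : α → PMF β} {C : α → β → Prop}
    (h : ∀ r, ∀ y ∈ (f r).support, C r y) (rs : List α) :
    ∀ ys ∈ (seqP f rs).support, List.Forall₂ C rs ys := by
  induction rs with
  | nil => intro ys hys; simp [seqP] at hys; simp [hys]
  | cons r rs ih =>
    intro ys hys
    rw [seqP, PMF.mem_support_bind_iff] at hys
    obtain ⟨y, hy, hys⟩ := hys
    rw [PMF.mem_support_map_iff] at hys
    obtain ⟨ys', hys', rfl⟩ := hys
    exact List.Forall₂.cons (h r y hy) (ih ys' hys')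

theorem length_flatten_of_forall₂ {m : ℕ} {rs ys : List (List Bool)}
    (h : List.Forall₂ (fun _ y => y.length = m) rs ys) : ys.flatten.length = rs.length * m := by
  induction h with
  | nil => simp
  | cons hy _ ih => rw [List.flatten_cons, List.length_append, hy, ih, List.length_cons]; ring

theorem length_fields (z : List Bool) : (fields z).length ≤ z.length := by
  fun_induction fields z with
  | case1 => simp
  | case2 b l ih =>
    have := length_field_lt b l
    rw [List.length_cons]; omega

theorem coord_length {P : PMF (List Bool)} {m k j : ℕ} (hP : ∀ y ∈ P.support, y.length = m) :
    ∀ r, ∀ y ∈ (coord P m k j r).support, y.length = m := by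
  intro r y hy
  rw [coord] at hy
  split_ifs at hy
  · exact bisect_length y hy
  · exact hP y hy

/-- The exact distribution of the output of `tupleProg`. With `n = |z| + k`, samples of precision
`1 / (2 n²)` are used, and `2^L · 4 n⁴` samples for each step of the bisection. If `2^L ≤ k`, this
number is at most `4 n⁵`, which makes the running time polynomial in `n`. -/
theorem exec_tupleProg {B PK PJ : Prog} {TK TJ : Polynomial ℕ}
    (hPK : Computes PK (2 * Polynomial.X ^ 2) TK 18 6 19 20)
    (hPJ : Computes PJ (4 * Polynomial.X ^ 4) TJ 18 7 19 20)
    {z : List Bool} {k t n m D : ℕ} (hn : n = z.length + k) (hm : m = (field (field z).2).1.length)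
    (hB : HaltsWithin A B (field z).1 (2 * n ^ 2) t) (hD : D = 4 * n ^ 5 + 2 * n ^ 2 + n) :
    ∃ μ, Exec A (tupleProg B PK PJ) (initial (tupleProg B PK PJ) z k).2
      (TK.eval n + TJ.eval n + ((100 * D + 100 + t + (2 * (D + t) + 2) * max 3 B.bound + 300 * D +
        400) * (D + 1) * (D + 1) + 1) * n + 200 * D + 200) μ ∧
      μ.map (fun m => m.reg 2) =
        (seqP (coord ((output A B (field z).1 (2 * n ^ 2) t).map (fit m)) m k (4 * n ^ 4))
          (fields (field (field z).2).2)).map fun ys => fit z.length ys.flatten := by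
  set kk := 2 * n ^ 2 with hkk
  set j := 4 * n ^ 4 with hj
  set x := (field z).1 with hx
  set w := (field (field z).2).2 with hw
  set P := (output A B x kk t).map (fit m) with hP
  have hPl : ∀ y ∈ P.support, y.length = m := by
    intro y hy
    rw [hP, PMF.mem_support_map_iff] at hy
    obtain ⟨u, _, rfl⟩ := hy
    simp
  have l1 := length_field z
  have l2 := length_field (field z).2
  rw [← hx] at l1
  rw [← hm, ← hw] at l2
  have hnD : n ≤ D := by omega
  have hnn : n ^ 2 ≤ D := by rw [hD]; nlinarith [Nat.zero_le (n ^ 5)]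
  have pre : Det A (copyRev 0 3 19 ;; copyRev 3 20 19 ;; unary 20 18 ;; copyRev 1 18 19 ;; PK ;; PJ ;;
      clear 18 ;; readField 0 9 19 ;; move 9 4 ;; readField 0 9 19 ;; unary 9 5)
      (initial (tupleProg B PK PJ) z k).2 (TK.eval n + TJ.eval n + 80 * n + 120)
      (QM k m kk j z.reverse x w [] [] [] [] [] [] [] [] [] [] []) := by
    rw [initial_eq _ z k 20]
    refine ((det_copyRev 0 3 19).seq ((det_copyRev 3 20 19).seq ((det_unary 20 18).seq
      ((det_copyRev 1 18 19).seq
      ((hPK _ _ _ _ n (by simp) (by simp) (by simp) (by simp) ?_ rfl rfl rfl).seq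
      ((hPJ _ _ _ _ n (by simp) (by simp) (by simp) (by simp) ?_ rfl rfl rfl).seq
      ((det_clear 18).seq ((det_readField 0 9 19).seq ((det_move 9 4).seq
      ((det_readField 0 9 19).seq (det_unary 9 5))))))))))).of_eq ?_ |>.mono ?_
    · simp [List.replicate_succ, hn, add_comm]
    · simp [List.replicate_succ, hn, add_comm]
    · simp [List.replicate_succ, QM, ← hx, ← hw, ← hm, hkk, hj]
    · simp [List.replicate_succ, ← hx, ← hm]
      omega
  have hloop := exec_coordLoop (A := A) (k := k) (m := m) (kk := kk) (j := j) (D := D)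
    (zl := z.reverse) (x := x) hPl
    (fun z acc r h pw ix wr tmp it ki mi => exec_sampleProg (D := D) hB (by omega) (by omega)
      (by rw [hkk]; omega)) (by omega) (by omega)
      (by
        have : k * j ≤ n * j := Nat.mul_le_mul_right _ (by omega)
        have e : n * j = 4 * n ^ 5 := by rw [hj]; ring
        omega) w [] (by omega)
  have post : ∀ ys ∈ (seqP (coord P m k j) (fields w)).support,
      Det A (move 8 19 ;; transfer 3 19 20 ;; move 20 2)
        (QM k m kk j z.reverse x [] (ys.flatten.reverse ++ []) [] [] [] [] [] [] [] [] [] [])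
        (20 * D + 10) (St (ket ∅) [[], List.replicate k false, fit z.length ys.flatten, [], x,
          List.replicate m false, List.replicate kk false, List.replicate j false, [], [], [], [], [],
          [], [], [], [], [], [], ys.flatten.drop z.length, [], []] fun _ => []) := by
    intro ys hys
    have h1 := length_flatten_of_forall₂ (mem_support_seqP (coord_length hPl) _ ys hys)
    have h2 := length_fields w
    have h3 : (fields w).length * m ≤ n * n := Nat.mul_le_mul (by omega) (by omega)
    have h4 : n * n = n ^ 2 := by ring
    refine ((det_move 8 19).seq ((det_transfer 3 19 20).seq (det_move 20 2))).of_eq ?_ |>.mono ?_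
    · simp
    · simp only [List.getD_cons_succ, List.getD_cons_zero, List.set_cons_succ,
        List.set_cons_zero, List.append_nil, List.length_reverse, length_fit,
        List.reverse_reverse, h1]
      omega
  refine ⟨_, (pre.seq_exec (hloop.seq_map_det post)).mono ?_, ?_⟩
  · have e : ((100 * D + 100 + t + (2 * (D + t) + 2) * max 3 B.bound + 300 * D + 400) * (D + 1) *
      (D + 1) + 1) * w.length ≤ ((100 * D + 100 + t + (2 * (D + t) + 2) * max 3 B.bound + 300 * D +
      400) * (D + 1) * (D + 1) + 1) * n := Nat.mul_le_mul_left _ (by omega)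
    omega
  · rw [PMF.map_comp]
    rfl

/-! ### Accuracy of the bisection -/

theorem prob_toReal_compl {α : Type*} (P : PMF α) (E : α → Prop) :
    (prob P fun a => ¬ E a).toReal = 1 - (prob P E).toReal := by
  have := congrArg ENNReal.toReal (prob_compl P E)
  rw [ENNReal.toReal_add (prob_ne_top _ _) (prob_ne_top _ _), ENNReal.toReal_one] at this
  linarith

theorem ex_ite {α : Type*} (P : PMF α) (E : α → Prop) [DecidablePred E] {a b : ℝ} (ha : 0 ≤ a)
    (hb : 0 ≤ b) : (ex P fun y => ENNReal.ofReal (if E y then a else b)) =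
      ENNReal.ofReal ((prob P E).toReal * a + (1 - (prob P E).toReal) * b) := by
  have h1 : (fun y => ENNReal.ofReal (if E y then a else b)) = fun y =>
      ENNReal.ofReal a * (if E y then 1 else 0) + ENNReal.ofReal b * (if ¬ E y then 1 else 0) := by
    funext y
    by_cases h : E y <;> simp [h]
  have h2 : (ex P fun y => if E y then 1 else 0) = prob P E := by
    rw [prob]; congr!
  have h3 : (ex P fun y => if ¬ E y then 1 else 0) = prob P fun y => ¬ E y := by
    rw [prob]; congr!
  rw [h1, ex_add, ex_mul_left, ex_mul_left, h2, h3, ← prob_toReal_compl,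
    ENNReal.ofReal_add (by positivity) (by positivity), ENNReal.ofReal_mul (by positivity),
    ENNReal.ofReal_mul (by positivity), ENNReal.ofReal_toReal (prob_ne_top _ _),
    ENNReal.ofReal_toReal (prob_ne_top _ _), mul_comm, mul_comm (ENNReal.ofReal b)]

theorem exp_le_quadratic {x : ℝ} (hx : |x| ≤ 1) : Real.exp x ≤ 1 + x + x ^ 2 := by
  have := (abs_le.mp (Real.abs_exp_sub_one_sub_id_le hx)).2
  linarith

/-- A bound for the exponential moment of an indicator function of mean `p`. -/
theorem bernoulli_exp_le {p x : ℝ} (h0 : 0 ≤ p) (h1 : p ≤ 1) (hx : |x| ≤ 1) :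
    p * Real.exp x + (1 - p) ≤ Real.exp (p * x + x ^ 2) := by
  have h2 := exp_le_quadratic hx
  have h3 := Real.add_one_le_exp (p * x + x ^ 2)
  nlinarith [mul_le_mul_of_nonneg_left h2 h0, sq_nonneg x]

/-- If each round multiplies the expectation of the potential `Φ` by at most `c`, then `n` rounds
multiply it by at most `c ^ n`. -/
theorem ex_kfold_le {β σ : Type*} {f : β → σ → PMF σ} {Φ : σ → ℝ≥0∞} {c : ℝ≥0∞}
    (h : ∀ b s, ex (f b s) Φ ≤ c * Φ s) (l : List β) (s : σ) :
    ex (kfold f l s) Φ ≤ c ^ l.length * Φ s := by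
  induction l generalizing s with
  | nil => simp [kfold, ex_pure]
  | cons b l ih =>
    rw [kfold, ex_bind]
    calc _ ≤ ex (f b s) fun s' => c ^ l.length * Φ s' := ex_mono ih
      _ = c ^ l.length * ex (f b s) Φ := ex_mul_left _ _ _
      _ ≤ c ^ l.length * (c * Φ s) := by gcongr; exact h b s
      _ = _ := by rw [List.length_cons, pow_succ, mul_assoc]

section countdown

variable {P : PMF (List Bool)} (X : List Bool → Bool) {x : ℝ}

/-- A counter that starts at `i` is decreased by each of the samples for which `X` holds. Chernoff's
bound for the probability that it reaches zero. -/
theorem prob_countdown_eq_zero_le (hx0 : 0 ≤ x) (hx1 : x ≤ 1) (l : List Bool) (i : ℕ) :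
    prob (kfold (fun (_ : Bool) s => P.map fun y => if X y then s - 1 else s) l i) (fun s => s = 0) ≤
      ENNReal.ofReal (Real.exp (l.length * ((prob P fun y => X y = true).toReal * x + x ^ 2) -
        x * i)) := by
  set p := (prob P fun y => X y = true).toReal with hp
  have hp1 : p ≤ 1 := ENNReal.toReal_le_of_le_ofReal zero_le_one (by simpa using prob_le_one _ _)
  have hp0 : 0 ≤ p := ENNReal.toReal_nonneg
  have h := ex_kfold_le (f := fun (_ : Bool) (s : ℕ) => P.map fun y => if X y then s - 1 else s)
    (Φ := fun s : ℕ => ENNReal.ofReal (Real.exp (-(x * s))))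
    (c := ENNReal.ofReal (Real.exp (p * x + x ^ 2))) (fun _ s => by
      rw [ex_map]
      calc _ ≤ ex P fun y => ENNReal.ofReal (if X y = true then Real.exp (-(x * s) + x) else
              Real.exp (-(x * s))) := by
            refine ex_mono fun y => ENNReal.ofReal_le_ofReal ?_
            simp only
            split_ifs with hy
            · refine Real.exp_le_exp.mpr ?_
              have : (s : ℝ) ≤ ((s - 1 : ℕ) : ℝ) + 1 := by exact_mod_cast (by omega : s ≤ s - 1 + 1)
              nlinarith
            · exact le_rfl
        _ = ENNReal.ofReal (p * Real.exp (-(x * s) + x) + (1 - p) * Real.exp (-(x * s))) :=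
            ex_ite _ _ (Real.exp_nonneg _) (Real.exp_nonneg _)
        _ ≤ _ := by
            rw [← ENNReal.ofReal_mul (Real.exp_nonneg _)]
            refine ENNReal.ofReal_le_ofReal ?_
            have := bernoulli_exp_le hp0 hp1 (x := x) (by rw [abs_of_nonneg hx0]; exact hx1)
            rw [Real.exp_add]
            nlinarith [mul_le_mul_of_nonneg_right this (Real.exp_nonneg (-(x * s)))]) l i
  refine (prob_le_of_le fun s _ hs => ?_).trans (h.trans_eq ?_)
  · simp [hs]
  · rw [← ENNReal.ofReal_pow (Real.exp_nonneg _), ← ENNReal.ofReal_mul (by positivity),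
      ← Real.exp_nat_mul, ← Real.exp_add]
    congr 2

/-- Chernoff's bound for the probability that the counter does not reach zero. -/
theorem prob_countdown_ne_zero_le (hx0 : 0 ≤ x) (hx1 : x ≤ 1) (l : List Bool) (i : ℕ) :
    prob (kfold (fun (_ : Bool) s => P.map fun y => if X y then s - 1 else s) l (i + 1))
      (fun s => s ≠ 0) ≤
      ENNReal.ofReal (Real.exp (l.length * (-(prob P fun y => X y = true).toReal * x + x ^ 2) +
        x * i)) := by
  set p := (prob P fun y => X y = true).toReal with hp
  have hp1 : p ≤ 1 := ENNReal.toReal_le_of_le_ofReal zero_le_one (by simpa using prob_le_one _ _)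
  have hp0 : 0 ≤ p := ENNReal.toReal_nonneg
  have h := ex_kfold_le (f := fun (_ : Bool) (s : ℕ) => P.map fun y => if X y then s - 1 else s)
    (Φ := fun s : ℕ => ENNReal.ofReal (if s = 0 then 0 else Real.exp (x * (s - 1))))
    (c := ENNReal.ofReal (Real.exp (p * (-x) + (-x) ^ 2))) (fun _ s => by
      rw [ex_map]
      rcases Nat.eq_zero_or_pos s with rfl | hs
      · refine le_of_eq_of_le ?_ zero_le
        simp only [Function.comp_def]
        simp [ex]
      calc _ ≤ ex P fun y => ENNReal.ofReal (if X y = true then Real.exp (x * (s - 1) + (-x)) else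
              Real.exp (x * (s - 1))) := by
            refine ex_mono fun y => ENNReal.ofReal_le_ofReal ?_
            simp only
            by_cases hy : X y = true
            · simp only [hy, if_true]
              split_ifs with h1
              · exact Real.exp_nonneg _
              · refine Real.exp_le_exp.mpr ?_
                rw [Nat.cast_sub hs]
                push_cast
                linarith
            · simp only [hy, Bool.false_eq_true, if_false, hs.ne', le_rfl]
        _ = ENNReal.ofReal (p * Real.exp (x * (s - 1) + (-x)) + (1 - p) * Real.exp (x * (s - 1))) :=
            ex_ite _ _ (Real.exp_nonneg _) (Real.exp_nonneg _)
        _ ≤ _ := by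
            rw [← ENNReal.ofReal_mul (Real.exp_nonneg _), if_neg hs.ne']
            refine ENNReal.ofReal_le_ofReal ?_
            have := bernoulli_exp_le hp0 hp1 (x := -x) (by rw [abs_neg, abs_of_nonneg hx0]; exact hx1)
            rw [Real.exp_add]
            nlinarith [mul_le_mul_of_nonneg_right this (Real.exp_nonneg (x * (s - 1)))]) l (i + 1)
  refine (prob_le_of_le fun s _ hs => ?_).trans (h.trans_eq ?_)
  · rw [if_neg hs, ENNReal.one_le_ofReal, Real.one_le_exp_iff]
    have : (1 : ℝ) ≤ s := by exact_mod_cast Nat.one_le_iff_ne_zero.mpr hs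
    nlinarith
  · rw [← ENNReal.ofReal_pow (Real.exp_nonneg _), ← ENNReal.ofReal_mul (by positivity),
      ← Real.exp_nat_mul, if_neg (Nat.succ_ne_zero i), ← Real.exp_add]
    congr 2
    push_cast
    ring

end countdown

/-- The probability, under `D`, of the strings that precede all continuations of `w`. -/
def below (D : PMF (List Bool)) (w : List Bool) : ℝ := (prob D fun y => lt w y = true).toReal

/-- The probability, under `D`, of the continuations of `w`. -/
def cyl (D : PMF (List Bool)) (w : List Bool) : ℝ := (prob D fun y => w <+: y).toReal

theorem lt_append_false (w y : List Bool) : lt (w ++ [false]) y = lt w y := by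
  induction w generalizing y with
  | nil => simp [lt]
  | cons b w ih => cases b <;> simp [lt, ih]

/-- The strings that precede `w1` are those that precede `w`, and the continuations of `w0`. -/
theorem lt_append_true {w y : List Bool} (h : w.length < y.length) :
    lt (w ++ [true]) y = true ↔ lt w y = true ∨ w ++ [false] <+: y := by
  induction w generalizing y with
  | nil =>
    cases y with
    | nil => simp at h
    | cons c y => cases c <;> simp [lt]
  | cons b w ih =>
    cases y with
    | nil => simp at h
    | cons c y =>
      have := ih (y := y) (by simpa using h)
      cases b <;> cases c <;> simp_all [lt]

theorem not_lt_of_prefix {w y : List Bool} (h : w <+: y) : lt w y = false := by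
  induction w generalizing y with
  | nil => rfl
  | cons b w ih =>
    obtain ⟨v, rfl⟩ := h
    have := ih (y := w ++ v) ⟨v, rfl⟩
    cases b <;> simp [lt, this]

theorem prob_add_of_disjoint {α : Type*} {P : PMF α} {E F G : α → Prop}
    (h : ∀ a ∈ P.support, G a ↔ E a ∨ F a) (hd : ∀ a ∈ P.support, ¬ (E a ∧ F a)) :
    (prob P G).toReal = (prob P E).toReal + (prob P F).toReal := by
  rw [← ENNReal.toReal_add (prob_ne_top _ _) (prob_ne_top _ _), prob, prob, prob, ← ex_add]
  congr 1
  refine le_antisymm (ex_mono_support fun a ha => ?_) (ex_mono_support fun a ha => ?_) <;>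
  · have h1 := h a ha
    have h2 := hd a ha
    by_cases hE : E a <;> by_cases hF : F a <;> simp_all

section

variable {D P : PMF (List Bool)} {m : ℕ}

theorem below_append_false (w : List Bool) : below D (w ++ [false]) = below D w := by
  simp only [below, lt_append_false]

theorem below_append_true (hD : ∀ y ∈ D.support, y.length = m) {w : List Bool} (hw : w.length < m) :
    below D (w ++ [true]) = below D w + cyl D (w ++ [false]) := by
  refine prob_add_of_disjoint (fun y hy => lt_append_true (by rw [hD y hy]; exact hw)) ?_
  rintro y hy ⟨h1, h2⟩
  have := not_lt_of_prefix h2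
  rw [lt_append_false] at this
  simp_all

theorem cyl_eq_add (hD : ∀ y ∈ D.support, y.length = m) {w : List Bool} (hw : w.length < m) :
    cyl D w = cyl D (w ++ [false]) + cyl D (w ++ [true]) := by
  refine prob_add_of_disjoint (fun y hy => ?_) ?_
  · constructor
    · rintro ⟨v, rfl⟩
      have := hD _ hy
      cases v with
      | nil => simp at this; omega
      | cons b v => cases b <;> simp
    · rintro (h | h) <;> exact (List.prefix_append _ _).trans h
  · rintro y hy ⟨⟨u, h1⟩, ⟨v, h2⟩⟩
    rw [← h2, List.append_assoc, List.append_assoc] at h1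
    simp at h1

/-- The number `ρ` is, up to `τ`, the position of the continuations of `w` in the cumulative
distribution function of `D`. -/
def Near (D : PMF (List Bool)) (ρ τ : ℝ) (w : List Bool) : Prop :=
  below D w ≤ ρ + τ ∧ ρ - τ ≤ below D w + cyl D w

theorem near_nil {ρ τ : ℝ} (h0 : 0 ≤ ρ) (h1 : ρ ≤ 1) (hτ : 0 ≤ τ) : Near D ρ τ [] := by
  have h2 : below D [] = 0 := by simp [below, lt, prob, ex]
  have h3 : cyl D [] = 1 := by
    simp only [cyl, List.nil_prefix, prob, if_true, ex_const, ENNReal.toReal_one]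
  constructor <;> rw [h2] <;> linarith

theorem near_append_false (hD : ∀ y ∈ D.support, y.length = m) {ρ τ : ℝ} {w : List Bool}
    (hw : w.length < m) (h : Near D ρ τ w) (h1 : ρ - τ ≤ below D (w ++ [true])) :
    Near D ρ τ (w ++ [false]) := by
  rw [below_append_true hD hw] at h1
  rw [Near, below_append_false]
  exact ⟨h.1, h1⟩

theorem near_append_true (hD : ∀ y ∈ D.support, y.length = m) {ρ τ : ℝ} {w : List Bool}
    (hw : w.length < m) (h : Near D ρ τ w) (h1 : below D (w ++ [true]) ≤ ρ + τ) :
    Near D ρ τ (w ++ [true]) := by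
  refine ⟨h1, h.2.trans_eq ?_⟩
  rw [cyl_eq_add hD hw, below_append_true hD hw, add_assoc]

/-- One step of the bisection preserves `Near`, except with small probability. -/
theorem prob_bisectStep_le (hD : ∀ y ∈ D.support, y.length = m) {L J v : ℕ} {ε δ : ℝ}
    (h1 : Close P D (ENNReal.ofReal ε)) (h2 : Close D P (ENNReal.ofReal ε))
    (hε0 : 0 ≤ ε) (hε : ε ≤ 1 / 2 ^ L) (hJ : 0 < J) (hδ : 4 * 2 ^ L / J ≤ δ)
    {w : List Bool} (hw : w.length < m) (h : Near D (v / 2 ^ L) (2 / 2 ^ L) w) :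
    prob (bisectStep P (2 ^ L * J) (v * J + 1) w) (fun w' => ¬ Near D (v / 2 ^ L) (2 / 2 ^ L) w') ≤
      ENNReal.ofReal δ := by
  set ρ : ℝ := v / 2 ^ L with hρ
  set τ : ℝ := 1 / 2 ^ L with hτ
  have hτ2 : (2 : ℝ) / 2 ^ L = 2 * τ := by rw [hτ]; ring
  rw [hτ2] at h ⊢
  have hτ0 : 0 < τ := by positivity
  have hτ1 : τ ≤ 1 := by
    rw [hτ, div_le_one (by positivity)]; exact one_le_pow₀ (by norm_num)
  set p := below P (w ++ [true]) with hp
  have hpD : |p - below D (w ++ [true])| ≤ ε := by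
    have e1 := ENNReal.toReal_mono (ENNReal.add_ne_top.mpr ⟨prob_ne_top _ _, ENNReal.ofReal_ne_top⟩)
      (h1.prob_le fun y => lt (w ++ [true]) y = true)
    have e2 := ENNReal.toReal_mono (ENNReal.add_ne_top.mpr ⟨prob_ne_top _ _, ENNReal.ofReal_ne_top⟩)
      (h2.prob_le fun y => lt (w ++ [true]) y = true)
    rw [ENNReal.toReal_add (prob_ne_top _ _) ENNReal.ofReal_ne_top, ENNReal.toReal_ofReal hε0] at e1 e2
    rw [abs_le]
    constructor <;> simp only [hp, below] <;> linarith
  rw [abs_le] at hpD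
  have hJr : (0 : ℝ) < J := by exact_mod_cast hJ
  have hK : ((List.replicate (2 ^ L * J) false).length : ℝ) = J / τ := by
    rw [List.length_replicate, hτ]; push_cast; field_simp
  have hv : (v : ℝ) * J = ρ * (J / τ) := by rw [hρ, hτ]; field_simp
  -- the exponent that results from the choice `x = τ / 2` in Chernoff's bound
  have hexp : ∀ e : ℝ, e ≤ -(J * τ / 4) → ENNReal.ofReal (Real.exp e) ≤ ENNReal.ofReal δ := by
    intro e he
    refine ENNReal.ofReal_le_ofReal (le_trans ?_ hδ)
    have h3 : 4 * 2 ^ L / (J : ℝ) = (J * τ / 4)⁻¹ := by rw [hτ]; field_simp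
    rw [h3]
    calc Real.exp e ≤ Real.exp (-(J * τ / 4)) := Real.exp_le_exp.mpr he
      _ = (Real.exp (J * τ / 4))⁻¹ := Real.exp_neg _
      _ ≤ _ := by
        have := Real.add_one_le_exp (J * τ / 4)
        gcongr
        linarith
  have hcancel : ∀ c : ℝ, J / τ * (c * (τ / 2)) = J * c / 2 := by intro c; field_simp
  rw [bisectStep, prob_map]
  have hbad : ∀ s : ℕ, ¬ Near D ρ (2 * τ) (w ++ [decide (s ≠ 0)]) →
      (s = 0 ∧ p < ρ - τ) ∨ (s ≠ 0 ∧ ρ + τ < p) := by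
    intro s hs
    by_cases h0 : s = 0
    · left
      refine ⟨h0, ?_⟩
      by_contra! hc
      refine hs ?_
      simp only [h0, ne_eq, not_true_eq_false, decide_false]
      exact near_append_false hD hw h (by linarith)
    · right
      refine ⟨h0, ?_⟩
      by_contra! hc
      refine hs ?_
      simp only [h0, ne_eq, not_false_eq_true, decide_true]
      exact near_append_true hD hw h (by linarith)
  rcases lt_or_ge p (ρ - τ) with hlt | hge
  · refine (prob_mono (F := fun s => s = 0) fun s _ hs => ?_).trans
      ((prob_countdown_eq_zero_le (lt (w ++ [true])) (x := τ / 2) (by linarith) (by linarith) _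
        _).trans (hexp _ ?_))
    · rcases hbad s hs with ⟨h0, _⟩ | ⟨_, h1⟩
      · exact h0
      · linarith
    · change _ * (p * _ + _) - _ ≤ _
      rw [hK]
      push_cast
      rw [hv]
      have e1 : J / τ * (p * (τ / 2) + (τ / 2) ^ 2) - τ / 2 * (ρ * (J / τ) + 1) =
        J * (p - ρ + τ / 2) / 2 - τ / 2 := by field_simp; ring
      rw [e1]
      nlinarith
  · rcases lt_or_ge (ρ + τ) p with hlt' | hge'
    · refine (prob_mono (F := fun s => s ≠ 0) fun s _ hs => ?_).trans
        ((prob_countdown_ne_zero_le (lt (w ++ [true])) (x := τ / 2) (by linarith) (by linarith) _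
          _).trans (hexp _ ?_))
      · rcases hbad s hs with ⟨_, h0⟩ | ⟨h1, _⟩
        · linarith
        · exact h1
      · change _ * (-p * _ + _) + _ ≤ _
        rw [hK]
        push_cast
        rw [hv]
        have e1 : J / τ * (-p * (τ / 2) + (τ / 2) ^ 2) + τ / 2 * (ρ * (J / τ)) =
          J * (ρ - p + τ / 2) / 2 := by field_simp; ring
        rw [e1]
        nlinarith
    · refine (prob_mono (F := fun _ => False) fun s _ hs => ?_).trans (by simp [prob, ex])
      rcases hbad s hs with ⟨_, h0⟩ | ⟨_, h1⟩ <;> linarith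

/-- A union bound for an experiment in two stages. -/
theorem prob_bind_le {α β : Type*} {P : PMF α} {g : α → PMF β} {E : α → Prop} {F : β → Prop}
    {δ ε : ℝ≥0∞} (h1 : prob P (fun a => ¬ E a) ≤ δ)
    (h2 : ∀ a ∈ P.support, E a → prob (g a) F ≤ ε) : prob (P.bind g) F ≤ δ + ε := by
  classical
  rw [prob_bind]
  calc _ ≤ ex P fun a => (if ¬ E a then 1 else 0) + ε := ex_mono_support fun a ha => by
        by_cases hE : E a
        · simpa [hE] using h2 a ha hE
        · simpa [hE] using (prob_le_one _ _).trans le_self_add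
    _ = prob P (fun a => ¬ E a) + ε := by
        rw [ex_add, ex_const, prob]; congr!
    _ ≤ _ := by gcongr

/-- The bisection finds a quantile, except with probability at most `δ` for each bit. Each
comparison is decided by `2 ^ L * J` samples. -/
theorem prob_bisect_le (hD : ∀ y ∈ D.support, y.length = m) {L J v : ℕ} {ε δ : ℝ}
    (h1 : Close P D (ENNReal.ofReal ε)) (h2 : Close D P (ENNReal.ofReal ε))
    (hε0 : 0 ≤ ε) (hε : ε ≤ 1 / 2 ^ L) (hJ : 0 < J) (hδ : 4 * 2 ^ L / J ≤ δ)
    (hv : v ≤ 2 ^ L) :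
    prob (bisect P m (2 ^ L * J) (v * J + 1)) (fun w => ¬ Near D (v / 2 ^ L) (2 / 2 ^ L) w) ≤
      m * ENNReal.ofReal δ := by
  have key : ∀ (l w : List Bool), w.length + l.length ≤ m → Near D (v / 2 ^ L) (2 / 2 ^ L) w →
      prob (kfold (fun _ w => bisectStep P (2 ^ L * J) (v * J + 1) w) l w)
        (fun w => ¬ Near D (v / 2 ^ L) (2 / 2 ^ L) w) ≤ l.length * ENNReal.ofReal δ := by
    intro l
    induction l with
    | nil =>
      intro w _ hw
      simp [kfold, prob, ex_pure, hw]
    | cons b l ih =>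
      intro w hl hw
      rw [kfold, List.length_cons]
      push_cast
      rw [add_mul, one_mul, add_comm ((l.length : ℝ≥0∞) * _)]
      simp only [List.length_cons] at hl
      refine prob_bind_le (prob_bisectStep_le hD h1 h2 hε0 hε hJ hδ (by omega) hw) ?_
      intro w' hw' hn
      rw [bisectStep, PMF.mem_support_map_iff] at hw'
      obtain ⟨s, _, rfl⟩ := hw'
      exact ih _ (by simp; omega) hn
  have := key (List.replicate m false) [] (by simp) (near_nil (by positivity)
    (by rw [div_le_one (by positivity)]; exact_mod_cast hv) (by positivity))
  rwa [List.length_replicate] at this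

theorem prob_seqP_forall₂_le {α β : Type*} {f : α → PMF β} {C : α → β → Prop} {δ : ℝ≥0∞}
    (rs : List α) (h : ∀ r ∈ rs, prob (f r) (fun y => ¬ C r y) ≤ δ) :
    prob (seqP f rs) (fun ys => ¬ List.Forall₂ C rs ys) ≤ rs.length * δ := by
  induction rs with
  | nil => simp [seqP, prob, ex_pure]
  | cons r rs ih =>
    rw [seqP, List.length_cons]
    push_cast
    rw [add_mul, one_mul, add_comm]
    refine prob_bind_le (h r (by simp)) fun y _ hy => ?_
    rw [prob_map]
    simp only [List.forall₂_cons, hy, true_and]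
    exact ih fun r hr => h r (by simp [hr])

theorem close_seqP {α β : Type*} {f g : α → PMF β} {ε : ℝ≥0∞} (rs : List α)
    (h : ∀ r ∈ rs, Close (f r) (g r) ε) : Close (seqP f rs) (seqP g rs) (rs.length * ε) := by
  induction rs with
  | nil => intro F _; simp [seqP]
  | cons r rs ih =>
    intro F hF
    rw [seqP, seqP, ex_bind, ex_bind, List.length_cons]
    push_cast
    simp only [ex_map]
    calc _ ≤ ex (f r) fun y => ex (seqP g rs) (F ∘ (y :: ·)) + rs.length * ε := ex_mono fun y =>
          ih (fun r hr => h r (by simp [hr])) _ fun ys => hF _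
      _ = (ex (f r) fun y => ex (seqP g rs) (F ∘ (y :: ·))) + rs.length * ε := by
          rw [ex_add, ex_const]
      _ ≤ ((ex (g r) fun y => ex (seqP g rs) (F ∘ (y :: ·))) + ε) + rs.length * ε := by
          gcongr
          exact h r (by simp) _ fun y => ex_le_const fun ys _ => hF _
      _ = _ := by ring

end

/-! ### The search problem of a sampling problem -/

/-- The input of the sampling problem that is encoded in `z`. -/
def inputOf (z : List Bool) : List Bool := (field z).1

/-- The length of samples that is encoded in `z`. -/
def lengthOf (z : List Bool) : ℕ := (field (field z).2).1.length

/-- The random strings that are encoded in `z`. -/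
def stringsOf (z : List Bool) : List (List Bool) := fields (field (field z).2).2

/-- The length of the random strings that are encoded in `z`. -/
def precisionOf (z : List Bool) : ℕ := ((stringsOf z).headD []).length

/-- The string `z` encodes an input, the length of the samples for this input, which the polynomial
`p` determines, and strings that have the same length. -/
def WellFormed (p : Polynomial ℕ) (z : List Bool) : Prop :=
  lengthOf z = p.eval (inputOf z).length ∧ ∀ r ∈ stringsOf z, r.length = precisionOf z

/-- The distribution of the concatenation, padded to the length of `z`, of independent samples from
the distribution `D x`, where `x` is the input encoded in `z`, one for each random string. -/
def samplesDist (D : List Bool → PMF (List Bool)) (z : List Bool) : PMF (List Bool) :=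
  (seqP (fun _ => D (inputOf z)) (stringsOf z)).map fun ys => fit z.length ys.flatten

instance : Countable (Polynomial ℕ) :=
  Function.Injective.countable (f := fun p : Polynomial ℕ => p.toFinsupp.coeff)
    fun _ _ h => Polynomial.toFinsupp_injective (by simpa using h)

/-- An enumeration of all programs with a polynomial time bound. -/
def clocked : ℕ → Prog × Polynomial ℕ :=
  haveI : Nonempty (Prog × Polynomial ℕ) := ⟨(.skip, 0)⟩
  Classical.choose (exists_surjective_nat (Prog × Polynomial ℕ))

theorem clocked_surjective : Function.Surjective clocked :=
  haveI : Nonempty (Prog × Polynomial ℕ) := ⟨(.skip, 0)⟩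
  Classical.choose_spec (exists_surjective_nat (Prog × Polynomial ℕ))

/-- The distribution of the output on `⟨z, 0^|z|⟩` of the `n`-th program, stopped by its clock. -/
def clockedOutput (A : Set (List Bool)) (n : ℕ) (z : List Bool) : PMF (List Bool) :=
  output A (clocked n).1 z z.length ((clocked n).2.eval (z.length + z.length))

/-- A mixture of the output distributions of all clocked programs. It replaces the universal
semimeasure: a string with small mass is not produced by any fixed program with a notable
probability. -/
def universal (A : Set (List Bool)) (z y : List Bool) : ℝ≥0∞ :=
  ∑' n, 2⁻¹ ^ (n + 1) * clockedOutput A n z y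

theorem tsum_universal (A : Set (List Bool)) (z : List Bool) : ∑' y, universal A z y = 1 := by
  simp only [universal]
  rw [ENNReal.tsum_comm]
  simp only [ENNReal.tsum_mul_left, PMF.tsum_coe, mul_one]
  rw [ENNReal.tsum_geometric_add_one, ENNReal.one_sub_inv_two, inv_inv,
    ENNReal.inv_mul_cancel (by simp) (by simp)]

/-- The string `y` of length `m` is approximately the quantile of `D` at `val r / 2 ^ L`, where `L`
is the length of `r`. -/
def Quantile (D : PMF (List Bool)) (m L : ℕ) (r y : List Bool) : Prop :=
  y.length = m ∧ Near D (val r / 2 ^ L) (2 / 2 ^ L) y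

/-- The solutions for `z`: strings of the length of `z` to which the universal mixture does not give
much more weight than the distribution of independent samples, or which consist of the quantiles at
the places given by the random strings in `z`. -/
def Solution (A : Set (List Bool)) (p : Polynomial ℕ) (D : List Bool → PMF (List Bool))
    (z Y : List Bool) : Prop :=
  Y.length = z.length ∧ (WellFormed p z →
    universal A z Y ≤ 2 ^ (precisionOf z + 1) * samplesDist D z Y ∨
    ∃ ys, Y = fit z.length ys.flatten ∧
      List.Forall₂ (Quantile (D (inputOf z)) (lengthOf z) (precisionOf z)) (stringsOf z) ys)

/-- Markov's inequality for the ratio of a semimeasure to a distribution. -/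
theorem prob_not_le_mul_le {α : Type*} {P : PMF α} {M : α → ℝ≥0∞} {c : ℝ≥0∞} (hM : ∑' a, M a ≤ 1)
    (h0 : c ≠ 0) (hc : c ≠ ∞) : prob P (fun a => ¬ M a ≤ c * P a) ≤ c⁻¹ := by
  calc _ ≤ ∑' a, c⁻¹ * M a := by
        refine ENNReal.tsum_le_tsum fun a => ?_
        by_cases h : M a ≤ c * P a
        · simp [h]
        · simp only [h, not_false_eq_true, if_true, mul_one]
          rw [← ENNReal.inv_mul_le_iff (by simpa) (by simpa), inv_inv]
          exact (not_le.mp h).le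
    _ ≤ _ := by
        rw [ENNReal.tsum_mul_left]
        exact mul_le_of_le_one_right' hM

theorem length_of_mem_stringsOf (z : List Bool) :
    (stringsOf z).length ≤ z.length ∧ lengthOf z ≤ z.length := by
  have l1 := length_field z
  have l2 := length_field (field z).2
  have l3 := length_fields (field (field z).2).2
  rw [stringsOf, lengthOf]
  omega

/-- The algorithm for the search problem fails with probability at most `1 / k`. If `2^L ≤ k`,
failures are due to the bisection; otherwise they are due to the precision of the samples, with
probability at most `n / (2 n²) ≤ 1 / (2k)`, and to Markov's inequality, with probability at most
`2^(-L - 1) ≤ 1 / (2k)`. -/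
theorem prob_not_solution_le {A : Set (List Bool)} {p : Polynomial ℕ} {D : List Bool → PMF (List Bool)}
    (hD : ∀ x, ∀ y ∈ (D x).support, y.length = p.eval x.length) {P : PMF (List Bool)}
    {z : List Bool} {k n : ℕ} (hk : 0 < k) (hn : n = z.length + k)
    (hP : tvDist P (D (inputOf z)) ≤ 1 / ((2 * n ^ 2 : ℕ) : ℝ)) :
    prob ((seqP (coord (P.map (fit (lengthOf z))) (lengthOf z) k (4 * n ^ 4)) (stringsOf z)).map
      fun ys => fit z.length ys.flatten) (fun Y => ¬ Solution A p D z Y) ≤ ENNReal.ofReal (1 / k) := by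
  set m := lengthOf z with hm
  set rs := stringsOf z with hrs
  set P' := P.map (fit m) with hP'
  set L := precisionOf z with hL
  obtain ⟨l1, l2⟩ := length_of_mem_stringsOf z
  rw [← hrs] at l1
  rw [← hm] at l2
  have hkr : (0 : ℝ) < k := by exact_mod_cast hk
  have hkn : (k : ℝ) ≤ n := by exact_mod_cast (by omega : k ≤ n)
  have hnr : (0 : ℝ) < n := hkr.trans_le hkn
  have hn0 : 0 < n := by omega
  have hn1 : (1 : ℝ) ≤ n := by exact_mod_cast (by omega : 1 ≤ n)
  have hNn : (rs.length : ℝ) ≤ n := by exact_mod_cast (by omega : rs.length ≤ n)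
  have hmn : (m : ℝ) ≤ n := by exact_mod_cast (by omega : m ≤ n)
  by_cases hW : WellFormed p z
  swap
  · refine (prob_mono (F := fun _ => False) fun Y hY h => ?_).trans (by simp [prob, ex])
    rw [PMF.mem_support_map_iff] at hY
    obtain ⟨ys, _, rfl⟩ := hY
    exact h ⟨length_fit _ _, fun h => absurd h hW⟩
  set DD := D (inputOf z) with hDD
  have hDm : ∀ y ∈ DD.support, y.length = m := fun y hy => (hD _ y hy).trans hW.1.symm
  have hDfit : DD.map (fit m) = DD := by
    rw [PMF.map, pmf_bind_congr (g := PMF.pure) fun y hy => by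
      simp only [Function.comp_apply]; rw [fit_eq_self (hDm y hy)], PMF.bind_pure]
  set ε : ℝ := 1 / ((2 * n ^ 2 : ℕ) : ℝ) with hε
  have hε0 : 0 ≤ ε := by positivity
  have c1 : Close P' DD (ENNReal.ofReal ε) := by
    rw [← hDfit]; exact (close_of_tvDist hP).map _
  have c2 : Close DD P' (ENNReal.ofReal ε) := by
    rw [← hDfit]; exact (close_of_tvDist ((tvDist_comm _ _).trans_le hP)).map _
  by_cases hLk : 2 ^ L ≤ k
  · -- there is enough time to find the quantiles
    have hLr : (2 : ℝ) ^ L ≤ k := by exact_mod_cast hLk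
    rw [prob_map]
    refine (prob_mono (F := fun ys => ¬ List.Forall₂ (Quantile DD m L) rs ys) fun ys _ h h' =>
      h ⟨length_fit _ _, fun _ => Or.inr ⟨ys, rfl, h'⟩⟩).trans ?_
    refine (prob_seqP_forall₂_le (δ := m * ENNReal.ofReal (4 * 2 ^ L / ((4 * n ^ 4 : ℕ) : ℝ))) rs
      fun r hr => ?_).trans ?_
    · have hrL := hW.2 r hr
      rw [← hL] at hrL
      have hc : coord P' m k (4 * n ^ 4) r =
          bisect P' m (2 ^ L * (4 * n ^ 4)) (val r * (4 * n ^ 4) + 1) := by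
        rw [coord, if_pos (by rwa [hrL]), hrL]
      rw [hc]
      refine (prob_mono fun y hy h h' => h ⟨bisect_length y hy, h'⟩).trans
        (prob_bisect_le hDm c1 c2 hε0 ?_ (by positivity) le_rfl ?_)
      · rw [hε]
        refine one_div_le_one_div_of_le (by positivity) ?_
        push_cast
        nlinarith
      · rw [← hrL]; exact (val_lt r).le
    · have e : ((rs.length : ℝ≥0∞) * (m * ENNReal.ofReal (4 * 2 ^ L / ((4 * n ^ 4 : ℕ) : ℝ)))) =
          ENNReal.ofReal (rs.length * (m * (4 * 2 ^ L / ((4 * n ^ 4 : ℕ) : ℝ)))) := by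
        rw [ENNReal.ofReal_mul (by positivity), ENNReal.ofReal_mul (by positivity),
          ENNReal.ofReal_natCast, ENNReal.ofReal_natCast]
      rw [e]
      refine ENNReal.ofReal_le_ofReal ?_
      calc (rs.length : ℝ) * (m * (4 * 2 ^ L / ((4 * n ^ 4 : ℕ) : ℝ)))
          ≤ n * (n * (4 * k / ((4 * n ^ 4 : ℕ) : ℝ))) := by gcongr
        _ = k / n ^ 2 := by push_cast; field_simp
        _ ≤ 1 / k := by
          rw [div_le_div_iff₀ (by positivity) hkr]
          nlinarith
  · -- the output is a sample from a distribution that is close to the ideal one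
    have hLr : (k : ℝ) ≤ 2 ^ L := by exact_mod_cast (not_le.mp hLk).le
    have c3 := (close_seqP (f := coord P' m k (4 * n ^ 4)) (g := fun _ => DD) rs fun r hr => by
      rwa [coord, if_neg (by rw [hW.2 r hr]; exact hLk)]).map fun ys => fit z.length ys.flatten
    have c4 := c3.prob_le fun Y => ¬ universal A z Y ≤ 2 ^ (L + 1) * samplesDist D z Y
    refine (prob_mono fun Y hY h h' => ?_).trans (c4.trans ?_)
    · rw [PMF.mem_support_map_iff] at hY
      obtain ⟨ys, _, rfl⟩ := hY
      exact h ⟨length_fit _ _, fun _ => Or.inl h'⟩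
    · have h1 := prob_not_le_mul_le (P := samplesDist D z) (tsum_universal A z).le
        (c := 2 ^ (L + 1)) (by simp) (by simp)
      have h2 : ((2 : ℝ≥0∞) ^ (L + 1))⁻¹ = ENNReal.ofReal (1 / 2 ^ (L + 1)) := by
        rw [one_div, ENNReal.ofReal_inv_of_pos (by positivity), ENNReal.ofReal_pow (by norm_num)]
        norm_num
      have h3 : (rs.length : ℝ≥0∞) * ENNReal.ofReal ε = ENNReal.ofReal (rs.length * ε) := by
        rw [ENNReal.ofReal_mul (by positivity), ENNReal.ofReal_natCast]
      rw [h2] at h1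
      rw [h3]
      refine (add_le_add_left h1 _).trans ?_
      rw [← ENNReal.ofReal_add (by positivity) (by positivity)]
      refine ENNReal.ofReal_le_ofReal ?_
      have e1 : 1 / (2 : ℝ) ^ (L + 1) ≤ 1 / (2 * k) := by
        refine one_div_le_one_div_of_le (by positivity) ?_
        rw [pow_succ]; linarith
      have e2 : rs.length * ε ≤ 1 / (2 * k) := by
        calc rs.length * ε ≤ n * ε := by gcongr
          _ = 1 / (2 * n) := by rw [hε]; push_cast; field_simp
          _ ≤ _ := by gcongr
      have e3 : 1 / (2 * (k : ℝ)) + 1 / (2 * k) = 1 / k := by field_simp; norm_num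
      linarith

/-- The search problem of a sampling problem in `SampBQP` is in `FBQP`. It is a search problem, i.e.
has solutions for all inputs, because the algorithm finds some with positive probability. -/
theorem exists_searchProblem {A : Set (List Bool)} {S : SamplingProblem} (hS : S ∈ SampBQPRel A)
    {p : Polynomial ℕ} (hp : ∀ x, ∀ y ∈ (S.dist x).support, y.length = p.eval x.length) :
    ∃ R ∈ FBQPRel A, ∀ z, R.sol z = {Y | Solution A p S.dist z Y} := by
  obtain ⟨B, TB, hB⟩ := hS
  obtain ⟨PK, TK, _, hPK⟩ := exists_polyProg (2 * Polynomial.X ^ 2) 18 6 19 20 (by simp) (by simp)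
    (by simp) (by simp) (by simp) (by simp)
  obtain ⟨PJ, TJ, _, hPJ⟩ := exists_polyProg (4 * Polynomial.X ^ 4) 18 7 19 20 (by simp) (by simp)
    (by simp) (by simp) (by simp) (by simp)
  set Dp : Polynomial ℕ := 4 * Polynomial.X ^ 5 + 2 * Polynomial.X ^ 2 + Polynomial.X with hDp
  set Tp : Polynomial ℕ := TB.comp (Polynomial.X + 2 * Polynomial.X ^ 2) with hTp
  set T : Polynomial ℕ := TK + TJ + ((100 * Dp + 100 + Tp + (2 * (Dp + Tp) + 2) *
    Polynomial.C (max 3 B.bound) + 300 * Dp + 400) * (Dp + 1) * (Dp + 1) + 1) * Polynomial.X +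
    200 * Dp + 200 with hT
  have main : ∀ z k, 0 < k → HaltsWithin A (tupleProg B PK PJ) z k (T.eval (z.length + k)) ∧
      prob (output A (tupleProg B PK PJ) z k (T.eval (z.length + k)))
        (fun Y => ¬ Solution A p S.dist z Y) ≤ ENNReal.ofReal (1 / k) := by
    intro z k hk
    set n := z.length + k with hn
    have hn2 : 0 < 2 * n ^ 2 := by positivity
    obtain ⟨hH, htv⟩ := hB (inputOf z) (2 * n ^ 2) hn2
    have hle : TB.eval ((inputOf z).length + 2 * n ^ 2) ≤ Tp.eval n := by
      have := length_field z
      rw [hTp, Polynomial.eval_comp]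
      refine eval_mono TB ?_
      simp only [Polynomial.eval_add, Polynomial.eval_X, Polynomial.eval_mul, Polynomial.eval_pow,
        Polynomial.eval_ofNat, inputOf]
      omega
    rw [← output_mono hH hle] at htv
    obtain ⟨μ, h1, h2⟩ := exec_tupleProg hPK hPJ (D := Dp.eval n) hn rfl (hH.mono hle) (by simp [hDp])
    have h3 := h1.mono (t' := T.eval n) (by simp [hT])
    refine ⟨haltsWithin_of_exec h3, ?_⟩
    rw [output_of_exec h3, h2]
    exact prob_not_solution_le hp hk hn htv
  refine ⟨⟨fun z => {Y | Solution A p S.dist z Y}, fun z => ?_, Polynomial.X, fun z Y hY => by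
    simpa using hY.1⟩, ⟨tupleProg B PK PJ, T, fun z k hk => ⟨(main z k hk).1, ?_⟩⟩, fun z => rfl⟩
  · by_contra hne
    rw [Set.not_nonempty_iff_eq_empty] at hne
    have h := (main z 2 (by norm_num)).2
    have h1 : ∀ Y, ¬ Solution A p S.dist z Y := fun Y hY => by
      have : Y ∈ {Y | Solution A p S.dist z Y} := hY
      rw [hne] at this
      exact this
    simp only [h1, not_false_eq_true, prob, if_true, ex_const] at h
    rw [ENNReal.one_le_ofReal] at h
    norm_num at h
  · rw [toOuterMeasure_eq_prob]
    have h := ENNReal.toReal_le_of_le_ofReal (by positivity) (main z k hk).2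
    rw [prob_toReal_compl] at h
    change _ ≤ (prob _ fun Y => Solution A p S.dist z Y).toReal
    linarith

/-! ### The algorithm for the sampling problem -/

/-- The memory of the sampling algorithm before the call of the search algorithm. The stacks are
used as follows: 0, input; 1, the number `k` (in unary); 2, output; 3, the length `m` of the
samples; 4, the length `L` of the random strings; 5, the number of strings that are still required;
6, the number of strings, a power of two; 7, the index of the sample that becomes the output; 8 to
11, auxiliary; 12 to 14, input and output of the search algorithm. -/
def SM (x : List Bool) (k m L pp acc idx : ℕ) (c s z : List Bool) : Mem :=
  St (ket ∅) [x, List.replicate k false, [], List.replicate m false, List.replicate L false,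
    List.replicate pp false, List.replicate acc false, List.replicate idx false, c, s, [], [], z, []]
    fun _ => []

/-- A fair coin. -/
abbrev coin : PMF Bool := PMF.uniformOfFintype Bool

/-- The sum of `idx` and a uniformly random number less than `2 ^ j`, times `acc`. -/
def drawIndex : ℕ → ℕ → ℕ → PMF ℕ
  | _, 0, idx => PMF.pure idx
  | acc, j + 1, idx => coin.bind fun b => drawIndex (acc + acc) j (idx + b.toNat * acc)

/-- Toss a coin for a binary digit of the index, and double the number of strings. -/
def drawStep : Prog :=
  (copyRev 6 8 10 ;; .loop 8 (.pop 8 ;; .pop 5)) ;; .toss 9 ;;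
    .branch 9 .skip (.pop 9) (.pop 9 ;; copyRev 6 7 10) ;; copyRev 6 8 10 ;; move 8 6

theorem exec_drawStep {x z : List Bool} {k m L pp acc idx : ℕ} :
    Exec A drawStep (SM x k m L pp acc idx [] [] z) (50 * acc + 40) (coin.map fun b =>
      SM x k m L (pp - acc) (acc + acc) (idx + b.toNat * acc) [] [] z) := by
  have d1 : Det A (copyRev 6 8 10) (SM x k m L pp acc idx [] [] z) (12 * acc + 3)
      (SM x k m L pp acc idx (List.replicate acc false) [] z) := by
    refine (det_copyRev 6 8 10).of_eq ?_ |>.mono ?_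
    · simp [SM]
    · simp
  have d2 := det_loop_list (A := A) (r := 8) (p := .pop 8 ;; .pop 5) (t := 3)
    (fun l s => SM x k m L s acc idx l [] z) (fun _ s => s - 1) (fun _ _ => True) (fun _ _ => rfl)
    (fun b l s _ => ((det_pop 8).seq (det_pop 5)).of_eq (by simp [SM])) (fun _ _ _ _ => trivial)
    (List.replicate acc false) pp trivial
  have hf : ∀ (l : List Bool) (s : ℕ), l.foldl (fun s _ => s - 1) s = s - l.length := by
    intro l
    induction l with
    | nil => simp
    | cons b l ih => intro s; rw [List.foldl_cons, ih, List.length_cons]; omega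
  rw [hf, List.length_replicate] at d2
  have d3 : Exec A (.toss 9) (SM x k m L (pp - acc) acc idx [] [] z) 1
      (coin.map fun b => SM x k m L (pp - acc) acc idx [] [b] z) := exec_toss_St 9
  have d4 : ∀ b, Det A (.branch 9 .skip (.pop 9) (.pop 9 ;; copyRev 6 7 10))
      (SM x k m L (pp - acc) acc idx [] [b] z) (12 * acc + 6)
      (SM x k m L (pp - acc) acc (idx + b.toNat * acc) [] [] z) := by
    intro b
    refine Det.mono (det_branch (t := 12 * acc + 5) (fun hu => absurd hu (List.cons_ne_nil _ _))
      (fun u hu => ?_) (fun u hu => ?_)) le_rfl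
    · obtain ⟨rfl, rfl⟩ := List.cons_eq_cons.mp hu
      refine (det_pop 9).of_eq ?_ |>.mono (by omega)
      simp [SM]
    · obtain ⟨rfl, rfl⟩ := List.cons_eq_cons.mp hu
      refine ((det_pop 9).seq (det_copyRev 6 7 10)).of_eq ?_ |>.mono ?_
      · simp [SM, add_comm]
      · simp; omega
  have d5 : ∀ i, Det A (copyRev 6 8 10 ;; move 8 6)
      (SM x k m L (pp - acc) acc i [] [] z) (17 * acc + 5)
      (SM x k m L (pp - acc) (acc + acc) i [] [] z) := by
    intro i
    refine ((det_copyRev 6 8 10).seq (det_move 8 6)).of_eq ?_ |>.mono ?_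
    · simp [SM]
    · simp; omega
  exact ((d1.seq d2).seq_exec (d3.seq_map_det fun b _ => (d4 b).seq (d5 _))).mono (by omega)

/-- The number of strings is doubled until it exceeds `pp`, the number of strings that are required;
a power of two is needed for a uniformly random index to be drawn by finitely many coin tosses. -/
theorem exec_drawLoop {x z : List Bool} {k m L M : ℕ} (pp acc : ℕ) (h0 : 0 < acc)
    (h1 : 0 < pp → pp + acc ≤ M) (h2 : acc ≤ 2 * M) :
    ∃ j, pp + acc ≤ acc * 2 ^ j ∧ acc * 2 ^ j ≤ 2 * M ∧ ∀ idx,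
      Exec A (.loop 5 drawStep) (SM x k m L pp acc idx [] [] z) ((50 * M + 41) * pp + 1)
        ((drawIndex acc j idx).map fun i => SM x k m L 0 (acc * 2 ^ j) i [] [] z) := by
  induction pp using Nat.strong_induction_on generalizing acc with
  | _ pp ih =>
    rcases Nat.eq_zero_or_pos pp with rfl | hpp
    · refine ⟨0, by simp, by simpa, fun idx => ?_⟩
      have : Exec A (.loop 5 drawStep) (SM x k m L 0 acc idx [] [] z) 1 _ := exec_loop_nil rfl
      simpa [drawIndex, PMF.pure_map] using this
    · have h3 := h1 hpp
      obtain ⟨j, e1, e2, e3⟩ := ih (pp - acc) (by omega) (acc + acc) (by omega) (by omega) (by omega)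
      have e4 : acc * 2 ^ (j + 1) = (acc + acc) * 2 ^ j := by ring
      refine ⟨j + 1, by rw [e4]; omega, by rw [e4]; omega, fun idx => ?_⟩
      have hne : (SM x k m L pp acc idx [] [] z).reg 5 ≠ [] := by
        change List.replicate pp false ≠ []
        rw [Ne, List.replicate_eq_nil_iff]
        omega
      rw [e4, drawIndex, PMF.map_bind]
      refine (exec_loop_cons_map hne exec_drawStep fun b _ => e3 _).mono ?_
      calc 50 * acc + 40 + ((50 * M + 41) * (pp - acc) + 1) + 1
          ≤ (50 * M + 41) * (pp - acc) + (50 * M + 41) * 1 + 1 := by omega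
        _ ≤ _ := by
          rw [← mul_add]
          gcongr
          omega

theorem mem_support_drawIndex {acc j idx i : ℕ} (h : i ∈ (drawIndex acc j idx).support) :
    i + acc ≤ idx + acc * 2 ^ j := by
  induction j generalizing acc idx with
  | zero => simp [drawIndex] at h; simp [h]
  | succ j ih =>
    rw [drawIndex, PMF.mem_support_bind_iff] at h
    obtain ⟨b, _, hb⟩ := h
    have h1 := ih hb
    have h2 : b.toNat * acc ≤ 1 * acc := Nat.mul_le_mul_right _ (Bool.toNat_le b)
    rw [pow_succ]
    nlinarith

/-- A uniformly random string of length `L`. -/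
def tosses (L : ℕ) : PMF (List Bool) :=
  kfold (fun _ s => coin.map (· :: s)) (List.replicate L false) []

/-- A list of `N` independent uniformly random strings of length `L`. -/
def randomStrings (L N : ℕ) : PMF (List (List Bool)) :=
  kfold (fun _ rs => (tosses L).map (· :: rs)) (List.replicate N false) []

theorem kfold_cons_support {α β : Type*} {P : PMF α} {C : α → Prop} (hP : ∀ a ∈ P.support, C a)
    (l : List β) (s : List α) (hs : ∀ a ∈ s, C a) :
    ∀ s' ∈ (kfold (fun _ s => P.map (· :: s)) l s).support,
      s'.length = l.length + s.length ∧ ∀ a ∈ s', C a := by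
  induction l generalizing s with
  | nil => intro s' h; simp [kfold] at h; subst h; exact ⟨by simp, hs⟩
  | cons b l ih =>
    intro s' h
    rw [kfold, PMF.mem_support_bind_iff] at h
    obtain ⟨s₁, h₁, h₂⟩ := h
    rw [PMF.mem_support_map_iff] at h₁
    obtain ⟨a, ha, rfl⟩ := h₁
    obtain ⟨h3, h4⟩ := ih (a :: s) (by simpa using ⟨hP a ha, hs⟩) s' h₂
    exact ⟨by rw [h3]; simp; omega, h4⟩

theorem length_of_mem_tosses {L : ℕ} {r : List Bool} (h : r ∈ (tosses L).support) : r.length = L := by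
  simpa using (kfold_cons_support (C := fun _ => True) (fun _ _ => trivial) _ [] (by simp) r h).1

theorem of_mem_randomStrings {L N : ℕ} {rs : List (List Bool)} (h : rs ∈ (randomStrings L N).support) :
    rs.length = N ∧ ∀ r ∈ rs, r.length = L := by
  simpa using kfold_cons_support (C := fun r : List Bool => r.length = L)
    (fun _ => length_of_mem_tosses) _ [] (by simp) rs h

/-- Push a self-delimiting random string. -/
def stringProg : Prog :=
  (copyRev 4 8 10 ;; .loop 8 (.pop 8 ;; .toss 9)) ;; move 9 8 ;; encode 8 12

theorem exec_stringProg {x z : List Bool} {k m L acc idx : ℕ} :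
    Exec A stringProg (SM x k m L 0 acc idx [] [] z) (40 * L + 40) ((tosses L).map fun r =>
      SM x k m L 0 acc idx [] [] (enc r ++ z)) := by
  have d1 : Det A (copyRev 4 8 10) (SM x k m L 0 acc idx [] [] z) (12 * L + 3)
      (SM x k m L 0 acc idx (List.replicate L false) [] z) := by
    refine (det_copyRev 4 8 10).of_eq ?_ |>.mono ?_
    · simp [SM]
    · simp
  have d2 := exec_loop_list (A := A) (r := 8) (p := .pop 8 ;; .toss 9) (t := 3)
    (fun l s => SM x k m L 0 acc idx l s z) (fun _ s => coin.map (· :: s)) (fun _ _ => True)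
    (fun _ _ => rfl)
    (fun b l s _ => by
      have e : Det A (.pop 8) (SM x k m L 0 acc idx (b :: l) s z) 1 (SM x k m L 0 acc idx l s z) :=
        det_pop 8
      have e' : Exec A (.toss 9) (SM x k m L 0 acc idx l s z) 1
        (coin.map fun b => SM x k m L 0 acc idx l (b :: s) z) := exec_toss_St 9
      rw [PMF.map_comp]
      exact e.seq_exec e')
    (fun _ _ _ _ _ _ => trivial) (List.replicate L false) [] trivial
  have d3 : ∀ r ∈ (tosses L).support, Det A (move 9 8 ;; encode 8 12)
      (SM x k m L 0 acc idx [] r z) (12 * L + 5) (SM x k m L 0 acc idx [] [] (enc r ++ z)) := by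
    intro r hr
    have := length_of_mem_tosses hr
    refine ((det_move 9 8).seq (det_encode 8 12)).of_eq ?_ |>.mono ?_
    · simp [SM]
    · simp; omega
  refine ((d1.seq_exec d2).seq_map_det d3).mono ?_
  rw [List.length_replicate]
  omega

theorem exec_stringLoop {x : List Bool} {k m L idx : ℕ} (N : ℕ) :
    Exec A (.loop 6 (.pop 6 ;; stringProg)) (SM x k m L 0 N idx [] [] []) ((40 * L + 43) * N + 1)
      ((randomStrings L N).map fun rs => SM x k m L 0 0 idx [] [] (rs.flatMap enc)) := by
  have := exec_loop_list (A := A) (r := 6) (p := .pop 6 ;; stringProg) (t := 40 * L + 42)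
    (fun l rs => St (ket ∅) [x, List.replicate k false, [], List.replicate m false,
      List.replicate L false, [], l, List.replicate idx false, [], [], [], [], rs.flatMap enc, []]
      fun _ => []) (fun _ rs => (tosses L).map (· :: rs))
    (fun l rs => ∃ n, l = List.replicate n false) (fun _ _ => rfl)
    (fun b l rs hI => by
      obtain ⟨n, hn⟩ := hI
      obtain ⟨n, rfl⟩ : ∃ n', l = List.replicate n' false := by
        cases n with
        | zero => simp at hn
        | succ n => exact ⟨n, (List.cons_eq_cons.mp hn).2⟩
      rw [PMF.map_comp]
      exact (Det.seq_exec (det_pop 6) exec_stringProg).mono (by omega))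
    (fun b l rs hI _ _ => by
      obtain ⟨n, hn⟩ := hI
      cases n with
      | zero => simp at hn
      | succ n => exact ⟨n, (List.cons_eq_cons.mp hn).2⟩)
    (List.replicate N false) [] ⟨N, rfl⟩
  rw [List.length_replicate] at this
  exact this

/-- The input of the search problem that encodes `x`, the length `m`, and the strings in `rs`. -/
def searchInput (x : List Bool) (m : ℕ) (rs : List (List Bool)) : List Bool :=
  enc x ++ (enc (List.replicate m false) ++ rs.flatMap enc)

theorem length_searchInput {x : List Bool} {m L N : ℕ} {rs : List (List Bool)} (h : rs.length = N)
    (hr : ∀ r ∈ rs, r.length = L) :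
    (searchInput x m rs).length = 2 * x.length + 2 * m + 2 + N * (2 * L + 1) := by
  have : (rs.flatMap enc).length = rs.length * (2 * L + 1) := by
    clear h
    induction rs with
    | nil => simp
    | cons r rs ih =>
      rw [List.flatMap_cons, List.length_append, ih fun r h => hr r (by simp [h]), length_enc,
        hr r (by simp), List.length_cons]
      ring
  simp only [searchInput, List.length_append, length_enc, this, h, List.length_replicate]
  omega

/-- The sampling algorithm that runs the search algorithm `C` on random strings, and extracts a
random sample from the output. -/
def extractProg (PM PL PP C : Prog) : Prog :=
  (copyRev 0 9 10 ;; unary 9 11 ;; PM ;; clear 11 ;; copyRev 3 11 10 ;; copyRev 1 11 10 ;;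
    copyRev 1 11 10 ;; PL ;; clear 11 ;; copyRev 4 11 10 ;; PP ;; clear 11 ;; .push 6 false) ;;
  .loop 5 drawStep ;; .loop 6 (.pop 6 ;; stringProg) ;;
  (copyRev 3 9 10 ;; encode 9 12 ;; move 0 9 ;; encode 9 12 ;; copyRev 12 9 10 ;; unary 9 13) ;;
  C.shift 12 ;; .loop 7 (.pop 7 ;; copyRev 3 8 10 ;; .loop 8 (.pop 8 ;; .pop 14)) ;;
  transfer 3 14 9 ;; move 9 2

/-- The exact distribution of the output of `extractProg`, which uses strings of length
`L = m + 2k + 10`, and a number of strings that is a power of two larger than `pp L`. -/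
theorem exec_extractProg {PM PL PP C : Prog} {p pp TM TL TP : Polynomial ℕ} {x : List Bool}
    {k m L M t : ℕ} (hPM : Computes PM p TM 11 3 8 10)
    (hPL : Computes PL (Polynomial.X + 10) TL 11 4 8 10) (hPP : Computes PP pp TP 11 5 8 10)
    (hm : m = p.eval x.length) (hL : L = m + 2 * k + 10)
    (hxM : x.length ≤ M) (hLM : L ≤ M) (hM : pp.eval L + 1 ≤ M)
    (hC : ∀ rs : List (List Bool), rs.length ≤ 2 * M → (∀ r ∈ rs, r.length = L) →
      HaltsWithin A C (searchInput x m rs) (searchInput x m rs).length t) :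
    ∃ j μ, pp.eval L + 1 ≤ 2 ^ j ∧ 2 ^ j ≤ 2 * M ∧
      Exec A (extractProg PM PL PP C) (initial (extractProg PM PL PP C) x k).2
        (TM.eval x.length + TL.eval (m + 2 * k) + TP.eval L + t + 1000 * (M + 1) ^ 2) μ ∧
      μ.map (fun m => m.reg 2) = (drawIndex 1 j 0).bind fun i => (randomStrings L (2 ^ j)).bind fun rs =>
        (output A C (searchInput x m rs) (searchInput x m rs).length t).map fun Y =>
          fit m (Y.drop (i * m)) := by
  obtain ⟨j, j1, j2, d2⟩ := exec_drawLoop (A := A) (x := x) (z := []) (k := k) (m := m) (L := L)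
    (M := M) (pp.eval L) 1 one_pos (fun _ => hM) (by omega)
  rw [one_mul] at j1 j2
  simp only [one_mul] at d2
  have hmM : m ≤ M := by omega
  have hkM : k ≤ M := by omega
  have d1 : Det A (copyRev 0 9 10 ;; unary 9 11 ;; PM ;; clear 11 ;; copyRev 3 11 10 ;;
      copyRev 1 11 10 ;; copyRev 1 11 10 ;; PL ;; clear 11 ;; copyRev 4 11 10 ;; PP ;; clear 11 ;;
      .push 6 false) (initial (extractProg PM PL PP C) x k).2
      (TM.eval x.length + TL.eval (m + 2 * k) + TP.eval L + 100 * M + 100)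
      (SM x k m L (pp.eval L) 1 0 [] [] []) := by
    rw [initial_eq _ x k 12]
    refine ((det_copyRev 0 9 10).seq ((det_unary 9 11).seq
      ((hPM _ _ _ _ x.length (by simp) (by simp) (by simp) (by simp) ?_ rfl rfl rfl).seq
      ((det_clear 11).seq ((det_copyRev 3 11 10).seq ((det_copyRev 1 11 10).seq
      ((det_copyRev 1 11 10).seq
      ((hPL _ _ _ _ (m + 2 * k) (by simp) (by simp) (by simp) (by simp) ?_ rfl rfl rfl).seq
      ((det_clear 11).seq ((det_copyRev 4 11 10).seq
      ((hPP _ _ _ _ L (by simp) (by simp) (by simp) (by simp) ?_ rfl rfl rfl).seq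
      ((det_clear 11).seq (det_push 6 false))))))))))))).of_eq ?_ |>.mono ?_
    · simp [List.replicate_succ]
    · simp [List.replicate_succ, ← hm]; omega
    · simp [List.replicate_succ, hL]; rfl
    · simp [List.replicate_succ, SM, ← hm, hL]; rfl
    · simp [List.replicate_succ, ← hm, hL]
      omega
  have e1 : ∀ i, ∀ rs ∈ (randomStrings L (2 ^ j)).support,
      Det A (copyRev 3 9 10 ;; encode 9 12 ;; move 0 9 ;; encode 9 12 ;; copyRev 12 9 10 ;; unary 9 13)
        (SM x k m L 0 0 i [] [] (rs.flatMap enc)) (150 * M + 100 + 70 * M * M)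
        (St (ket ∅) ([[], List.replicate k false, [], List.replicate m false, List.replicate L false,
          [], [], List.replicate i false, [], [], [], []] ++ [searchInput x m rs,
          List.replicate (searchInput x m rs).length false]) fun _ => []) := by
    intro i rs hrs
    have hlen := length_searchInput (x := x) (m := m) (of_mem_randomStrings hrs).1
      (of_mem_randomStrings hrs).2
    have h2 : 2 ^ j * (2 * L + 1) ≤ 2 * M * (2 * M + 1) := Nat.mul_le_mul j2 (by omega)
    have h3 : 2 * M * (2 * M + 1) = 4 * (M * M) + 2 * M := by ring
    refine ((det_copyRev 3 9 10).seq ((det_encode 9 12).seq ((det_move 0 9).seq ((det_encode 9 12).seq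
      ((det_copyRev 12 9 10).seq (det_unary 9 13)))))).of_eq ?_ |>.mono ?_
    · simp [searchInput]
      simp only [add_comm]
      rw [add_assoc]
    · simp only [searchInput, List.length_append] at hlen
      simp [-List.length_flatMap, length_enc]
      simp only [length_enc, List.length_replicate] at hlen
      rw [mul_assoc 70]
      omega
  have e2 : ∀ i, i ≤ 2 * M → ∀ (q : QState) (u0 u1 u2 : List Bool) (lo : ℕ → List Bool),
      Det A (.loop 7 (.pop 7 ;; copyRev 3 8 10 ;; .loop 8 (.pop 8 ;; .pop 14)) ;;
        transfer 3 14 9 ;; move 9 2)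
        (St q [[], List.replicate k false, [], List.replicate m false, List.replicate L false,
          [], [], List.replicate i false, [], [], [], [], u0, u1, u2] lo)
        ((20 * M + 20) * (2 * M) + 20 * M + 20)
        (St q [[], List.replicate k false, fit m (u2.drop (i * m)), [], List.replicate L false,
          [], [], [], [], [], [], [], u0, u1, (u2.drop (i * m)).drop m] lo) := by
    intro i hi q u0 u1 u2 lo
    set G : List Bool → List Bool → List Bool → Mem := fun l c s =>
      St q [[], List.replicate k false, [], List.replicate m false, List.replicate L false,
        [], [], l, c, [], [], [], u0, u1, s] lo with hG
    have inner : ∀ l s, Det A (.loop 8 (.pop 8 ;; .pop 14)) (G l (List.replicate m false) s)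
        (4 * m + 1) (G l [] (s.drop m)) := by
      intro l s
      have h := det_loop_list (A := A) (r := 8) (p := .pop 8 ;; .pop 14) (t := 3)
        (fun c s => G l c s) (fun _ s => s.tail) (fun _ _ => True) (fun _ _ => rfl)
        (fun b c s _ => ((det_pop 8).seq (det_pop 14)).of_eq (by simp [hG])) (fun _ _ _ _ => trivial)
        (List.replicate m false) s trivial
      have hf : ∀ (c s : List Bool), c.foldl (fun s _ => s.tail) s = s.drop c.length := by
        intro c
        induction c with
        | nil => simp
        | cons b c ih => intro s; rw [List.foldl_cons, ih, List.length_cons, List.drop_tail]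
      rwa [hf, List.length_replicate] at h
    have outer := det_loop_list (A := A) (r := 7)
      (p := .pop 7 ;; copyRev 3 8 10 ;; .loop 8 (.pop 8 ;; .pop 14)) (t := 20 * m + 10)
      (fun l s => G l [] s) (fun _ s => s.drop m) (fun _ _ => True) (fun _ _ => rfl)
      (fun b l s _ => by
        have f : Det A (.pop 7) (G (b :: l) [] s) 1 (G l [] s) := det_pop 7
        have f' : Det A (copyRev 3 8 10) (G l [] s) (12 * m + 3) (G l (List.replicate m false) s) := by
          refine (det_copyRev 3 8 10).of_eq ?_ |>.mono ?_
          · simp [hG]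
          · simp
        exact (f.seq (f'.seq (inner l s))).mono (by omega)) (fun _ _ _ _ => trivial)
      (List.replicate i false) u2 trivial
    have hf : ∀ (c s : List Bool), c.foldl (fun s _ => s.drop m) s = s.drop (c.length * m) := by
      intro c
      induction c with
      | nil => simp
      | cons b c ih =>
        intro s
        rw [List.foldl_cons, ih, List.length_cons, List.drop_drop]
        congr 1
        ring
    rw [hf, List.length_replicate] at outer
    refine (outer.seq ((det_transfer 3 14 9).seq (det_move 9 2))).of_eq ?_ |>.mono ?_
    · simp
    · have : (20 * m + 10 + 1) * i ≤ (20 * M + 20) * (2 * M) := Nat.mul_le_mul (by omega) hi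
      simp
      omega
  have tail : ∀ i ∈ (drawIndex 1 j 0).support, Exec A (.loop 6 (.pop 6 ;; stringProg) ;;
      (copyRev 3 9 10 ;; encode 9 12 ;; move 0 9 ;; encode 9 12 ;; copyRev 12 9 10 ;; unary 9 13) ;;
      C.shift 12 ;; .loop 7 (.pop 7 ;; copyRev 3 8 10 ;; .loop 8 (.pop 8 ;; .pop 14)) ;;
      transfer 3 14 9 ;; move 9 2) (SM x k m L 0 (2 ^ j) i [] [] [])
      ((40 * M + 43) * (2 * M) + 1 + (150 * M + 100 + 70 * M * M + (t + ((20 * M + 20) * (2 * M) +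
        20 * M + 20) + 1) + 1) + 1)
      ((randomStrings L (2 ^ j)).bind fun rs => (run A t (initial C (searchInput x m rs)
        (searchInput x m rs).length)).map fun c => St c.2.qst [[], List.replicate k false,
          fit m ((c.2.reg 2).drop (i * m)), [], List.replicate L false, [], [], [], [], [], [], [],
          c.2.reg 0, c.2.reg 1, ((c.2.reg 2).drop (i * m)).drop m] fun r => c.2.reg (r + 3)) := by
    intro i hi
    have hi' : i ≤ 2 * M := by have := mem_support_drawIndex hi; omega
    refine Exec.seq_map ((exec_stringLoop (2 ^ j)).mono ?_) fun rs hrs => ?_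
    · have := Nat.mul_le_mul (show 40 * L + 43 ≤ 40 * M + 43 by omega) j2
      omega
    · obtain ⟨r1, r2⟩ := of_mem_randomStrings hrs
      exact (e1 i rs hrs).seq_exec ((exec_call (vs := [[], List.replicate k false, [],
        List.replicate m false, List.replicate L false, [], [], List.replicate i false,
        [], [], [], []]) (hC rs (by omega) r2)).seq_map_det fun c _ => e2 i hi' _ _ _ _ _)
  refine ⟨j, _, j1, j2, (d1.seq_exec (Exec.seq_map (d2 0) tail)).mono ?_, ?_⟩
  · have : (50 * M + 41) * pp.eval L ≤ (50 * M + 41) * M := Nat.mul_le_mul_left _ (by omega)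
    ring_nf at this ⊢
    nlinarith
  · rw [PMF.map_bind]
    congr 1
    funext i
    rw [PMF.map_bind]
    congr 1
    funext rs
    rw [PMF.map_comp, output, PMF.map_comp]
    rfl

theorem Prog.Classical.extractProg {PM PL PP C : Prog} (h1 : PM.Classical) (h2 : PL.Classical)
    (h3 : PP.Classical) (h4 : C.Classical) : (extractProg PM PL PP C).Classical := by
  have := h4.shift 12
  simp_all [SampSearch.extractProg, copyRev, dup, move, unary, clear, encode, transfer, drawStep,
    stringProg, Prog.Classical]

/-! ### Random indices and random strings -/

theorem ex_coin (f : Bool → ℝ≥0∞) : ex coin f = 2⁻¹ * (f false + f true) := by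
  rw [ex, tsum_bool]
  simp [mul_add]

theorem sum_range_two_mul (n : ℕ) (f : ℕ → ℝ≥0∞) :
    ∑ i ∈ Finset.range (2 * n), f i = ∑ i ∈ Finset.range n, (f (2 * i) + f (2 * i + 1)) := by
  induction n with
  | zero => simp
  | succ n ih =>
    rw [Finset.sum_range_succ, ← ih, show 2 * (n + 1) = 2 * n + 1 + 1 by ring, Finset.sum_range_succ,
      Finset.sum_range_succ, add_assoc]

/-- The index is uniformly distributed. -/
theorem ex_drawIndex (acc j idx : ℕ) (f : ℕ → ℝ≥0∞) :
    ex (drawIndex acc j idx) f = 2⁻¹ ^ j * ∑ i ∈ Finset.range (2 ^ j), f (idx + acc * i) := by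
  induction j generalizing acc idx with
  | zero => simp [drawIndex, ex_pure]
  | succ j ih =>
    rw [drawIndex, ex_bind, ex_coin, ih, ih, ← mul_add, ← Finset.sum_add_distrib, ← mul_assoc,
      ← pow_succ', pow_succ' 2 j, sum_range_two_mul]
    congr 1
    refine Finset.sum_congr rfl fun i _ => ?_
    congr 2 <;> simp <;> ring

theorem kfold_append {β σ : Type*} (f : β → σ → PMF σ) (l l' : List β) (s : σ) :
    kfold f (l ++ l') s = (kfold f l s).bind (kfold f l') := by
  induction l generalizing s with
  | nil => simp [kfold]
  | cons b l ih =>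
    rw [List.cons_append, kfold, kfold, PMF.bind_bind]
    congr 1
    funext s
    exact ih s

theorem tosses_succ (L : ℕ) : tosses (L + 1) = (tosses L).bind fun s => coin.map (· :: s) := by
  rw [tosses, List.replicate_succ', kfold_append]
  congr 1
  funext s
  simp [kfold]

/-- The number with random binary digits is uniformly distributed. -/
theorem ex_tosses_val (L : ℕ) (f : ℕ → ℝ≥0∞) :
    (ex (tosses L) fun r => f (val r)) = 2⁻¹ ^ L * ∑ i ∈ Finset.range (2 ^ L), f i := by
  induction L generalizing f with
  | zero => simp [tosses, kfold, ex_pure, val]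
  | succ L ih =>
    have e : ∀ b r, val (b :: r) = 2 * val r + b.toNat := fun _ _ => rfl
    simp only [tosses_succ, ex_bind, ex_map, ex_coin, Function.comp_def, e, Bool.toNat_false,
      Bool.toNat_true, add_zero]
    rw [ih fun i => 2⁻¹ * (f (2 * i) + f (2 * i + 1)), ← Finset.mul_sum, ← mul_assoc, ← pow_succ,
      pow_succ' 2 L, sum_range_two_mul]

theorem card_le_of_mem_Icc {s : Finset ℕ} {a b : ℝ} (hb : 0 ≤ b) (hab : a ≤ b)
    (h : ∀ i ∈ s, a ≤ i ∧ (i : ℝ) ≤ b) : (s.card : ℝ) ≤ b - a + 1 := by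
  have h1 : s ⊆ Finset.Icc ⌈a⌉₊ ⌊b⌋₊ := fun i hi => by
    rw [Finset.mem_Icc]
    exact ⟨Nat.ceil_le.mpr (h i hi).1, Nat.le_floor (h i hi).2⟩
  have h2 := Finset.card_le_card h1
  rw [Nat.card_Icc] at h2
  have h3 := Nat.floor_le hb
  have h4 := Nat.le_ceil a
  rcases le_total ⌈a⌉₊ (⌊b⌋₊ + 1) with h5 | h5
  · have h6 : (s.card : ℝ) + ⌈a⌉₊ ≤ ⌊b⌋₊ + 1 := by exact_mod_cast (by omega)
    linarith
  · have h6 : s.card = 0 := by omega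
    rw [h6]
    push_cast
    linarith

section

variable {D : PMF (List Bool)} {m : ℕ}

theorem cyl_le (hD : ∀ y ∈ D.support, y.length = m) {y : List Bool} (hy : y.length = m) :
    ENNReal.ofReal (cyl D y) ≤ D y := by
  rw [cyl, ENNReal.ofReal_toReal (prob_ne_top _ _)]
  calc prob D (fun y' => y <+: y') ≤ prob D (fun y' => y' = y) :=
        prob_mono fun y' h' h => (h.eq_of_length (hy.trans (hD y' h').symm)).symm
    _ = D y := by
      rw [prob, ex, tsum_eq_single y]
      · simp
      · intro b hb; simp [hb]

/-- A fixed string is the quantile at a random place with about the same probability with which it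
is sampled. -/
theorem prob_quantile_le (hD : ∀ y ∈ D.support, y.length = m) (L : ℕ) (y : List Bool) :
    prob (tosses L) (fun r => Quantile D m L r y) ≤
      if y.length = m then D y + 5 * 2⁻¹ ^ L else 0 := by
  classical
  split_ifs with hy
  swap
  · simp [Quantile, hy, prob, ex]
  have h1 : prob (tosses L) (fun r => Quantile D m L r y) =
      2⁻¹ ^ L * ∑ i ∈ Finset.range (2 ^ L),
        if Near D (i / 2 ^ L) (2 / 2 ^ L) y then (1 : ℝ≥0∞) else 0 := by
    rw [← ex_tosses_val, prob]
    congr 1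
    funext r
    simp only [Quantile, hy, true_and]
  have hpos : (0 : ℝ) < 2 ^ L := by positivity
  have hb : 0 ≤ below D y := ENNReal.toReal_nonneg
  have hc : 0 ≤ cyl D y := ENNReal.toReal_nonneg
  rw [h1, Finset.sum_boole]
  have h2 := card_le_of_mem_Icc (a := 2 ^ L * below D y - 2) (b := 2 ^ L * (below D y + cyl D y) + 2)
    (s := (Finset.range (2 ^ L)).filter fun i : ℕ => Near D (i / 2 ^ L) (2 / 2 ^ L) y)
    (by positivity) (by nlinarith [mul_nonneg hpos.le hc]) fun i hi => by
      obtain ⟨e1, e2⟩ := (Finset.mem_filter.mp hi).2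
      have e3 : (i : ℝ) = 2 ^ L * (i / 2 ^ L) := by field_simp
      have e4 : (2 : ℝ) = 2 ^ L * (2 / 2 ^ L) := by field_simp
      constructor
      · have := mul_le_mul_of_nonneg_left e1 hpos.le
        linarith
      · have := mul_le_mul_of_nonneg_left e2 hpos.le
        linarith
  set s := (Finset.range (2 ^ L)).filter fun i : ℕ => Near D (i / 2 ^ L) (2 / 2 ^ L) y
  have h3 : (s.card : ℝ) ≤ 2 ^ L * cyl D y + 5 := by linarith
  have h4 : (s.card : ℝ≥0∞) ≤ 2 ^ L * ENNReal.ofReal (cyl D y) + 5 := by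
    rw [← ENNReal.ofReal_natCast]
    refine (ENNReal.ofReal_le_ofReal h3).trans_eq ?_
    rw [ENNReal.ofReal_add (by positivity) (by norm_num), ENNReal.ofReal_mul (by positivity),
      ENNReal.ofReal_pow (by norm_num)]
    simp
  calc _ ≤ 2⁻¹ ^ L * (2 ^ L * ENNReal.ofReal (cyl D y) + 5) := by gcongr
    _ = ENNReal.ofReal (cyl D y) + 5 * 2⁻¹ ^ L := by
      rw [mul_add, ← mul_assoc, ← mul_pow, ENNReal.inv_mul_cancel (by simp) (by simp), one_pow, one_mul,
        mul_comm (5 : ℝ≥0∞)]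
    _ ≤ _ := by gcongr; exact cyl_le hD hy

theorem tsum_length_eq (m : ℕ) (c : ℝ≥0∞) :
    (∑' y : List Bool, if y.length = m then c else 0) = 2 ^ m * c := by
  have h := tsum_subtype {y : List Bool | y.length = m} fun _ => c
  have h1 : (∑' y : List Bool, if y.length = m then c else 0) =
      ∑' y, Set.indicator {y : List Bool | y.length = m} (fun _ => c) y :=
    tsum_congr fun y => by simp [Set.indicator_apply]
  rw [h1, ← h]
  change (∑' _ : List.Vector Bool m, c) = _
  rw [tsum_fintype, Finset.sum_const, Finset.card_univ, card_vector, nsmul_eq_mul]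
  simp

/-- The expectation of the sum of `g` over the quantiles at a random place. -/
theorem ex_tosses_tsum_le (hD : ∀ y ∈ D.support, y.length = m) {L : ℕ} {g : List Bool → ℝ≥0∞}
    {c : ℝ≥0∞} (hg : ∀ y, g y ≤ c) :
    (open scoped Classical in ex (tosses L) fun r => ∑' y, if Quantile D m L r y then g y else 0) ≤
      ex D g + 5 * 2⁻¹ ^ L * (2 ^ m * c) := by
  classical
  rw [ex_tsum]
  calc _ = ∑' y, prob (tosses L) (fun r => Quantile D m L r y) * g y := by
        refine tsum_congr fun y => ?_
        rw [prob, ← ex_mul_right]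
        congr 1
        funext r
        split_ifs <;> simp
    _ ≤ ∑' y, (D y * g y + 5 * 2⁻¹ ^ L * (if y.length = m then c else 0)) := by
        refine ENNReal.tsum_le_tsum fun y => ?_
        refine (mul_le_mul_left (prob_quantile_le hD L y) _).trans ?_
        split_ifs
        · rw [add_mul]; gcongr; exact hg y
        · simp
    _ = _ := by rw [ENNReal.tsum_add, ENNReal.tsum_mul_left, tsum_length_eq]; rfl

/-! ### Blocks of a string -/

/-- The first `N` blocks of length `m` of a string. -/
def blocks (m : ℕ) : ℕ → List Bool → List (List Bool)
  | 0, _ => []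
  | N + 1, Y => fit m Y :: blocks m N (Y.drop m)

theorem length_blocks (m N : ℕ) (Y : List Bool) : (blocks m N Y).length = N := by
  induction N generalizing Y with
  | zero => rfl
  | succ N ih => simp [blocks, ih]

theorem sum_blocks (m N : ℕ) (f : List Bool → ℝ≥0∞) (Y : List Bool) :
    ((blocks m N Y).map f).sum = ∑ i ∈ Finset.range N, f (fit m (Y.drop (i * m))) := by
  induction N generalizing Y with
  | zero => simp [blocks]
  | succ N ih =>
    rw [blocks, List.map_cons, List.sum_cons, ih, Finset.sum_range_succ', add_comm]
    congr 1
    · refine Finset.sum_congr rfl fun i _ => ?_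
      rw [List.drop_drop, add_mul, one_mul, add_comm]
    · simp

theorem blocks_flatten_append {ys : List (List Bool)} (h : ∀ y ∈ ys, y.length = m) (w : List Bool) :
    blocks m ys.length (ys.flatten ++ w) = ys := by
  induction ys with
  | nil => rfl
  | cons y ys ih =>
    have hy : y.length = m := h y (by simp)
    rw [List.length_cons, blocks, List.flatten_cons, List.append_assoc, fit_append_eq _ _ _ hy,
      List.drop_left' hy, ih fun y h' => h y (by simp [h'])]

theorem blocks_fit_flatten {ys : List (List Bool)} (h : ∀ y ∈ ys, y.length = m) {n : ℕ}
    (hn : ys.length * m ≤ n) : blocks m ys.length (fit n ys.flatten) = ys := by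
  have hl : ys.flatten.length = ys.length * m := by
    clear hn
    induction ys with
    | nil => simp
    | cons y ys ih =>
      rw [List.flatten_cons, List.length_append, ih fun y h' => h y (by simp [h']), h y (by simp),
        List.length_cons]
      ring
  have e : fit n ys.flatten = ys.flatten ++ List.replicate (n - ys.flatten.length) false := by
    rw [fit, List.take_append, List.take_of_length_le (by omega), List.take_replicate,
      min_eq_left (by omega)]
  rw [e, blocks_flatten_append h]

/-- The expectation of a product of independent factors. -/
theorem ex_seqP_prod {α β : Type*} (f : α → PMF β) (g : β → ℝ≥0∞) (rs : List α) :
    (ex (seqP f rs) fun ys => (ys.map g).prod) = (rs.map fun r => ex (f r) g).prod := by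
  induction rs with
  | nil => simp [seqP, ex_pure]
  | cons r rs ih =>
    rw [seqP, ex_bind, List.map_cons, List.prod_cons, ← ih, ← ex_mul_right]
    congr 1
    funext y
    rw [ex_map, ← ex_mul_left]
    simp [Function.comp_def]

theorem ex_randomStrings_prod_le (L N : ℕ) (h : List Bool → ℝ≥0∞) :
    (ex (randomStrings L N) fun rs => (rs.map h).prod) ≤ ex (tosses L) h ^ N := by
  have := ex_kfold_le (f := fun (_ : Bool) rs => (tosses L).map (· :: rs))
    (Φ := fun rs => (rs.map h).prod) (c := ex (tosses L) h) (fun b rs => by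
      rw [ex_map, ← ex_mul_right]
      simp [Function.comp_def]) (List.replicate N false) []
  rw [randomStrings]
  simpa using this

end

/-! ### Accuracy of the sampling algorithm -/

section

variable {D : PMF (List Bool)} {m : ℕ} {π : ℝ} {E : List Bool → Prop} {r : ℝ}

open scoped Classical in
/-- The exponential of `r` times the deviation of the indicator function of `E` from its mean `π`.
-/
def weight (E : List Bool → Prop) (π r : ℝ) (y : List Bool) : ℝ≥0∞ :=
  ENNReal.ofReal (Real.exp (r * ((if E y then 1 else 0) - π)))

open scoped Classical in
/-- The number of elements of a list for which `E` holds. -/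
def count (E : List Bool → Prop) (ys : List (List Bool)) : ℝ≥0∞ :=
  (ys.map fun y => if E y then 1 else 0).sum

/-- The exponential moment of a deviation from the mean, for one sample from `D`. -/
theorem ex_weight_le (hπ : π = (prob D E).toReal) (h0 : 0 ≤ r) (h1 : r ≤ 1) :
    ex D (weight E π r) ≤ ENNReal.ofReal (Real.exp (r ^ 2)) := by
  classical
  have hp1 : π ≤ 1 := by
    rw [hπ]
    exact ENNReal.toReal_le_of_le_ofReal zero_le_one (by simpa using prob_le_one _ _)
  have hp0 : 0 ≤ π := hπ ▸ ENNReal.toReal_nonneg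
  have e : (weight E π r) = fun y => ENNReal.ofReal
      (if E y then Real.exp (-(π * r)) * Real.exp r else Real.exp (-(π * r))) := by
    funext y
    rw [weight]
    congr 1
    split_ifs
    · rw [← Real.exp_add]; congr 1; ring
    · congr 1; ring
  rw [e, ex_ite _ _ (by positivity) (by positivity), ← hπ]
  refine ENNReal.ofReal_le_ofReal ?_
  have h2 := bernoulli_exp_le hp0 hp1 (x := r) (by rwa [abs_of_nonneg h0])
  calc _ = Real.exp (-(π * r)) * (π * Real.exp r + (1 - π)) := by ring
    _ ≤ Real.exp (-(π * r)) * Real.exp (π * r + r ^ 2) := by gcongr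
    _ = _ := by rw [← Real.exp_add]; congr 1; ring

theorem weight_le (hπ : 0 ≤ π) (h0 : 0 ≤ r) (h1 : r ≤ 1) (y : List Bool) : weight E π r y ≤ 3 := by
  classical
  rw [weight]
  have : Real.exp (r * ((if E y then 1 else 0) - π)) ≤ 3 := by
    refine le_trans (Real.exp_le_exp.mpr (?_ : _ ≤ (1 : ℝ))) (Real.exp_one_lt_d9.le.trans (by norm_num))
    split_ifs <;> nlinarith
  exact (ENNReal.ofReal_le_ofReal this).trans (by simp)

/-- The inequality `u ≤ c + exp (u - c)`, where `u` is `r` times the deviation of the number of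
elements with the property `E` from its mean. -/
theorem count_le {c : ℝ} (hπ : 0 ≤ π) (hr : 0 < r) (hc : 0 ≤ c) {N : ℕ} (hN : 0 < N)
    {ys : List (List Bool)} (hys : ys.length = N) :
    (N : ℝ≥0∞)⁻¹ * count E ys ≤ ENNReal.ofReal (π + c / (N * r)) +
      ENNReal.ofReal (Real.exp (-c) / (N * r)) * (ys.map (weight E π r)).prod := by
  classical
  have key : ∀ ys : List (List Bool), ∃ s : ℝ, 0 ≤ s ∧ count E ys = ENNReal.ofReal s ∧
      (ys.map (weight E π r)).prod = ENNReal.ofReal (Real.exp (r * (s - ys.length * π))) := by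
    intro ys
    induction ys with
    | nil => exact ⟨0, le_rfl, by simp [count], by simp⟩
    | cons y ys ih =>
      obtain ⟨s, h0, h1, h2⟩ := ih
      refine ⟨(if E y then 1 else 0) + s, by positivity, ?_, ?_⟩
      · rw [count, List.map_cons, List.sum_cons, ENNReal.ofReal_add (by positivity) h0, ← h1, count]
        split_ifs <;> simp
      · rw [List.map_cons, List.prod_cons, h2, weight, ← ENNReal.ofReal_mul (by positivity),
          ← Real.exp_add, List.length_cons]
        congr 2
        push_cast
        ring
  obtain ⟨s, h0, h1, h2⟩ := key ys
  have hNr : (0 : ℝ) < N := by exact_mod_cast hN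
  rw [h1, h2, hys, ← ENNReal.ofReal_natCast, ← ENNReal.ofReal_inv_of_pos hNr,
    ← ENNReal.ofReal_mul (by positivity), ← ENNReal.ofReal_mul (by positivity),
    ← ENNReal.ofReal_add (by positivity) (by positivity)]
  refine ENNReal.ofReal_le_ofReal ?_
  have h3 := Real.add_one_le_exp (r * (s - N * π) - c)
  have h4 : Real.exp (-c) / (N * r) * Real.exp (r * (s - N * π)) =
      Real.exp (r * (s - N * π) - c) / (N * r) := by
    rw [div_mul_eq_mul_div, ← Real.exp_add]; congr 2; ring
  rw [h4]
  have h5 : π + c / (N * r) + Real.exp (r * (s - N * π) - c) / (N * r) =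
      (π * (N * r) + c + Real.exp (r * (s - N * π) - c)) / (N * r) := by field_simp
  rw [h5, le_div_iff₀ (by positivity)]
  have h6 : (N : ℝ)⁻¹ * s * (N * r) = s * r := by field_simp
  rw [h6]
  nlinarith

theorem count_le_length (ys : List (List Bool)) : count E ys ≤ ys.length := by
  induction ys with
  | nil => simp [count]
  | cons y ys ih =>
    rw [count] at ih ⊢
    rw [List.map_cons, List.sum_cons, List.length_cons, add_comm]
    push_cast
    gcongr
    split_ifs <;> simp

/-- If the concatenation of `ys` consists of quantiles at the places `rs`, the product of the
weights is at most the product of the sums of the weights over all quantiles at these places. -/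
theorem prod_weight_le {C : List Bool → List Bool → Prop} {g : List Bool → ℝ≥0∞}
    {rs ys : List (List Bool)} (h : List.Forall₂ C rs ys) :
    (ys.map g).prod ≤
      (open scoped Classical in (rs.map fun r => ∑' y, if C r y then g y else 0).prod) := by
  classical
  induction h with
  | nil => simp
  | @cons r y rs ys h _ ih =>
    rw [List.map_cons, List.prod_cons, List.map_cons, List.prod_cons]
    gcongr
    refine le_trans ?_ (ENNReal.le_tsum y)
    rw [if_pos h]

end

theorem of_searchInput {x : List Bool} {m L N : ℕ} {rs : List (List Bool)} (hN : 0 < N)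
    (h : rs.length = N) (hr : ∀ r ∈ rs, r.length = L) :
    inputOf (searchInput x m rs) = x ∧ lengthOf (searchInput x m rs) = m ∧
      stringsOf (searchInput x m rs) = rs ∧ precisionOf (searchInput x m rs) = L := by
  have h1 : inputOf (searchInput x m rs) = x := by rw [inputOf, searchInput, field_enc]
  have h2 : lengthOf (searchInput x m rs) = m := by
    rw [lengthOf, searchInput, field_enc, field_enc, List.length_replicate]
  have h3 : stringsOf (searchInput x m rs) = rs := by
    rw [stringsOf, searchInput, field_enc, field_enc, fields_flatMap_enc]
  refine ⟨h1, h2, h3, ?_⟩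
  rw [precisionOf, h3]
  cases rs with
  | nil => simp at h; omega
  | cons r rs => exact hr r (by simp)

/-- The frequency of `E` among the blocks of the output of the `ν`-th program, for a fixed choice of
the random strings. In the bound for the exponential moment, the term with `2 ^ (L + ν + 2)` is due
to the solutions that have small weight under the universal mixture, and the product over `rs` is
due to the lists of quantiles; `δ` bounds the probability that the output is not a solution. -/
theorem ex_count_le {p : Polynomial ℕ} {D : List Bool → PMF (List Bool)} {x : List Bool}
    {m L N ν : ℕ} {rs : List (List Bool)} {E : List Bool → Prop} {π r c : ℝ} {δ : ℝ≥0∞}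
    (hD : ∀ x, ∀ y ∈ (D x).support, y.length = p.eval x.length)
    (hm : m = p.eval x.length) (hmL : m ≤ L) (hN : 0 < N)
    (h : rs.length = N) (hrs : ∀ r ∈ rs, r.length = L)
    (hsol : prob (clockedOutput A ν (searchInput x m rs))
      (fun Y => ¬ Solution A p D (searchInput x m rs) Y) ≤ δ)
    (hπ : π = (prob (D x) E).toReal) (hr0 : 0 < r) (hr1 : r ≤ 1) (hc : 0 ≤ c) :
    (ex (clockedOutput A ν (searchInput x m rs)) fun Y => (N : ℝ≥0∞)⁻¹ * count E (blocks m N Y)) ≤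
      ENNReal.ofReal (π + c / (N * r)) + ENNReal.ofReal (Real.exp (-c) / (N * r)) *
        (2 ^ (L + ν + 2) * ENNReal.ofReal (Real.exp (r ^ 2)) ^ N +
          (open scoped Classical in
            (rs.map fun r' => ∑' y, if Quantile (D x) m L r' y then weight E π r y else 0).prod)) +
        δ := by
  classical
  set z := searchInput x m rs with hz
  obtain ⟨z1, z2, z3, z4⟩ := of_searchInput (x := x) (m := m) hN h hrs
  rw [← hz] at z1 z2 z3 z4
  have hzl : N * m ≤ z.length := by
    rw [hz, length_searchInput h hrs]
    have : N * m ≤ N * (2 * L + 1) := Nat.mul_le_mul_left _ (by omega)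
    omega
  have hW : WellFormed p z := ⟨by rw [z1, z2, hm], by rw [z3, z4]; exact hrs⟩
  have hπ0 : 0 ≤ π := hπ ▸ ENNReal.toReal_nonneg
  set Q := clockedOutput A ν z with hQ
  set G : List Bool → ℝ≥0∞ := fun Y => ((blocks m N Y).map (weight E π r)).prod with hG
  set H : ℝ≥0∞ := (rs.map fun r' => ∑' y, if Quantile (D x) m L r' y then weight E π r y else 0).prod
    with hH
  set κ := ENNReal.ofReal (Real.exp (-c) / (N * r)) with hκ
  set a := ENNReal.ofReal (π + c / (N * r)) with ha
  set Low : List Bool → Prop := fun Y => universal A z Y ≤ 2 ^ (L + 1) * samplesDist D z Y with hLow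
  have hlow : (ex Q fun Y => if Low Y then G Y else 0) ≤
      2 ^ (L + ν + 2) * ENNReal.ofReal (Real.exp (r ^ 2)) ^ N := by
    have h1 : ∀ Y, Q Y ≤ 2 ^ (ν + 1) * universal A z Y := by
      intro Y
      have : 2⁻¹ ^ (ν + 1) * Q Y ≤ universal A z Y := ENNReal.le_tsum ν
      calc Q Y = 2 ^ (ν + 1) * (2⁻¹ ^ (ν + 1) * Q Y) := by
            rw [← mul_assoc, ← mul_pow, ENNReal.mul_inv_cancel (by simp) (by simp), one_pow, one_mul]
        _ ≤ _ := by gcongr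
    have h2 : ex (samplesDist D z) G ≤ ENNReal.ofReal (Real.exp (r ^ 2)) ^ N := by
      rw [samplesDist, ex_map, z1, z3]
      calc _ ≤ ex (seqP (fun _ => D x) rs) fun ys => (ys.map (weight E π r)).prod := by
            refine ex_mono_support fun ys hys => ?_
            have hf := mem_support_seqP (C := fun _ y => y.length = m)
              (fun _ y hy => (hD x y hy).trans hm.symm) rs ys hys
            have hl : ys.length = N := hf.length_eq.symm.trans h
            have hm' : ∀ y ∈ ys, y.length = m := fun y hy => by
              obtain ⟨i, hi, rfl⟩ := List.mem_iff_getElem.mp hy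
              exact hf.get (by omega) hi
            simp only [Function.comp_apply, hG]
            rw [← hl, blocks_fit_flatten hm' (by rw [hl]; exact hzl)]
        _ = ex (D x) (weight E π r) ^ N := by
            rw [ex_seqP_prod, List.map_const', List.prod_replicate, h]
        _ ≤ _ := by gcongr; exact ex_weight_le hπ hr0.le hr1
    calc _ ≤ ∑' Y, 2 ^ (L + ν + 2) * (samplesDist D z Y * G Y) := by
          refine ENNReal.tsum_le_tsum fun Y => ?_
          by_cases hY : Low Y
          · simp only [hY, if_true]
            calc Q Y * G Y ≤ 2 ^ (ν + 1) * (2 ^ (L + 1) * samplesDist D z Y) * G Y := by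
                  gcongr; exact (h1 Y).trans (by gcongr)
              _ = _ := by ring
          · simp [hY]
      _ = 2 ^ (L + ν + 2) * ex (samplesDist D z) G := by rw [ENNReal.tsum_mul_left, ex]
      _ ≤ _ := by gcongr
  have hpt : ∀ Y, (N : ℝ≥0∞)⁻¹ * count E (blocks m N Y) ≤
      a + κ * ((if Low Y then G Y else 0) + H) + if ¬ Solution A p D z Y then 1 else 0 := by
    intro Y
    by_cases hY : Solution A p D z Y
    swap
    · rw [if_pos hY]
      refine le_trans ?_ le_add_self
      calc (N : ℝ≥0∞)⁻¹ * count E (blocks m N Y) ≤ (N : ℝ≥0∞)⁻¹ * N := by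
            gcongr; exact (count_le_length _).trans_eq (by rw [length_blocks])
        _ = 1 := ENNReal.inv_mul_cancel (by simpa using hN.ne') (by simp)
    refine le_add_right ((count_le hπ0 hr0 hc hN (length_blocks m N Y)).trans ?_)
    gcongr
    rcases hY.2 hW with hl | ⟨ys, rfl, hq⟩
    · rw [z4] at hl
      rw [if_pos (show Low Y from hl)]
      exact le_self_add
    · refine le_add_left ?_
      rw [z1, z2, z3, z4] at hq
      have hl : ys.length = N := hq.length_eq.symm.trans h
      have hm' : ∀ y ∈ ys, y.length = m := fun y hy => by
        obtain ⟨i, hi, rfl⟩ := List.mem_iff_getElem.mp hy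
        exact (hq.get (by omega) hi).1
      have hb := blocks_fit_flatten hm' (n := z.length) (by rw [hl]; exact hzl)
      rw [hl] at hb
      rw [hb]
      exact prod_weight_le hq
  calc _ ≤ ex Q fun Y => a + κ * ((if Low Y then G Y else 0) + H) +
        if ¬ Solution A p D z Y then 1 else 0 := ex_mono hpt
    _ = a + κ * ((ex Q fun Y => if Low Y then G Y else 0) + H) +
        prob Q fun Y => ¬ Solution A p D z Y := by
      rw [ex_add, ex_add, ex_const, ex_mul_left, ex_add, ex_const, prob]
      congr!
    _ ≤ _ := by gcongr

/-- The choice of `c` in `prob_extract_le`: the left hand side bounds the two exponential moments,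
and is at most `exp c`. -/
theorem two_pow_add_exp_le (n : ℕ) {u : ℝ} (hu : 0 ≤ u) :
    2 ^ n * Real.exp u + Real.exp (2 * u) ≤ Real.exp (n + 1 + 2 * u) := by
  have h2 : (2 : ℝ) ≤ Real.exp 1 := by have := Real.add_one_le_exp (1 : ℝ); linarith
  have h3 : (2 : ℝ) ^ n ≤ Real.exp n := by
    rw [← mul_one (n : ℝ), Real.exp_nat_mul]
    gcongr
  have h4 : Real.exp u ≤ Real.exp (2 * u) := Real.exp_le_exp.mpr (by linarith)
  have h5 : (1 : ℝ) ≤ Real.exp n := Real.one_le_exp (by positivity)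
  have h6 := Real.exp_pos (2 * u)
  calc 2 ^ n * Real.exp u + Real.exp (2 * u)
      ≤ Real.exp n * Real.exp (2 * u) + Real.exp n * Real.exp (2 * u) := by
        gcongr
        nlinarith
    _ = Real.exp n * 2 * Real.exp (2 * u) := by ring
    _ ≤ Real.exp n * Real.exp 1 * Real.exp (2 * u) := by gcongr
    _ = _ := by rw [← Real.exp_add, ← Real.exp_add]

/-- The choice `L = m + 2k + 10`: summed over all `2^m` strings, the error of `prob_quantile_le` at
most doubles the exponent of the exponential moment. -/
theorem exp_sq_add_le {k m L : ℕ} (hk : 0 < k) (hL : L = m + 2 * k + 10) :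
    Real.exp ((1 / (8 * k : ℝ)) ^ 2) + 5 * 2⁻¹ ^ L * (2 ^ m * 3) ≤
      Real.exp (2 * (1 / (8 * k : ℝ)) ^ 2) := by
  have hkr : (0 : ℝ) < k := by exact_mod_cast hk
  set s := (1 / (8 * k : ℝ)) ^ 2 with hs
  have h1 : 5 * 2⁻¹ ^ L * (2 ^ m * 3) ≤ s := by
    have e : (5 : ℝ) * 2⁻¹ ^ L * (2 ^ m * 3) = 15 / (1024 * (2 ^ k) ^ 2) := by
      rw [hL, pow_add, pow_add, inv_pow, inv_pow, inv_pow, ← pow_mul, mul_comm k 2]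
      field_simp
      norm_num
    have h2 : (k : ℝ) ≤ 2 ^ k := by exact_mod_cast Nat.lt_two_pow_self.le
    have h3 : (k : ℝ) ^ 2 ≤ (2 ^ k) ^ 2 := by gcongr
    rw [e, hs, div_pow, div_le_div_iff₀ (by positivity) (by positivity)]
    nlinarith
  have h2 := Real.add_one_le_exp s
  have h3 : Real.exp (2 * s) = Real.exp s * Real.exp s := by rw [← Real.exp_add]; congr 1; ring
  have h4 : 1 ≤ Real.exp s := Real.one_le_exp (by positivity)
  rw [h3]
  nlinarith [sq_nonneg (1 / (8 * k : ℝ))]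

/-- The parameters of the algorithm are such that the sum of all errors is at most `1 / k`. -/
theorem sum_errors_le {k L N a : ℕ} (hk : 0 < k) (hkL : k ≤ L) (hN : 32 * L ^ 2 * a ≤ N) (ha : 0 < a) :
    (a + 2 * (N * (1 / (8 * k : ℝ)) ^ 2)) / (N * (1 / (8 * k : ℝ))) + 1 / N ≤ 1 / k := by
  have hkr : (1 : ℝ) ≤ k := by exact_mod_cast hk
  have har : (1 : ℝ) ≤ a := by exact_mod_cast ha
  have hkLr : (k : ℝ) ≤ L := by exact_mod_cast hkL
  have hNr : 32 * (L : ℝ) ^ 2 * a ≤ N := by exact_mod_cast hN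
  have h1 : 32 * (k : ℝ) ^ 2 * a ≤ N := le_trans (by gcongr) hNr
  have hN0 : (0 : ℝ) < N := lt_of_lt_of_le (by positivity) h1
  have e : (a + 2 * (N * (1 / (8 * k : ℝ)) ^ 2)) / (N * (1 / (8 * k : ℝ))) + 1 / N =
      (8 * k * a + 1) / N + 1 / (4 * k) := by
    field_simp
    ring
  have h2 : (8 * k * a + 1) / (N : ℝ) ≤ 1 / (2 * k) := by
    rw [div_le_div_iff₀ hN0 (by positivity)]
    nlinarith [mul_le_mul hkr har zero_le_one (by linarith)]
  have h3 : 1 / (2 * (k : ℝ)) + 1 / (4 * k) ≤ 1 / k := by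
    rw [div_add_div _ _ (by positivity) (by positivity), div_le_div_iff₀ (by positivity) (by positivity)]
    nlinarith [pow_pos (by linarith : (0 : ℝ) < k) 2]
  rw [e]
  linarith

/-- No event is by more than `1 / k` more likely for the output of the sampling algorithm than under
`D x`. -/
theorem prob_extract_le {p : Polynomial ℕ} {D : List Bool → PMF (List Bool)} {x : List Bool}
    {k m L ν j : ℕ} (hD : ∀ x, ∀ y ∈ (D x).support, y.length = p.eval x.length)
    (hm : m = p.eval x.length) (hk : 0 < k) (hL : L = m + 2 * k + 10)
    (hj : 32 * L ^ 2 * (L + ν + 4) ≤ 2 ^ j)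
    (hsol : ∀ rs ∈ (randomStrings L (2 ^ j)).support,
      prob (clockedOutput A ν (searchInput x m rs)) (fun Y => ¬ Solution A p D (searchInput x m rs) Y) ≤
        ENNReal.ofReal (1 / (2 ^ j : ℕ)))
    (E : List Bool → Prop) :
    prob ((drawIndex 1 j 0).bind fun i => (randomStrings L (2 ^ j)).bind fun rs =>
      (clockedOutput A ν (searchInput x m rs)).map fun Y => fit m (Y.drop (i * m))) E ≤
      prob (D x) E + ENNReal.ofReal (1 / k) := by
  classical
  set N := 2 ^ j with hN
  set π := (prob (D x) E).toReal with hπ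
  set r : ℝ := 1 / (8 * k) with hr
  -- the exponential moments are at most `exp c`, and this makes the last term of `count_le` harmless
  set c : ℝ := L + ν + 3 + 2 * (N * r ^ 2) with hc
  have hN0 : 0 < N := by positivity
  have hNr : (0 : ℝ) < N := by exact_mod_cast hN0
  have hkr : (1 : ℝ) ≤ k := by exact_mod_cast hk
  have hr0 : 0 < r := by positivity
  have hr1 : r ≤ 1 := by rw [hr, div_le_one (by positivity)]; linarith
  have hc0 : 0 ≤ c := by positivity
  have hπ0 : 0 ≤ π := ENNReal.toReal_nonneg
  -- averaging over the index first turns the probability into the expected frequency of `E`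
  have h1 : prob ((drawIndex 1 j 0).bind fun i => (randomStrings L N).bind fun rs =>
      (clockedOutput A ν (searchInput x m rs)).map fun Y => fit m (Y.drop (i * m))) E =
      ex (randomStrings L N) fun rs => ex (clockedOutput A ν (searchInput x m rs)) fun Y =>
        (N : ℝ≥0∞)⁻¹ * count E (blocks m N Y) := by
    simp only [prob, ex_bind, ex_map]
    rw [ex_comm]
    congr 1
    funext rs
    rw [ex_comm]
    congr 1
    funext Y
    rw [ex_drawIndex, count, sum_blocks]
    simp only [Function.comp_apply, zero_add, one_mul, hN]
    congr 1
    push_cast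
    rw [ENNReal.inv_pow]
  set h : List Bool → ℝ≥0∞ := fun r' =>
    ∑' y, if Quantile (D x) m L r' y then weight E π r y else 0 with hh
  have h2 : ex (tosses L) h ≤ ENNReal.ofReal (Real.exp (2 * r ^ 2)) := by
    refine (ex_tosses_tsum_le (fun y hy => (hD x y hy).trans hm.symm)
      (weight_le (E := E) hπ0 hr0.le hr1)).trans ?_
    refine (add_le_add_left (ex_weight_le hπ hr0.le hr1) _).trans ?_
    refine le_trans (le_of_eq ?_) (ENNReal.ofReal_le_ofReal (exp_sq_add_le hk hL))
    rw [ENNReal.ofReal_add (by positivity) (by positivity), ENNReal.ofReal_mul (by positivity),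
      ENNReal.ofReal_mul (by positivity), ENNReal.ofReal_mul (by positivity),
      ENNReal.ofReal_pow (by positivity), ENNReal.ofReal_pow (by positivity),
      ENNReal.ofReal_inv_of_pos (by positivity), ← hr]
    simp
  have h3 : 2 ^ (L + ν + 2) * ENNReal.ofReal (Real.exp (r ^ 2)) ^ N +
      ENNReal.ofReal (Real.exp (2 * r ^ 2)) ^ N ≤ ENNReal.ofReal (Real.exp c) := by
    have e := two_pow_add_exp_le (L + ν + 2) (u := N * r ^ 2) (by positivity)
    have e1 : ((L + ν + 2 : ℕ) : ℝ) + 1 + 2 * (N * r ^ 2) = c := by rw [hc]; push_cast; ring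
    rw [e1] at e
    refine le_trans (le_of_eq ?_) (ENNReal.ofReal_le_ofReal e)
    rw [ENNReal.ofReal_add (by positivity) (by positivity), ENNReal.ofReal_mul (by positivity),
      ENNReal.ofReal_pow (by positivity), ← ENNReal.ofReal_pow (by positivity),
      ← ENNReal.ofReal_pow (by positivity), ← Real.exp_nat_mul, ← Real.exp_nat_mul]
    congr 2
    · simp
    · congr 1; ring
  rw [h1]
  calc _ ≤ ex (randomStrings L N) fun rs => ENNReal.ofReal (π + c / (N * r)) +
        ENNReal.ofReal (Real.exp (-c) / (N * r)) *
        (2 ^ (L + ν + 2) * ENNReal.ofReal (Real.exp (r ^ 2)) ^ N + (rs.map h).prod) +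
        ENNReal.ofReal (1 / N) := ex_mono_support fun rs hrs => by
          obtain ⟨r1, r2⟩ := of_mem_randomStrings hrs
          exact ex_count_le hD hm (by omega) hN0 r1 r2 (hsol rs hrs) hπ hr0 hr1 hc0
    _ = ENNReal.ofReal (π + c / (N * r)) + ENNReal.ofReal (Real.exp (-c) / (N * r)) *
        (2 ^ (L + ν + 2) * ENNReal.ofReal (Real.exp (r ^ 2)) ^ N +
          ex (randomStrings L N) fun rs => (rs.map h).prod) + ENNReal.ofReal (1 / N) := by
      rw [ex_add, ex_const, ex_add, ex_const, ex_mul_left, ex_add, ex_const]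
    _ ≤ ENNReal.ofReal (π + c / (N * r)) + ENNReal.ofReal (Real.exp (-c) / (N * r)) *
        ENNReal.ofReal (Real.exp c) + ENNReal.ofReal (1 / N) := by
      gcongr
      refine le_trans ?_ h3
      gcongr
      exact (ex_randomStrings_prod_le L N h).trans (by gcongr)
    _ = ENNReal.ofReal (π + ((c + 1) / (N * r) + 1 / N)) := by
      rw [← ENNReal.ofReal_mul (by positivity), ← ENNReal.ofReal_add (by positivity) (by positivity),
        ← ENNReal.ofReal_add (by positivity) (by positivity)]
      congr 1
      rw [div_mul_eq_mul_div, ← Real.exp_add, neg_add_cancel, Real.exp_zero]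
      ring
    _ ≤ ENNReal.ofReal (π + 1 / k) := by
      refine ENNReal.ofReal_le_ofReal ?_
      have e := sum_errors_le (a := L + ν + 4) hk (by omega : k ≤ L) hj (by omega)
      have e1 : ((L + ν + 4 : ℕ) : ℝ) + 2 * (N * r ^ 2) = c + 1 := by rw [hc]; push_cast; ring
      rw [← hr, e1] at e
      linarith
    _ = _ := by
      rw [ENNReal.ofReal_add hπ0 (by positivity), hπ, ENNReal.ofReal_toReal (prob_ne_top _ _)]

/-- A classical algorithm for the search problem of a sampling problem yields a classical sampling
algorithm. -/
theorem SampPRel_eq_of_FBPPRel_eq (h : FBPPRel A = FBQPRel A) : SampPRel A = SampBQPRel A := by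
  refine (SampPRel_subset A).antisymm fun S hS => ?_
  obtain ⟨p, hp⟩ := S.exists_length
  obtain ⟨R, hR, hsol⟩ := exists_searchProblem hS hp
  rw [← h] at hR
  obtain ⟨C, hC, TC, hRC⟩ := hR
  -- the number of the clocked program `C` is a constant on which the sampling algorithm may depend
  obtain ⟨ν, hν⟩ := clocked_surjective (C, TC)
  set pp : Polynomial ℕ := 32 * Polynomial.X ^ 2 * (Polynomial.X + Polynomial.C (ν + 4)) with hpp
  obtain ⟨PM, TM, cM, hPM⟩ := exists_polyProg p 11 3 8 10 (by simp) (by simp)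
    (by simp) (by simp) (by simp) (by simp)
  obtain ⟨PL, TL, cL, hPL⟩ := exists_polyProg (Polynomial.X + 10) 11 4 8 10 (by simp) (by simp)
    (by simp) (by simp) (by simp) (by simp)
  obtain ⟨PP, TP, cP, hPP⟩ := exists_polyProg pp 11 5 8 10 (by simp) (by simp)
    (by simp) (by simp) (by simp) (by simp)
  set Lp : Polynomial ℕ := p + 2 * Polynomial.X + 10 with hLp
  set Mp : Polynomial ℕ := Lp + pp.comp Lp + Polynomial.X + 1 with hMp
  set Tc : Polynomial ℕ := TC.comp (2 * (4 * Mp + 2 + 2 * Mp * (2 * Mp + 1))) with hTc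
  set T : Polynomial ℕ := TM + TL.comp Lp + TP.comp Lp + Tc + 1000 * (Mp + 1) ^ 2 with hT
  refine ⟨extractProg PM PL PP C, .extractProg cM cL cP hC, T, fun x k hk => ?_⟩
  set n := x.length + k with hn
  set m := p.eval x.length with hm
  set L := m + 2 * k + 10 with hL
  set M := Mp.eval n with hM
  have hmn : m ≤ p.eval n := eval_mono p (by omega)
  have eL : Lp.eval n = p.eval n + 2 * n + 10 := by simp [hLp]
  have hLL : L ≤ Lp.eval n := by omega
  have eM : M = Lp.eval n + pp.eval (Lp.eval n) + n + 1 := by simp [hM, hMp]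
  have hppL := eval_mono pp hLL
  have hlen : ∀ rs : List (List Bool), rs.length ≤ 2 * M → (∀ r ∈ rs, r.length = L) →
      (searchInput x m rs).length ≤ 4 * M + 2 + 2 * M * (2 * M + 1) := by
    intro rs h1 h2
    rw [length_searchInput rfl h2]
    have : rs.length * (2 * L + 1) ≤ 2 * M * (2 * M + 1) := Nat.mul_le_mul h1 (by omega)
    omega
  have hpos : ∀ rs : List (List Bool), 0 < (searchInput x m rs).length := fun rs => by
    simp [searchInput, length_enc]
  have hle : ∀ rs : List (List Bool), rs.length ≤ 2 * M → (∀ r ∈ rs, r.length = L) →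
      TC.eval ((searchInput x m rs).length + (searchInput x m rs).length) ≤ Tc.eval n := by
    intro rs h1 h2
    have e : Tc.eval n = TC.eval (2 * (4 * M + 2 + 2 * M * (2 * M + 1))) := by simp [hTc, hM]
    rw [e]
    exact eval_mono TC (by have := hlen rs h1 h2; omega)
  have hH : ∀ rs : List (List Bool), rs.length ≤ 2 * M → (∀ r ∈ rs, r.length = L) →
      HaltsWithin A C (searchInput x m rs) (searchInput x m rs).length (Tc.eval n) :=
    fun rs h1 h2 => (hRC (searchInput x m rs) _ (hpos rs)).1.mono (hle rs h1 h2)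
  obtain ⟨j, μ, j1, j2, h1, h2⟩ := exec_extractProg (M := M) hPM hPL hPP hm hL (by omega) (by omega)
    (by omega) hH
  have h3 := h1.mono (t' := T.eval n) (by
    have e1 := eval_mono TM (show x.length ≤ n by omega)
    have e2 := eval_mono TL (show m + 2 * k ≤ Lp.eval n by omega)
    have e3 := eval_mono TP hLL
    simp only [hT, Polynomial.eval_add, Polynomial.eval_comp, Polynomial.eval_mul,
      Polynomial.eval_pow, Polynomial.eval_one, Polynomial.eval_ofNat, ← hM]
    omega)
  refine ⟨haltsWithin_of_exec h3, ?_⟩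
  have e : ∀ rs ∈ (randomStrings L (2 ^ j)).support,
      output A C (searchInput x m rs) (searchInput x m rs).length (Tc.eval n) =
        clockedOutput A ν (searchInput x m rs) := by
    intro rs hrs
    obtain ⟨r1, r2⟩ := of_mem_randomStrings hrs
    rw [clockedOutput, hν]
    exact output_mono (hRC (searchInput x m rs) _ (hpos rs)).1 (hle rs (by omega) r2)
  have e' : ∀ i, ((randomStrings L (2 ^ j)).bind fun rs =>
      (output A C (searchInput x m rs) (searchInput x m rs).length (Tc.eval n)).map fun Y =>
        fit m (Y.drop (i * m))) = (randomStrings L (2 ^ j)).bind fun rs =>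
      (clockedOutput A ν (searchInput x m rs)).map fun Y => fit m (Y.drop (i * m)) :=
    fun i => pmf_bind_congr fun rs hrs => by rw [e rs hrs]
  rw [output_of_exec h3, h2]
  simp only [e']
  refine tvDist_le_of_prob (by positivity) fun E => ?_
  refine prob_extract_le hp hm hk hL ?_ (fun rs hrs => ?_) E
  · refine le_trans ?_ j1
    simp [hpp, add_assoc]
  · obtain ⟨r1, r2⟩ := of_mem_randomStrings hrs
    have hs := (hRC (searchInput x m rs) _ (hpos rs)).2
    rw [toOuterMeasure_eq_prob, hsol] at hs
    have hc : clockedOutput A ν (searchInput x m rs) = output A C (searchInput x m rs)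
        (searchInput x m rs).length
        (TC.eval ((searchInput x m rs).length + (searchInput x m rs).length)) := by
      rw [clockedOutput, hν]
    rw [← hc] at hs
    rw [← ENNReal.ofReal_toReal (prob_ne_top _ _)]
    refine ENNReal.ofReal_le_ofReal ?_
    rw [prob_toReal_compl]
    have hN : (2 ^ j : ℕ) ≤ (searchInput x m rs).length := by
      rw [length_searchInput r1 r2]
      have : 2 ^ j * 1 ≤ 2 ^ j * (2 * L + 1) := Nat.mul_le_mul_left _ (by omega)
      omega
    have hN' : 1 / ((searchInput x m rs).length : ℝ) ≤ 1 / ((2 ^ j : ℕ) : ℝ) :=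
      one_div_le_one_div_of_le (by positivity) (by exact_mod_cast hN)
    change 1 - _ ≤ (prob _ fun Y => Solution A p S.dist (searchInput x m rs) Y).toReal at hs
    linarith

theorem FBPPRel_eq_iff (A : Set (List Bool)) :
    FBPPRel A = FBQPRel A ↔ SampPRel A = SampBQPRel A :=
  ⟨SampPRel_eq_of_FBPPRel_eq, FBPPRel_eq_of_SampPRel_eq⟩

end SampSearch

end

theorem mainTheorem2 :
    (SampSearch.FBPP = SampSearch.FBQP ↔ SampSearch.SampP = SampSearch.SampBQP) ∧
    ∀ A : Set (List Bool),
      (SampSearch.FBPPRel A = SampSearch.FBQPRel A ↔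
        SampSearch.SampPRel A = SampSearch.SampBQPRel A) :=
  ⟨SampSearch.FBPPRel_eq_iff ∅, SampSearch.FBPPRel_eq_iff⟩
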